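/- **Setting.** Let $\mathcal L^2=L^2([0,1],dt)$, let $l^2$ be the space of real square-summable sequences with canonical basis $(x_n)$ and scalar product $x.y$, and let $(e_n)$ be a complete orthonormal basis of $\mathcal L^2$. For $\alpha>0$ put $I^\alpha_{0^+}f(x)=\frac1{\Gamma(\alpha)}\int_0^x f(t)(x-t)^{\alpha-1}dt$ and $I^\alpha_{1^-}f(x)=\frac1{\Gamma(\alpha)}\int_x^1 f(t)(t-x)^{\alpha-1}dt$, with $I^0_{0^+}=I^0_{1^-}=\mathrm{Id}$. Fix $0\le\beta<1/2$, and let $\mathcal I_{\beta,2}=I^\beta_{0^+}(\mathcal L^2)$ and $h_n^{1-\beta}=I^{1-\beta}_{1^-}e_n$. Let $\mathfrak J_\beta:\mathcal I_{\beta,2}\to l^2$ be the map $\mathfrak J_\beta\omega=\sum_n\big(\int_0^1h_n^{1-\beta}\,d\omega\big)x_n$, where $\int_0^1 h_n^{1-\beta}\,d\omega:=(e_n,I^{-\beta}_{0^+}\omega)_{\mathcal L^2}$. Let $m_\beta$ be the law on $l^2$ of $\mathfrak J_\beta(W)$, where $W$ is a standard Brownian motion on $[0,1]$ (almost surely $W\in\mathcal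 I_{\beta,2}$). For an integer $m\ge1$ and a Brownian motion $B$, let $B_m^\dagger$ be the linear interpolation of $B$ on $m$ intervals: $B_m^\dagger(0)=0$ and $dB_m^\dagger(t)=m\sum_{j=0}^{m-1}\big(B(\tfrac{j+1}m)-B(\tfrac jm)\big)\mathbf 1_{[j/m,(j+1)/m)}(t)\,dt$. Let $\nu_m^\dagger$ be the law of $\mathfrak J_\beta B_m^\dagger$ on $l^2$. Let $p_{F_m^\dagger}$ be the orthogonal projection of $\mathcal L^2$ onto the span of $e_j^m=\sqrt m\,\mathbf 1_{[j/m,(j+1)/m)}$, $0\le j<m$, and let $H_m^\dagger=\sum_n p_{F_m^\dagger}h_n^{1-\beta}\otimes x_n$. For a Hilbert space $X$, $\mathcal C^k_b(l^2;X)$ is the set of $k$ times Fréchet differentiable $F:l^2\to X$ with $\|F\|_{\mathcal C^k_b}=\sup_{1\le j\le k}\|\nabla^{(j)}F\|_\infty<\infty$, where $\|\nabla^{(j)}F\|_\infty=\sup_{x}\|\nabla^{(j)}F(x)\|_{X\otimes (l^2)^{\otimes j}}$ (Hilbert–Schmidt norms). For $H=\sum_n H_n\otimes x_n\in X\otimes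 l^2$, $\operatorname{trace}_X(H\otimes H)$ is the operator on $l^2$ with matrix $(\langle H_n,H_k\rangle_X)_{n,k}$. For $\alpha\ge0$, a probability measure $\nu$ on $l^2$ satisfies $\mathrm{Hyp}(X,H,\alpha)$ if for every $G\in\mathcal C^2_b(l^2;l^2)$ the integrals below converge and $$\Big|\int x.G(x)\,d\nu(x)-\int\operatorname{trace}\big(\operatorname{trace}_X(H\otimes H)\circ\nabla G(x)\big)d\nu(x)\Big|\le\alpha\,\|\nabla^{(2)}G\|_\infty .$$ Finally, $\rho_2(\nu,\mu)=\sup\{\int F\,d\nu-\int F\,d\mu:\ \|F\|_{\mathcal C^2_b(l^2;\mathbb R)}\le1\}$. **Theorem.** Let $0\le\beta<1/2$ and $m\ge1$. Then $B_m^\dagger\in\mathcal I_{\beta,2}$ for every sample path, almost surely $W\in\mathcal I_{\beta,2}$, $\nu_m^\dagger$ and $m_\beta$ are well-defined probability measures on $l^2$ which integrate every $F\in\mathcal C_b^2(l^2;\mathbb R)$, and $H_m^\dagger\in\mathcal L^2\otimes l^2$. The measure $\nu_m^\dagger$ satisfies $\mathrm{Hyp}(\mathcal L^2,H_m^\dagger,0)$,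 and $$\rho_2(\nu_m^\dagger,m_\beta)\le\frac{m^{2\beta-1}}{2(1-2\beta)\,\Gamma(1-\beta)^2}.$$ -/

import Mathlib

open MeasureTheory ProbabilityTheory Set
open scoped NNReal ENNReal lp InnerProductSpace

namespace BrownianStein

noncomputable section

/-! ### The spaces `L²([0,1])` and `l²` -/

/-- The Hilbert space `L²([0,1], dt)`. -/
abbrev L2 : Type := Lp ℝ 2 (volume.restrict (Icc (0 : ℝ) 1))

/-- The Hilbert space of real square-summable sequences. -/
abbrev l2 : Type := ℓ²(ℕ, ℝ)

instance instMeasurableSpaceSeq : MeasurableSpace l2 := borel l2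

instance instBorelSpaceSeq : BorelSpace l2 := ⟨rfl⟩

/-- The canonical orthonormal basis `(x_n)` of `l²`. -/
def basisVec (n : ℕ) : l2 := lp.single 2 n 1

/-! ### Fractional integrals and Besov-Liouville spaces -/

/-- The left fractional integral `I^α_{0+} f` on `[0,1]`, with `I^0_{0+} = Id`. -/
def fracIntLeft (α : ℝ) (f : ℝ → ℝ) (x : ℝ) : ℝ :=
  if α = 0 then f x else (1 / Real.Gamma α) * ∫ t in (0 : ℝ)..x, f t * (x - t) ^ (α - 1)

/-- The right fractional integral `I^α_{1-} f` on `[0,1]`, with `I^0_{1-} = Id`. -/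
def fracIntRight (α : ℝ) (f : ℝ → ℝ) (x : ℝ) : ℝ :=
  if α = 0 then f x else (1 / Real.Gamma α) * ∫ t in x..(1 : ℝ), f t * (t - x) ^ (α - 1)

/-- For `α > 1/2` the operator `I^α_{1-}` maps `L²([0,1])` into itself. -/
theorem memLp_fracIntRight {α : ℝ} (hα : 1 / 2 < α) (f : L2) :
    MemLp (fracIntRight α f) 2 (volume.restrict (Icc (0 : ℝ) 1)) := by
  have hα0 : α ≠ 0 := by linarith
  have hf2 : Integrable (fun t => (f t) ^ 2) (volume.restrict (Icc (0 : ℝ) 1)) :=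
    (Lp.memLp f).integrable_sq
  have hfm : AEStronglyMeasurable f (volume.restrict (Icc (0 : ℝ) 1)) :=
    (Lp.memLp f).aestronglyMeasurable
  have e1 : ∀ x ∈ Icc (0 : ℝ) 1, ∫ t in x..(1 : ℝ), f t * (t - x) ^ (α - 1)
      = ∫ t, (f t * (if x < t then (t - x) ^ (α - 1) else 0))
          ∂(volume.restrict (Icc (0 : ℝ) 1)) := by
    intro x hx
    rw [intervalIntegral.integral_of_le hx.2]
    have hsub : Ioc x 1 ⊆ Icc (0 : ℝ) 1 := fun t ht => ⟨hx.1.trans ht.1.le, ht.2⟩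
    rw [← inter_eq_self_of_subset_right hsub, ← setIntegral_indicator measurableSet_Ioc]
    refine setIntegral_congr_fun measurableSet_Icc fun t ht => ?_
    by_cases h : x < t
    · have : t ∈ Ioc x 1 := ⟨h, ht.2⟩
      simp [this, h]
    · have : t ∉ Ioc x 1 := fun h' => h h'.1
      simp [this, h]
  refine MemLp.of_bound ?_
    (|1 / Real.Gamma α| * (((∫ t in Icc (0 : ℝ) 1, (f t) ^ 2) + 1 / (2 * α - 1)) / 2)) ?_
  · have hm : AEStronglyMeasurable (fun x : ℝ => (1 / Real.Gamma α) *
        ∫ t, (f t * (if x < t then (t - x) ^ (α - 1) else 0))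
          ∂(volume.restrict (Icc (0 : ℝ) 1))) (volume.restrict (Icc (0 : ℝ) 1)) := by
      refine AEStronglyMeasurable.const_mul ?_ _
      refine AEStronglyMeasurable.integral_prod_right'
        (f := fun p : ℝ × ℝ => f p.2 * (if p.1 < p.2 then (p.2 - p.1) ^ (α - 1) else 0)) ?_
      refine AEStronglyMeasurable.mul hfm.comp_snd ?_
      refine Measurable.aestronglyMeasurable ?_
      exact Measurable.ite (measurableSet_lt measurable_fst measurable_snd)
        ((measurable_snd.sub measurable_fst).pow_const _) measurable_const
    refine hm.congr ?_
    filter_upwards [ae_restrict_mem measurableSet_Icc] with x hx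
    simp only [fracIntRight, hα0, if_false]
    rw [e1 x hx]
  · filter_upwards [ae_restrict_mem measurableSet_Icc] with x hx
    simp only [fracIntRight, hα0, if_false]
    rw [norm_mul, Real.norm_eq_abs (1 / Real.Gamma α)]
    refine mul_le_mul_of_nonneg_left ?_ (abs_nonneg _)
    have hsub : Ioc x 1 ⊆ Icc (0 : ℝ) 1 := fun t ht => ⟨hx.1.trans ht.1.le, ht.2⟩
    have hfi : IntervalIntegrable (fun t => (f t) ^ 2) volume x 1 := by
      rw [intervalIntegrable_iff_integrableOn_Ioc_of_le hx.2]
      exact IntegrableOn.mono_set hf2 hsub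
    have hki : IntervalIntegrable (fun t => (t - x) ^ (2 * α - 2)) volume x 1 := by
      have := (intervalIntegral.intervalIntegrable_rpow' (a := 0) (b := 1 - x)
        (r := 2 * α - 2) (by linarith)).comp_sub_right x
      simpa using this
    have hI1 : ∫ t in x..(1 : ℝ), (f t) ^ 2 ≤ ∫ t in Icc (0 : ℝ) 1, (f t) ^ 2 := by
      rw [intervalIntegral.integral_of_le hx.2]
      exact setIntegral_mono_set hf2 (Filter.Eventually.of_forall fun t => sq_nonneg _)
        hsub.eventuallyLE
    have hI2 : ∫ t in x..(1 : ℝ), (t - x) ^ (2 * α - 2) ≤ 1 / (2 * α - 1) := by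
      rw [intervalIntegral.integral_comp_sub_right (fun u => u ^ (2 * α - 2)) x, sub_self,
        integral_rpow (Or.inl (by linarith)), Real.zero_rpow (by linarith), sub_zero,
        show 2 * α - 2 + 1 = 2 * α - 1 by ring]
      refine div_le_div_of_nonneg_right ?_ (by linarith)
      exact Real.rpow_le_one (by linarith [hx.2]) (by linarith [hx.1]) (by linarith)
    calc ‖∫ t in x..(1 : ℝ), f t * (t - x) ^ (α - 1)‖
        ≤ ∫ t in x..(1 : ℝ), ((f t) ^ 2 + (t - x) ^ (2 * α - 2)) / 2 := by
          refine intervalIntegral.norm_integral_le_of_norm_le hx.2 ?_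
            ((hfi.add hki).div_const 2)
          refine Filter.Eventually.of_forall fun t ht => ?_
          have h0 : 0 < t - x := sub_pos.2 ht.1
          have hsq : (t - x) ^ (2 * α - 2) = ((t - x) ^ (α - 1)) ^ 2 := by
            rw [← Real.rpow_natCast, ← Real.rpow_mul h0.le]
            congr 1
            push_cast
            ring
          rw [hsq, norm_mul, Real.norm_eq_abs, Real.norm_eq_abs]
          nlinarith [sq_nonneg (|f t| - |(t - x) ^ (α - 1)|), sq_abs (f t),
            sq_abs ((t - x) ^ (α - 1))]
      _ = ((∫ t in x..(1 : ℝ), (f t) ^ 2) + ∫ t in x..(1 : ℝ), (t - x) ^ (2 * α - 2)) / 2 := by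
          rw [intervalIntegral.integral_div, intervalIntegral.integral_add hfi hki]
      _ ≤ _ := by linarith

/-- `IsFracDeriv β w f`: the path `w` equals `I^β_{0+} f` a.e. on `[0,1]`, i.e.
`f = I^{-β}_{0+} w`. Such an `f` is unique in `L²`, as `I^β_{0+}` is injective. -/
def IsFracDeriv (β : ℝ) (w : ℝ → ℝ) (f : L2) : Prop :=
  w =ᵐ[volume.restrict (Icc (0 : ℝ) 1)] fracIntLeft β f

/-- Membership of a path on `[0,1]` in the Besov-Liouville space `𝓘⁺_{β,2} = I^β_{0+}(L²)`. -/
def MemBesov (β : ℝ) (w : ℝ → ℝ) : Prop := ∃ f : L2, IsFracDeriv β w f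

/-- The inverse `I^{-β}_{0+} : 𝓘⁺_{β,2} → L²` (with value `0` outside `𝓘⁺_{β,2}`). -/
def fracDeriv (β : ℝ) (w : ℝ → ℝ) : L2 :=
  open Classical in if h : MemBesov β w then h.choose else 0

/-- The isometry `𝔍_β : 𝓘⁺_{β,2} → l²`, `𝔍_β w = ∑ₙ (∫₀¹ hₙ^{1-β} dw) xₙ`, where
`hₙ^{1-β} = I^{1-β}_{1-} eₙ` and, by definition,
`∫₀¹ h dw = (I^{-(1-β)}_{1-} h, I^{-β}_{0+} w)_{L²}`; so its `n`-th coordinate is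
`(eₙ, I^{-β}_{0+} w)_{L²}`. -/
def J (β : ℝ) (e : HilbertBasis ℕ ℝ L2) (w : ℝ → ℝ) : l2 := e.repr (fracDeriv β w)

theorem J_apply (β : ℝ) (e : HilbertBasis ℕ ℝ L2) (w : ℝ → ℝ) (n : ℕ) :
    J β e w n = ⟪e n, fracDeriv β w⟫_ℝ := e.repr_apply_apply _ _

/-- `hₙ^{1-β} = I^{1-β}_{1-} eₙ` as an element of `L²([0,1])`, for `β < 1/2`. -/
def hBasis (β : ℝ) (hβ : β < 1 / 2) (e : HilbertBasis ℕ ℝ L2) (n : ℕ) : L2 :=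
  (memLp_fracIntRight (α := 1 - β) (by linarith) (e n)).toLp _

/-! ### Tensor products, traces -/

section Tensor

variable {X : Type*} [NormedAddCommGroup X] [InnerProductSpace ℝ X]

/-- The elementary tensor `u ⊗ x`. The Hilbert tensor product `l² ⊗ X` is realised as the space
`ℓ²(ℕ, X)` of square-summable sequences in `X`; a sequence `(Hₙ)` stands for
`∑ₙ xₙ ⊗ Hₙ`. -/
def tmul (u : l2) (x : X) : ℓ²(ℕ, X) :=
  ⟨fun n => u n • x, by
    refine (memℓp_gen_iff (by norm_num)).2 ?_
    have hu := ((memℓp_gen_iff (p := 2) (by norm_num)).1 (lp.memℓp u)).mul_right (‖x‖ ^ (2 : ℝ))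
    refine hu.congr fun n => ?_
    simp [norm_smul, mul_pow]⟩

/-- An element `H` of `l² ⊗ X` seen as a bounded operator from `X` to `l²`,
`(u ⊗ x)(y) = ⟨x, y⟩ u`; in coordinates `y ↦ (⟨Hₙ, y⟩)ₙ`. -/
def toOp (H : ℓ²(ℕ, X)) : X →L[ℝ] l2 :=
  have hs : ∀ y : X, ∀ n, ‖⟪H n, y⟫_ℝ‖ ^ 2 ≤ ‖H n‖ ^ 2 * ‖y‖ ^ 2 := fun y n => by
    rw [← mul_pow]
    exact pow_le_pow_left₀ (norm_nonneg _) (norm_inner_le_norm _ _) 2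
  have hH : Summable fun n => ‖H n‖ ^ 2 := by
    simpa using (memℓp_gen_iff (p := 2) (by norm_num)).1 (lp.memℓp H)
  have hm : ∀ y : X, Memℓp (fun n => ⟪H n, y⟫_ℝ) 2 := fun y => by
    refine (memℓp_gen_iff (by norm_num)).2 ?_
    simpa using Summable.of_nonneg_of_le (fun n => sq_nonneg _) (hs y) (hH.mul_right _)
  LinearMap.mkContinuous
    { toFun := fun y => (⟨fun n => ⟪H n, y⟫_ℝ, hm y⟩ : l2)
      map_add' := fun y z => by
        ext n
        exact inner_add_right _ _ _
      map_smul' := fun c y => by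
        ext n
        exact real_inner_smul_right _ _ _ } ‖H‖ (fun y => by
      have h1 := lp.norm_rpow_eq_tsum (p := 2) (by norm_num)
        (⟨fun n => ⟪H n, y⟫_ℝ, hm y⟩ : l2)
      have h2 := lp.norm_rpow_eq_tsum (p := 2) (by norm_num) H
      simp only [ENNReal.toReal_ofNat, Real.rpow_ofNat] at h1 h2
      refine (sq_le_sq₀ (norm_nonneg _) (by positivity)).1 ?_
      have h3 : ‖H‖ ^ 2 * ‖y‖ ^ 2 = ∑' n, ‖H n‖ ^ 2 * ‖y‖ ^ 2 := by rw [h2, tsum_mul_right]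
      change ‖(⟨fun n => ⟪H n, y⟫_ℝ, hm y⟩ : l2)‖ ^ 2 ≤ (‖H‖ * ‖y‖) ^ 2
      rw [h1, mul_pow, h3]
      exact Summable.tsum_le_tsum (hs y)
        (Summable.of_nonneg_of_le (fun n => sq_nonneg _) (hs y) (hH.mul_right _))
        (hH.mul_right _))

theorem toOp_apply (H : ℓ²(ℕ, X)) (y : X) (n : ℕ) : toOp H y n = ⟪H n, y⟫_ℝ := rfl

variable [CompleteSpace X]

/-- The partial trace `trace_X (H ⊗ H)`, an operator on `l²`: it is `H H*`, with matrix entries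
`⟨Hₙ, Hₖ⟩_X`. See `partialTrace_spec` for the comparison with the general partial trace. -/
def partialTrace (H : ℓ²(ℕ, X)) : l2 →L[ℝ] l2 :=
  toOp H ∘L ContinuousLinearMap.adjoint (toOp H)

/-- `partialTrace H` is the partial trace along `X` of the operator `H ⊗ H : K ↦ ⟨H, K⟩ H` of
`l² ⊗ X`, computed in an arbitrary orthonormal basis `f` of `X`. -/
theorem partialTrace_spec {ι : Type*} (f : HilbertBasis ι ℝ X) (H : ℓ²(ℕ, X)) (u v : l2) :
    HasSum (fun i => ⟪tmul u (f i), InnerProductSpace.rankOne ℝ H H (tmul v (f i))⟫_ℝ)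
      ⟪u, partialTrace H v⟫_ℝ := by
  have key : ∀ (w : l2) (x : X), ⟪tmul w x, H⟫_ℝ = ⟪w, toOp H x⟫_ℝ := fun w x => by
    rw [lp.inner_eq_tsum, lp.inner_eq_tsum]
    refine tsum_congr fun n => ?_
    rw [toOp_apply]
    show ⟪w n • x, H n⟫_ℝ = ⟪H n, x⟫_ℝ * w n
    rw [real_inner_smul_left, real_inner_comm, mul_comm]
  have e1 : ∀ i, ⟪tmul u (f i), InnerProductSpace.rankOne ℝ H H (tmul v (f i))⟫_ℝ
      = ⟪ContinuousLinearMap.adjoint (toOp H) u, f i⟫_ℝ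
        * ⟪f i, ContinuousLinearMap.adjoint (toOp H) v⟫_ℝ := fun i => by
    rw [InnerProductSpace.rankOne_apply, real_inner_smul_right, key, real_inner_comm, key,
      ContinuousLinearMap.adjoint_inner_left, ContinuousLinearMap.adjoint_inner_right,
      real_inner_comm v, mul_comm]
  have e2 : ⟪u, partialTrace H v⟫_ℝ = ⟪ContinuousLinearMap.adjoint (toOp H) u,
      ContinuousLinearMap.adjoint (toOp H) v⟫_ℝ :=
    (ContinuousLinearMap.adjoint_inner_left (toOp H) _ u).symm
  rw [e2]
  simp only [e1]
  exact f.hasSum_inner_mul_inner _ _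

end Tensor

/-- The trace of a (trace-class) operator on `l²`. -/
def trace (A : l2 →L[ℝ] l2) : ℝ := ∑' n, ⟪A (basisVec n), basisVec n⟫_ℝ

/-! ### Test functions, `Hyp` and the distances `ρ_j` -/

section TestFunctions

variable {X : Type*} [NormedAddCommGroup X] [InnerProductSpace ℝ X]

/-- The (Hilbert-Schmidt) norm of `X ⊗ (l²)^{⊗ j}`, of a `j`-linear map from `l²` to `X`. -/
def hsNorm {j : ℕ} (T : ContinuousMultilinearMap ℝ (fun _ : Fin j => l2) X) : ℝ≥0∞ :=
  (∑' i : Fin j → ℕ, ‖T fun a => basisVec (i a)‖ₑ ^ 2) ^ (1 / 2 : ℝ)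

/-- `‖∇^{(j)} F‖_∞ = sup_x ‖∇^{(j)} F(x)‖_{X ⊗ (l²)^{⊗ j}}`. -/
def derivSupNorm (j : ℕ) (F : l2 → X) : ℝ≥0∞ := ⨆ x : l2, hsNorm (iteratedFDeriv ℝ j F x)

/-- `‖F‖_{C^k_b(l²; X)} = sup_{1 ≤ j ≤ k} ‖∇^{(j)} F‖_∞`. -/
def cbNorm (k : ℕ) (F : l2 → X) : ℝ≥0∞ := ⨆ j ∈ Finset.Icc 1 k, derivSupNorm j F

/-- `F ∈ C^k_b(l²; X)`: `F` is `k` times Fréchet differentiable with bounded derivatives. -/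
def MemCb (k : ℕ) (F : l2 → X) : Prop :=
  (∀ j < k, Differentiable ℝ (iteratedFDeriv ℝ j F)) ∧ cbNorm k F < ⊤

variable [CompleteSpace X]

/-- The property `Hyp(X, H, α)` of a measure `ν` on `l²`. -/
def Hyp (H : ℓ²(ℕ, X)) (α : ℝ≥0) (ν : Measure l2) : Prop :=
  ∀ G : l2 → l2, MemCb 2 G →
    Integrable (fun x => ⟪x, G x⟫_ℝ) ν ∧
    Integrable (fun x => trace (partialTrace H ∘L fderiv ℝ G x)) ν ∧
    ENNReal.ofReal |(∫ x, ⟪x, G x⟫_ℝ ∂ν) - ∫ x, trace (partialTrace H ∘L fderiv ℝ G x) ∂ν|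
      ≤ α * derivSupNorm 2 G

end TestFunctions

/-- `ρ_j(ν, μ) = sup { ∫ F dν - ∫ F dμ : ‖F‖_{C^j_b(l²; ℝ)} ≤ 1 }`. -/
def rho (j : ℕ) (ν μ : Measure l2) : EReal :=
  ⨆ F : {F : l2 → ℝ // MemCb j F ∧ cbNorm j F ≤ 1},
    (((∫ x, F.1 x ∂ν) - ∫ x, F.1 x ∂μ : ℝ) : EReal)

/-! ### Brownian motion, its linear interpolation and their laws on `l²` -/

/-- The path `t ↦ B(t)` of a process indexed by the nonnegative reals (only its values at
`t ∈ [0,1]` are used). -/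
def path {Ω : Type*} (B : ℝ≥0 → Ω → ℝ) (ω : Ω) (t : ℝ) : ℝ := B t.toNNReal ω

/-- The piecewise linear interpolation `w_m` of `w` on `m` intervals: `w_m(0) = 0` and
`dw_m(t) = m ∑_{j<m} (w((j+1)/m) - w(j/m)) 1_{[j/m,(j+1)/m)}(t) dt`. -/
def linInterp (m : ℕ) (w : ℝ → ℝ) (t : ℝ) : ℝ :=
  ∫ s in (0 : ℝ)..t, m * ∑ j ∈ Finset.range m,
    (w ((j + 1) / m) - w (j / m)) * (Ico ((j : ℝ) / m) ((j + 1) / m)).indicator 1 s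

/-- `ν_m^†`, the law on `l²` of `𝔍_β` applied to the linear interpolation of `B`. -/
def nuDagger {Ω : Type*} [MeasurableSpace Ω] (P : Measure Ω) (B : ℝ≥0 → Ω → ℝ) (β : ℝ)
    (e : HilbertBasis ℕ ℝ L2) (m : ℕ) : Measure l2 :=
  P.map fun ω => J β e (linInterp m (path B ω))

/-- `m_β`, the image under `𝔍_β` of the law of the Brownian motion `W` on `𝓘_{β,2}`. -/
def mBeta {Ω : Type*} [MeasurableSpace Ω] (P : Measure Ω) (W : ℝ≥0 → Ω → ℝ) (β : ℝ)
    (e : HilbertBasis ℕ ℝ L2) : Measure l2 :=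
  P.map fun ω => J β e (path W ω)

/-- `e_j^m = √m 1_{[j/m,(j+1)/m)}`, as an element of `L²([0,1])`. -/
def eStep (m j : ℕ) : L2 :=
  indicatorConstLp 2 (measurableSet_Ico (a := (j : ℝ) / m) (b := (j + 1) / m))
    (measure_ne_top _ _) (Real.sqrt m)

/-- `F_m^† = span (e_0^m, …, e_{m-1}^m)`. -/
def FDagger (m : ℕ) : Submodule ℝ L2 :=
  Submodule.span ℝ (Set.range fun j : Fin m => eStep m j)

instance instFiniteDimensionalFDagger (m : ℕ) : FiniteDimensional ℝ (FDagger m) :=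
  FiniteDimensional.span_of_finite ℝ (Set.finite_range _)

/-- The coordinates of `H_m^† = ∑ₙ p_{F_m^†} hₙ^{1-β} ⊗ xₙ`. -/
def HDagger (β : ℝ) (hβ : β < 1 / 2) (e : HilbertBasis ℕ ℝ L2) (m : ℕ) (n : ℕ) : L2 :=
  (FDagger m).starProjection (hBasis β hβ e n)

end

end BrownianStein

open BrownianStein

/-! A hinge `max (x - a) 0` is `I^β_{0+}` of the explicit function `hingeDeriv β a`, so the
fractional derivative of the interpolation is the finite Gaussian sum `interpDeriv`, namely `∑ j, (m
ΔB_j) • cellVec j` with `cellVec j = I^{1-β}_{0+} 1_{cell j}`. Injectivity of `I^β_{0+}` (Abel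
inversion) identifies this sum with `fracDeriv`.

For `Hyp` with `α = 0`: exchanging integrals gives `⟪e_j^m, h_n⟫ = √m ⟪cellVec j, e n⟫`, so with
`v_j = stepCoord` one has `H_m^† = ∑ j, v_j ⊗ e_j^m` and `trace_X (H ⊗ H) = ∑ j, v_j ⊗ v_j`. This is
the covariance of `∑ j, (√m ΔB_j) • v_j`, the image of the interpolation under `𝔍_β`. The identity
is then Gaussian integration by parts in each independent increment (`hyp_nuDagger`).

The distance bound does not go through `Hyp`; it couples a Brownian path with its own
interpolations. On refining `m` cells into `m * q`, the derivative changes by a combination of the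
residuals `fineDev`, which are uncorrelated with the coarse increments, hence independent of them.
In a second order Taylor expansion at the coarse level the linear term therefore has mean zero, and
the remainder is at most half the derivative bound times `E‖difference‖²`. By Pythagoras this second
moment is the gain in `interpEnergy`. Two-sided estimates place the energy at level `m` between `K
(1/(2-2β) - m^(2β-1))` and `K/(2-2β)`, where `K = 1/((1-2β) Γ(1-β)²)`; thus no refinement gains more
than `K m^(2β-1)`, and half of this is the constant of the theorem.

The same energy estimate makes the changes along `m * 2 ^ k` summable in mean. The derivatives
converge almost surely and in `L¹`; since the interpolations converge pointwise to the continuous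
path, closedness of `I^β_{0+}` (`IsFracDeriv.of_tendsto`) shows that the limit is `fracDeriv β (path
W ω)`. Finally `nuDagger` depends only on finite-dimensional marginals, so `B` may be replaced by
`W` and both laws live on one space. -/

namespace BrownianStein

/-! ### Beta integrals and truncated power kernels -/

/-- Lebesgue measure on `[0,1]`. -/
noncomputable abbrev unitVolume : Measure ℝ := volume.restrict (Icc (0 : ℝ) 1)

theorem integral_rpow_mul_rpow {p q a c : ℝ} (hp : 0 < p) (hq : 0 < q) (hac : a < c) :
    ∫ t in a..c, (t - a) ^ (p - 1) * (c - t) ^ (q - 1) = (c - a) ^ (p + q - 1) * beta p q := by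
  have h1 : ∫ t in a..c, (t - a) ^ (p - 1) * (c - t) ^ (q - 1)
      = ∫ t in (0 : ℝ)..(c - a), t ^ (p - 1) * ((c - a) - t) ^ (q - 1) := by
    have := intervalIntegral.integral_comp_sub_right (a := a) (b := c)
      (fun t => t ^ (p - 1) * ((c - a) - t) ^ (q - 1)) a
    rw [sub_self] at this
    rw [← this]
    congr 1
    ext t
    congr 2
    ring
  rw [h1]
  have hb : 0 < c - a := sub_pos.2 hac
  have h2 := Complex.betaIntegral_scaled p q hb
  have h3 : (beta p q : ℂ) = Complex.betaIntegral p q := by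
    rw [Complex.betaIntegral_eq_Gamma_mul_div, beta]
    · push_cast [Complex.Gamma_ofReal, ← Complex.ofReal_add]
      rfl
    all_goals simpa
  rw [← h3] at h2
  apply Complex.ofReal_injective
  rw [Complex.ofReal_mul, Complex.ofReal_cpow hb.le, ← intervalIntegral.integral_ofReal]
  push_cast at h2 ⊢
  rw [← h2]
  refine intervalIntegral.integral_congr fun t ht => ?_
  rw [uIcc_of_le hb.le] at ht
  simp only [Complex.ofReal_cpow ht.1,
    Complex.ofReal_cpow (show 0 ≤ c - a - t by linarith [ht.2])]
  push_cast
  rfl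

theorem beta_one_right {p : ℝ} (hp : 0 < p) : beta p 1 = 1 / p := by
  rw [beta, Real.Gamma_add_one hp.ne', Real.Gamma_one]
  have := (Real.Gamma_pos_of_pos hp).ne'
  field_simp

/-- A non-integrable function has integral zero by convention, whereas the Beta value computed above
is positive. -/
theorem intervalIntegrable_rpow_mul_rpow {p q a c : ℝ} (hp : 0 < p) (hq : 0 < q) (hac : a < c) :
    IntervalIntegrable (fun t => (t - a) ^ (p - 1) * (c - t) ^ (q - 1)) volume a c := by
  by_contra h
  have h1 := integral_rpow_mul_rpow hp hq hac
  rw [intervalIntegral.integral_undef h] at h1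
  exact (mul_pos (Real.rpow_pos_of_pos (sub_pos.2 hac) _) (beta_pos hp hq)).ne h1

/-- The kernel `(x - t)_+^{α - 1}`. -/
noncomputable def kern (α x t : ℝ) : ℝ := if t < x then (x - t) ^ (α - 1) else 0

theorem measurable_kern (α : ℝ) : Measurable (fun p : ℝ × ℝ => kern α p.1 p.2) :=
  Measurable.ite (measurableSet_lt measurable_snd measurable_fst)
    ((measurable_fst.sub measurable_snd).pow_const _) measurable_const

theorem kern_nonneg (α x t : ℝ) : 0 ≤ kern α x t := by
  unfold kern
  split_ifs with h
  · exact Real.rpow_nonneg (sub_pos.2 h).le _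
  · exact le_rfl

theorem kern_mul_kern_eq_indicator (p q a c t : ℝ) :
    kern p t a * kern q c t
      = (Ioo a c).indicator (fun t => (t - a) ^ (p - 1) * (c - t) ^ (q - 1)) t := by
  unfold kern
  by_cases h1 : a < t <;> by_cases h2 : t < c <;> simp [h1, h2]

theorem setIntegral_indicator_Ioo {a c : ℝ} (ha : 0 ≤ a) (hc : c ≤ 1) (f : ℝ → ℝ) :
    ∫ t, (Ioo a c).indicator f t ∂unitVolume = ∫ t in Ioo a c, f t := by
  rw [setIntegral_indicator measurableSet_Ioo, inter_eq_self_of_subset_right]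
  exact fun t ht => ⟨ha.trans ht.1.le, ht.2.le.trans hc⟩

/-- The semigroup law `I^p I^q = I^{p+q}` at the level of kernels; every later exchange of
fractional integrals reduces to this Beta integral. -/
theorem integral_kern_mul_kern {p q a c : ℝ} (hp : 0 < p) (hq : 0 < q) (ha : 0 ≤ a) (hc : c ≤ 1) :
    ∫ t, kern p t a * kern q c t ∂unitVolume
      = if a < c then (c - a) ^ (p + q - 1) * beta p q else 0 := by
  rw [setIntegral_congr_fun measurableSet_Icc (fun t _ => kern_mul_kern_eq_indicator p q a c t),
    setIntegral_indicator_Ioo ha hc]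
  split_ifs with h
  · rw [← integral_rpow_mul_rpow hp hq h, intervalIntegral.integral_of_le h.le,
      integral_Ioc_eq_integral_Ioo]
  · rw [Ioo_eq_empty h]
    simp

theorem integrable_kern_mul_kern {p q a c : ℝ} (hp : 0 < p) (hq : 0 < q) :
    Integrable (fun t => kern p t a * kern q c t) unitVolume := by
  have : IntegrableOn ((Ioo a c).indicator (fun t => (t - a) ^ (p - 1) * (c - t) ^ (q - 1)))
      (Icc (0 : ℝ) 1) := by
    refine Integrable.integrableOn ?_
    rw [integrable_indicator_iff measurableSet_Ioo]
    rcases lt_or_ge a c with h | h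
    · exact ((intervalIntegrable_iff_integrableOn_Ioo_of_le h.le).1
        (intervalIntegrable_rpow_mul_rpow hp hq h))
    · simp [Ioo_eq_empty h.not_gt]
  exact this.congr_fun (fun t _ => (kern_mul_kern_eq_indicator p q a c t).symm) measurableSet_Icc

theorem kern_one {x t : ℝ} (h : t < x) : kern 1 x t = 1 := by simp [kern, h]

theorem integral_kern {p a : ℝ} (hp : 0 < p) (ha : a ∈ Ico (0 : ℝ) 1) :
    Integrable (fun t => kern p t a) unitVolume ∧
      ∫ t, kern p t a ∂unitVolume = (1 - a) ^ p / p := by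
  have h1 := integrable_kern_mul_kern (a := a) (c := 1) hp one_pos
  have h2 := integral_kern_mul_kern hp one_pos ha.1 le_rfl
  -- The kernel of exponent one ending at `1` equals one except at `t = 1`, so this is the case `q =
  -- 1`, `c = 1` of the Beta integral.
  have h3 : (fun t => kern p t a * kern 1 1 t) =ᵐ[unitVolume] fun t => kern p t a := by
    have : ∀ᵐ t ∂unitVolume, t ≠ 1 := ae_restrict_of_ae (by simp [ae_iff])
    filter_upwards [this, ae_restrict_mem measurableSet_Icc] with t h1 h2
    rw [kern_one (lt_of_le_of_ne h2.2 h1), mul_one]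
  refine ⟨h1.congr h3, ?_⟩
  rw [← integral_congr_ae h3, h2, if_pos ha.2, beta_one_right hp]
  rw [show p + 1 - 1 = p by ring]
  ring

/-! ### The fractional integral as an operator on L¹, and Abel inversion -/

theorem fracIntLeft_eq_integral_kern {α : ℝ} (h0 : α ≠ 0) (f : ℝ → ℝ) {x : ℝ}
    (hx : x ∈ Icc (0 : ℝ) 1) :
    fracIntLeft α f x = (1 / Real.Gamma α) * ∫ t, kern α x t * f t ∂unitVolume := by
  rw [fracIntLeft, if_neg h0, intervalIntegral.integral_of_le hx.1, integral_Ioc_eq_integral_Ioo]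
  congr 1
  rw [← setIntegral_indicator_Ioo le_rfl hx.2]
  have h0 : ∀ᵐ t ∂unitVolume, t ≠ 0 := ae_restrict_of_ae (by simp [ae_iff])
  refine integral_congr_ae ?_
  filter_upwards [h0, ae_restrict_mem measurableSet_Icc] with t h1 h2
  have : 0 < t := lt_of_le_of_ne h2.1 h1.symm
  by_cases h : t < x <;> simp [kern, h, this, mul_comm]

theorem ae_ne_one : ∀ᵐ t ∂unitVolume, t ≠ 1 := ae_restrict_of_ae (by simp [ae_iff])

theorem integrable_prod_kern {α : ℝ} (hα : 0 < α) {f : ℝ → ℝ} (hf : Integrable f unitVolume) :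
    Integrable (fun p : ℝ × ℝ => kern α p.1 p.2 * f p.2) (unitVolume.prod unitVolume) := by
  have hm : AEStronglyMeasurable (fun p : ℝ × ℝ => kern α p.1 p.2 * f p.2)
      (unitVolume.prod unitVolume) :=
    (measurable_kern α).aestronglyMeasurable.mul hf.aestronglyMeasurable.comp_snd
  rw [integrable_prod_iff' hm]
  constructor
  · filter_upwards [ae_ne_one, ae_restrict_mem measurableSet_Icc] with t h1 h2
    exact (integral_kern hα ⟨h2.1, lt_of_le_of_ne h2.2 h1⟩).1.mul_const _
  · have : Integrable (fun t => (1 - t) ^ α / α * ‖f t‖) unitVolume := by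
      refine Integrable.bdd_mul (c := 1 / α) hf.norm
        (by fun_prop (disch := exact hα.le)) ?_
      filter_upwards [ae_restrict_mem measurableSet_Icc] with t h2
      have : 0 ≤ 1 - t := by linarith [h2.2]
      rw [Real.norm_of_nonneg (by positivity)]
      gcongr
      exact Real.rpow_le_one this (by linarith [h2.1]) hα.le
    refine this.congr ?_
    filter_upwards [ae_ne_one, ae_restrict_mem measurableSet_Icc] with t h1 h2
    simp_rw [norm_mul, Real.norm_of_nonneg (kern_nonneg _ _ _)]
    rw [integral_mul_const, (integral_kern hα ⟨h2.1, lt_of_le_of_ne h2.2 h1⟩).2]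

/-- For fixed `t`, the kernel has mass `(1 - t) ^ α / α ≤ 1 / α` in `x`; Tonelli turns this into an
`L¹` operator bound. -/
theorem integral_abs_integral_kern_le {α : ℝ} (hα : 0 < α) {f : ℝ → ℝ}
    (hf : Integrable f unitVolume) :
    ∫ x, |∫ t, kern α x t * f t ∂unitVolume| ∂unitVolume ≤ (1 / α) * ∫ t, |f t| ∂unitVolume := by
  have hi := integrable_prod_kern hα hf
  calc ∫ x, |∫ t, kern α x t * f t ∂unitVolume| ∂unitVolume
      ≤ ∫ x, ∫ t, ‖kern α x t * f t‖ ∂unitVolume ∂unitVolume := by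
        refine integral_mono_of_nonneg (Filter.Eventually.of_forall fun _ => abs_nonneg _)
          hi.integral_norm_prod_left (Filter.Eventually.of_forall fun x => ?_)
        exact norm_integral_le_integral_norm (fun t => kern α x t * f t)
    _ = ∫ t, ∫ x, ‖kern α x t * f t‖ ∂unitVolume ∂unitVolume :=
        integral_integral_swap (f := fun x t => ‖kern α x t * f t‖) hi.norm
    _ ≤ ∫ t, (1 / α) * |f t| ∂unitVolume := by
        refine integral_mono_ae hi.integral_norm_prod_right (hf.abs.const_mul _) ?_
        filter_upwards [ae_ne_one, ae_restrict_mem measurableSet_Icc] with t h1 h2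
        simp_rw [norm_mul, Real.norm_of_nonneg (kern_nonneg _ _ _)]
        rw [integral_mul_const, (integral_kern hα ⟨h2.1, lt_of_le_of_ne h2.2 h1⟩).2]
        have : 0 ≤ 1 - t := by linarith [h2.2]
        refine mul_le_mul_of_nonneg_right ?_ (norm_nonneg _)
        gcongr
        exact Real.rpow_le_one this (by linarith [h2.1]) hα.le
    _ = _ := integral_const_mul _ _

theorem ae_integrable_kern {α : ℝ} (hα : 0 < α) {f : ℝ → ℝ} (hf : Integrable f unitVolume) :
    ∀ᵐ x ∂unitVolume, Integrable (fun t => kern α x t * f t) unitVolume :=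
  (integrable_prod_kern hα hf).prod_right_ae

/-- `I^{1-α}_{0+} I^α_{0+} = I^1_{0+}`, up to normalisation. -/
theorem integral_kern_integral_kern {α c : ℝ} (hα : 0 < α) (hα1 : α < 1) (hc : c ≤ 1) {f : ℝ → ℝ}
    (hf : Integrable f unitVolume) :
    ∫ s, kern (1 - α) c s * ∫ t, kern α s t * f t ∂unitVolume ∂unitVolume
      = beta α (1 - α) * ∫ t, (Iio c).indicator f t ∂unitVolume := by
  have hm : AEStronglyMeasurable (fun p : ℝ × ℝ => kern (1 - α) c p.1 * (kern α p.1 p.2 * f p.2))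
      (unitVolume.prod unitVolume) :=
    ((measurable_kern _).comp (measurable_const.prodMk measurable_fst)).aestronglyMeasurable.mul
      ((measurable_kern α).aestronglyMeasurable.mul hf.aestronglyMeasurable.comp_snd)
  have hβ : 0 < 1 - α := by linarith
  have key : ∀ t ∈ Icc (0 : ℝ) 1, ∫ s, kern (1 - α) c s * kern α s t ∂unitVolume
      = (Iio c).indicator (fun _ => beta α (1 - α)) t := by
    intro t ht
    simp_rw [mul_comm (kern (1 - α) c _)]
    rw [integral_kern_mul_kern hα hβ ht.1 hc]
    by_cases h : t < c
    · simp [h]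
    · simp [h]
  have hi : Integrable (fun p : ℝ × ℝ => kern (1 - α) c p.1 * (kern α p.1 p.2 * f p.2))
      (unitVolume.prod unitVolume) := by
    rw [integrable_prod_iff' hm]
    constructor
    · filter_upwards [ae_restrict_mem measurableSet_Icc] with t h2
      refine ((integrable_kern_mul_kern (a := t) (c := c) hα hβ).mul_const (f t)).congr
        (Filter.Eventually.of_forall fun s => ?_)
      ring
    · have : Integrable (fun t => (Iio c).indicator (fun _ => beta α (1 - α)) t * ‖f t‖)
          unitVolume := by
        refine Integrable.bdd_mul (c := |beta α (1 - α)|) hf.norm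
          (measurable_const.indicator measurableSet_Iio).aestronglyMeasurable ?_
        exact Filter.Eventually.of_forall fun t => norm_indicator_le_norm_self _ _
      refine this.congr ?_
      filter_upwards [ae_restrict_mem measurableSet_Icc] with t h2
      rw [← key t h2, ← integral_mul_const]
      refine integral_congr_ae (Filter.Eventually.of_forall fun s => ?_)
      simp only [norm_mul, Real.norm_of_nonneg (kern_nonneg _ _ _), mul_assoc]
  calc ∫ s, kern (1 - α) c s * ∫ t, kern α s t * f t ∂unitVolume ∂unitVolume
      = ∫ s, ∫ t, kern (1 - α) c s * (kern α s t * f t) ∂unitVolume ∂unitVolume := by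
        simp_rw [integral_const_mul]
    _ = ∫ t, ∫ s, kern (1 - α) c s * (kern α s t * f t) ∂unitVolume ∂unitVolume :=
        integral_integral_swap (f := fun s t => kern (1 - α) c s * (kern α s t * f t)) hi
    _ = ∫ t, beta α (1 - α) * (Iio c).indicator f t ∂unitVolume := by
        refine setIntegral_congr_fun measurableSet_Icc fun t ht => ?_
        simp_rw [← mul_assoc]
        rw [integral_mul_const, key t ht]
        by_cases h : t < c <;> simp [h]
    _ = _ := integral_const_mul _ _

/-- The primitive of `f` vanishes identically on `[0,1]`, and by Lebesgue differentiation its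
derivative is `f` almost everywhere. -/
theorem ae_eq_zero_of_integral_indicator_Iio {f : ℝ → ℝ} (hf : Integrable f unitVolume)
    (h : ∀ c ∈ Icc (0 : ℝ) 1, ∫ t, (Iio c).indicator f t ∂unitVolume = 0) :
    f =ᵐ[unitVolume] 0 := by
  have hI : IntervalIntegrable f volume 0 1 :=
    (intervalIntegrable_iff_integrableOn_Icc_of_le zero_le_one).2 hf
  have h0 : ∀ x ∈ Icc (0 : ℝ) 1, ∫ t in (0 : ℝ)..x, f t = 0 := by
    intro x hx
    refine Eq.trans ?_ (h x hx)
    rw [intervalIntegral.integral_of_le hx.1, ← integral_Icc_eq_integral_Ioc,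
      setIntegral_indicator measurableSet_Iio, integral_Icc_eq_integral_Ico]
    congr 2
    ext t
    simp only [mem_Ico, mem_inter_iff, mem_Icc, mem_Iio]
    constructor
    · exact fun h => ⟨⟨h.1, h.2.le.trans hx.2⟩, h.2⟩
    · exact fun h => ⟨h.1.1, h.2⟩
  have hd := hI.ae_hasDerivAt_integral
  have hz : ∀ᵐ t ∂unitVolume, t ≠ 0 := ae_restrict_of_ae (by simp [ae_iff])
  filter_upwards [ae_restrict_of_ae hd, ae_ne_one, hz, ae_restrict_mem measurableSet_Icc]
    with x hx h1 h2 hm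
  rw [uIcc_of_le zero_le_one] at hx
  have hx' := hx hm 0 ⟨le_rfl, zero_le_one⟩
  have : HasDerivAt (fun x => ∫ t in (0 : ℝ)..x, f t) 0 x := by
    refine (hasDerivAt_const x (0 : ℝ)).congr_of_eventuallyEq ?_
    filter_upwards [Ioo_mem_nhds (lt_of_le_of_ne hm.1 h2.symm) (lt_of_le_of_ne hm.2 h1)] with y hy
    exact h0 y ⟨hy.1.le, hy.2.le⟩
  exact hx'.unique this

end BrownianStein

/-! ### Fractional derivatives: linearity, uniqueness, closedness -/

namespace BrownianStein

open Filter Topology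

theorem integrable_coe_L2 (f : L2) : Integrable f unitVolume :=
  (Lp.memLp f).integrable (by norm_num)

theorem fracIntLeft_zero_left (f : ℝ → ℝ) : fracIntLeft 0 f = f := by
  ext x
  simp [fracIntLeft]

theorem fracIntLeft_congr_ae {β : ℝ} {f g : ℝ → ℝ} (h : f =ᵐ[unitVolume] g) :
    fracIntLeft β f =ᵐ[unitVolume] fracIntLeft β g := by
  by_cases h0 : β = 0
  · subst h0
    rwa [fracIntLeft_zero_left, fracIntLeft_zero_left]
  · filter_upwards [ae_restrict_mem measurableSet_Icc] with x hx
    rw [fracIntLeft_eq_integral_kern h0 _ hx, fracIntLeft_eq_integral_kern h0 _ hx]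
    congr 1
    refine integral_congr_ae ?_
    filter_upwards [h] with t ht
    rw [ht]

theorem fracIntLeft_add_const_mul {β : ℝ} (hβ : 0 ≤ β) {f g : ℝ → ℝ}
    (hf : Integrable f unitVolume) (hg : Integrable g unitVolume) (c : ℝ) :
    fracIntLeft β (fun t => f t + c * g t) =ᵐ[unitVolume]
      fun x => fracIntLeft β f x + c * fracIntLeft β g x := by
  rcases hβ.eq_or_lt with h0 | h0
  · subst h0
    simp only [fracIntLeft_zero_left]
    rfl
  · filter_upwards [ae_restrict_mem measurableSet_Icc, ae_integrable_kern h0 hf,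
      ae_integrable_kern h0 hg] with x hx h1 h2
    simp only [fracIntLeft_eq_integral_kern h0.ne' _ hx]
    rw [mul_left_comm, ← mul_add, ← integral_const_mul c, ← integral_add h1 (h2.const_mul c)]
    congr 2
    ext t
    ring

theorem aestronglyMeasurable_fracIntLeft {β : ℝ} (hβ : 0 ≤ β) {f : ℝ → ℝ}
    (hf : Integrable f unitVolume) : AEStronglyMeasurable (fracIntLeft β f) unitVolume := by
  rcases hβ.eq_or_lt with h0 | h0
  · subst h0
    rw [fracIntLeft_zero_left]
    exact hf.aestronglyMeasurable
  · have := ((integrable_prod_kern h0 hf).aestronglyMeasurable.integral_prod_right').const_mul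
      (1 / Real.Gamma β)
    refine this.congr ?_
    filter_upwards [ae_restrict_mem measurableSet_Icc] with x hx
    rw [fracIntLeft_eq_integral_kern h0.ne' _ hx]

theorem exists_eLpNorm_fracIntLeft_le {β : ℝ} (hβ : 0 ≤ β) :
    ∃ C : ℝ, 0 ≤ C ∧ ∀ f : ℝ → ℝ, Integrable f unitVolume →
      eLpNorm (fracIntLeft β f) 1 unitVolume ≤ ENNReal.ofReal C * eLpNorm f 1 unitVolume := by
  rcases hβ.eq_or_lt with h0 | h0
  · subst h0
    refine ⟨1, zero_le_one, fun f _ => ?_⟩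
    simp [fracIntLeft_zero_left]
  · have hG : 0 < Real.Gamma β := Real.Gamma_pos_of_pos h0
    refine ⟨1 / Real.Gamma β * (1 / β), by positivity, fun f hf => ?_⟩
    have h1 : eLpNorm (fracIntLeft β f) 1 unitVolume
        = eLpNorm (fun x => (1 / Real.Gamma β) * ∫ t, kern β x t * f t ∂unitVolume) 1
          unitVolume := by
      refine eLpNorm_congr_ae ?_
      filter_upwards [ae_restrict_mem measurableSet_Icc] with x hx
      exact fracIntLeft_eq_integral_kern h0.ne' _ hx
    have h2 := ((integrable_prod_kern h0 hf).integral_prod_left.const_mul (1 / Real.Gamma β))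
    rw [h1, eLpNorm_one_eq_lintegral_enorm, eLpNorm_one_eq_lintegral_enorm,
      ← ofReal_integral_norm_eq_lintegral_enorm h2, ← ofReal_integral_norm_eq_lintegral_enorm hf,
      ← ENNReal.ofReal_mul (by positivity)]
    refine ENNReal.ofReal_le_ofReal ?_
    simp only [norm_mul, Real.norm_of_nonneg (one_div_pos.2 hG).le]
    rw [integral_const_mul, mul_assoc]
    exact mul_le_mul_of_nonneg_left (integral_abs_integral_kern_le h0 hf) (by positivity)

theorem IsFracDeriv.add_smul {β : ℝ} (hβ : 0 ≤ β) {v w : ℝ → ℝ} {f g : L2}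
    (hv : IsFracDeriv β v f) (hw : IsFracDeriv β w g) (c : ℝ) :
    IsFracDeriv β (fun t => v t + c * w t) (f + c • g) := by
  have h1 := fracIntLeft_add_const_mul hβ (integrable_coe_L2 f) (integrable_coe_L2 g) c
  have h2 : (fun t => f t + c * g t) =ᵐ[unitVolume] (f + c • g : L2) := by
    filter_upwards [Lp.coeFn_add f (c • g), Lp.coeFn_smul c g] with t h3 h4
    rw [h3, Pi.add_apply, h4, Pi.smul_apply, smul_eq_mul]
  unfold IsFracDeriv at *
  filter_upwards [h1, fracIntLeft_congr_ae (β := β) h2, hv, hw] with x e1 e2 e3 e4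
  rw [← e2, e1, e3, e4]

theorem isFracDeriv_zero {β : ℝ} : IsFracDeriv β (fun _ => 0) 0 := by
  have h : ((0 : L2) : ℝ → ℝ) =ᵐ[unitVolume] fun _ => 0 := Lp.coeFn_zero ..
  unfold IsFracDeriv
  filter_upwards [fracIntLeft_congr_ae (β := β) h] with x hx
  rw [hx]
  by_cases h0 : β = 0 <;> simp [fracIntLeft, h0]

theorem IsFracDeriv.sum {β : ℝ} (hβ : 0 ≤ β) {ι : Type*} (s : Finset ι) (c : ι → ℝ)
    {w : ι → ℝ → ℝ} {f : ι → L2} (h : ∀ i ∈ s, IsFracDeriv β (w i) (f i)) :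
    IsFracDeriv β (fun t => ∑ i ∈ s, c i * w i t) (∑ i ∈ s, c i • f i) := by
  classical
  induction s using Finset.induction_on with
  | empty => simpa using isFracDeriv_zero
  | insert a s ha ih =>
    simp only [Finset.sum_insert ha]
    have := (ih fun i hi => h i (Finset.mem_insert_of_mem hi)).add_smul hβ
      (h a (Finset.mem_insert_self _ _)) (c a)
    rw [add_comm (c a • f a)]
    convert this using 2
    ring

/-- Abel's argument: applying `I^{1-β}_{0+}` to `I^β_{0+} f = 0` shows that every primitive `∫₀^c f`
vanishes. The case `β = 0` is immediate. -/
theorem IsFracDeriv.eq_zero {β : ℝ} (hβ : 0 ≤ β) (hβ1 : β < 1) {f : L2}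
    (h : IsFracDeriv β (fun _ => 0) f) : f = 0 := by
  rw [Lp.eq_zero_iff_ae_eq_zero]
  rcases hβ.eq_or_lt with h0 | h0
  · subst h0
    filter_upwards [h] with x hx
    simpa [fracIntLeft] using hx.symm
  · refine ae_eq_zero_of_integral_indicator_Iio (integrable_coe_L2 f) fun c hc => ?_
    have h1 := integral_kern_integral_kern h0 hβ1 hc.2 (integrable_coe_L2 f)
    have h2 : ∫ s, kern (1 - β) c s * ∫ t, kern β s t * f t ∂unitVolume ∂unitVolume = 0 := by
      refine integral_eq_zero_of_ae ?_
      unfold IsFracDeriv at h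
      filter_upwards [h, ae_restrict_mem measurableSet_Icc] with s hs hm
      rw [fracIntLeft_eq_integral_kern h0.ne' _ hm] at hs
      have hG : (1 / Real.Gamma β) ≠ 0 := (one_div_pos.2 (Real.Gamma_pos_of_pos h0)).ne'
      have : ∫ t, kern β s t * f t ∂unitVolume = 0 := by
        rcases mul_eq_zero.1 hs.symm with h | h
        · exact absurd h hG
        · exact h
      simp [this]
    rw [h2] at h1
    rcases mul_eq_zero.1 h1.symm with h | h
    · exact absurd h (beta_pos h0 (by linarith)).ne'
    · exact h

theorem IsFracDeriv.unique {β : ℝ} (hβ : 0 ≤ β) (hβ1 : β < 1) {w : ℝ → ℝ} {f g : L2}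
    (hf : IsFracDeriv β w f) (hg : IsFracDeriv β w g) : f = g := by
  have := (hf.add_smul hβ hg (-1))
  have h0 : f + (-1 : ℝ) • g = 0 := IsFracDeriv.eq_zero hβ hβ1 (by simpa using this)
  rw [neg_one_smul, ← sub_eq_add_neg] at h0
  exact sub_eq_zero.1 h0

/-- Uniqueness makes the arbitrary choice in `fracDeriv` harmless: any exhibited fractional
derivative is the chosen one. -/
theorem IsFracDeriv.fracDeriv_eq {β : ℝ} (hβ : 0 ≤ β) (hβ1 : β < 1) {w : ℝ → ℝ} {f : L2}
    (hf : IsFracDeriv β w f) : fracDeriv β w = f := by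
  have h : MemBesov β w := ⟨f, hf⟩
  rw [fracDeriv, dif_pos h]
  exact IsFracDeriv.unique hβ hβ1 h.choose_spec hf

/-- `L²` convergence of the derivatives implies `L¹` convergence, which `I^β_{0+}` preserves. A
subsequence of `I^β_{0+} (f k) = w k` then converges almost everywhere, and its limit has to be `v`.
-/
theorem IsFracDeriv.of_tendsto {β : ℝ} (hβ : 0 ≤ β) {w : ℕ → ℝ → ℝ} {v : ℝ → ℝ} {f : ℕ → L2}
    {F : L2} (h : ∀ k, IsFracDeriv β (w k) (f k)) (hf : Tendsto f atTop (𝓝 F))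
    (hw : ∀ x ∈ Icc (0 : ℝ) 1, Tendsto (fun k => w k x) atTop (𝓝 (v x))) :
    IsFracDeriv β v F := by
  obtain ⟨C, hC, hb⟩ := exists_eLpNorm_fracIntLeft_le hβ
  have hm : TendstoInMeasure unitVolume (fun k => fracIntLeft β (f k)) atTop
      (fracIntLeft β F) := by
    refine tendstoInMeasure_of_tendsto_eLpNorm one_ne_zero
      (fun k => aestronglyMeasurable_fracIntLeft hβ (integrable_coe_L2 _))
      (aestronglyMeasurable_fracIntLeft hβ (integrable_coe_L2 _)) ?_
    have h1 : Tendsto (fun k => ENNReal.ofReal C * ENNReal.ofReal ‖f k - F‖) atTop (𝓝 0) := by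
      have h2 := (tendsto_iff_norm_sub_tendsto_zero.1 hf)
      have h3 := (ENNReal.tendsto_ofReal h2)
      rw [ENNReal.ofReal_zero] at h3
      simpa using ENNReal.Tendsto.const_mul h3 (Or.inr ENNReal.ofReal_ne_top)
    refine tendsto_of_tendsto_of_tendsto_of_le_of_le tendsto_const_nhds h1
      (fun _ => zero_le) fun k => ?_
    have e1 : eLpNorm (fracIntLeft β (f k) - fracIntLeft β F) 1 unitVolume
        = eLpNorm (fracIntLeft β (f k - F : L2)) 1 unitVolume := by
      refine eLpNorm_congr_ae ?_
      have e2 := fracIntLeft_add_const_mul hβ (integrable_coe_L2 (f k)) (integrable_coe_L2 F) (-1)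
      have e3 : (fun t => f k t + (-1) * F t) =ᵐ[unitVolume] (f k - F : L2) := by
        filter_upwards [Lp.coeFn_sub (f k) F] with t ht
        rw [ht, Pi.sub_apply]
        ring
      filter_upwards [e2, fracIntLeft_congr_ae (β := β) e3] with x h2 h3
      rw [← h3, h2, Pi.sub_apply]
      ring
    simp only
    rw [e1]
    refine (hb _ (integrable_coe_L2 _)).trans ?_
    gcongr
    have : IsProbabilityMeasure unitVolume := ⟨by simp⟩
    rw [Lp.norm_def, ENNReal.ofReal_toReal (Lp.eLpNorm_ne_top _)]
    exact eLpNorm_le_eLpNorm_of_exponent_le (by norm_num) (Lp.aestronglyMeasurable _)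
  obtain ⟨ns, hns, hae⟩ := hm.exists_seq_tendsto_ae
  have hall : ∀ᵐ x ∂unitVolume, ∀ k, w k x = fracIntLeft β (f k) x := ae_all_iff.2 h
  unfold IsFracDeriv
  filter_upwards [hae, hall, ae_restrict_mem measurableSet_Icc] with x h1 h2 h3
  refine tendsto_nhds_unique ((hw x h3).comp hns.tendsto_atTop) (h1.congr fun i => ?_)
  exact (h2 _).symm

/-- The function `(t - a)_+^{1-β} / Γ(2-β)`, which is `I^{1-β}_{0+} 1_{[a,1]}`. -/
noncomputable def hingeDeriv (β a t : ℝ) : ℝ := kern (2 - β) t a / Real.Gamma (2 - β)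

theorem measurable_hingeDeriv (β a : ℝ) : Measurable (hingeDeriv β a) :=
  ((measurable_kern _).comp (measurable_id.prodMk measurable_const)).div_const _

theorem memLp_hingeDeriv {β : ℝ} (hβ : β < 1 / 2) (a : ℝ) :
    MemLp (hingeDeriv β a) 2 unitVolume := by
  have hG : 0 < Real.Gamma (2 - β) := Real.Gamma_pos_of_pos (by linarith)
  refine MemLp.of_bound (measurable_hingeDeriv β a).aestronglyMeasurable
    ((1 + |a|) ^ (2 - β - 1) / Real.Gamma (2 - β)) ?_
  filter_upwards [ae_restrict_mem measurableSet_Icc] with t ht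
  rw [hingeDeriv, norm_div, Real.norm_of_nonneg (kern_nonneg _ _ _), Real.norm_of_nonneg hG.le]
  gcongr
  unfold kern
  split_ifs with h
  · refine Real.rpow_le_rpow (by linarith) ?_ (by linarith)
    linarith [ht.2, neg_abs_le a]
  · positivity

/-- The class of `hingeDeriv β a` in `L²([0,1])`. -/
noncomputable def hingeVec (β : ℝ) (hβ : β < 1 / 2) (a : ℝ) : L2 := (memLp_hingeDeriv hβ a).toLp _

theorem coeFn_hingeVec (β : ℝ) (hβ : β < 1 / 2) (a : ℝ) :
    hingeVec β hβ a =ᵐ[unitVolume] hingeDeriv β a := MemLp.coeFn_toLp _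

/-- The hinge is `I^1_{0+} 1_{[a,1]} = I^β_{0+} I^{1-β}_{0+} 1_{[a,1]}`. In kernels this is `B(2-β,
β) = Γ(2-β) Γ(β) / Γ(2)`, with `Γ(2) = 1` and resulting exponent one. -/
theorem isFracDeriv_hinge {β : ℝ} (hβ0 : 0 ≤ β) (hβ : β < 1 / 2) {a : ℝ} (ha : 0 ≤ a) :
    IsFracDeriv β (fun x => max (x - a) 0) (hingeVec β hβ a) := by
  have hG : 0 < Real.Gamma (2 - β) := Real.Gamma_pos_of_pos (by linarith)
  unfold IsFracDeriv
  filter_upwards [fracIntLeft_congr_ae (β := β) (coeFn_hingeVec β hβ a),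
    ae_restrict_mem measurableSet_Icc] with x h1 hx
  rw [h1]
  rcases hβ0.eq_or_lt with h0 | h0
  · subst h0
    rw [fracIntLeft, if_pos rfl, hingeDeriv, kern, sub_zero, Real.Gamma_two]
    split_ifs with h
    · rw [max_eq_left (by linarith), show (2 - 1 : ℝ) = 1 by norm_num]
      simp
    · rw [max_eq_right (by linarith)]
      simp
  · have hGb : 0 < Real.Gamma β := Real.Gamma_pos_of_pos h0
    rw [fracIntLeft_eq_integral_kern h0.ne' _ hx]
    have : ∀ t, kern β x t * hingeDeriv β a t
        = (1 / Real.Gamma (2 - β)) * (kern (2 - β) t a * kern β x t) := fun t => by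
      rw [hingeDeriv]
      ring
    simp_rw [this]
    rw [integral_const_mul, integral_kern_mul_kern (by linarith) h0 ha hx.2]
    split_ifs with h
    · rw [max_eq_left (by linarith), beta, sub_add_cancel, Real.Gamma_two,
        show (2 - 1 : ℝ) = 1 by norm_num, Real.rpow_one]
      field_simp
    · rw [max_eq_right (by linarith)]
      simp

end BrownianStein

/-! ### Piecewise linear interpolation and its refinement -/

namespace BrownianStein

open Filter Topology

/-- The class in `L²([0,1])` of `I^{1-β}_{0+} 1_{[j/m,(j+1)/m)}`. -/
noncomputable def cellVec (β : ℝ) (hβ : β < 1 / 2) (m j : ℕ) : L2 :=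
  hingeVec β hβ (j / m) - hingeVec β hβ ((j + 1) / m)

/-- The increment of `w` over the `j`-th cell of the subdivision of `[0,1]` into `m` intervals. -/
noncomputable def cellIncr (m j : ℕ) (w : ℝ → ℝ) : ℝ := w ((j + 1) / m) - w (j / m)

/-- The fractional derivative of the piecewise linear interpolation of `w`. -/
noncomputable def interpDeriv (β : ℝ) (hβ : β < 1 / 2) (m : ℕ) (w : ℝ → ℝ) : L2 :=
  ∑ j ∈ Finset.range m, (m * cellIncr m j w) • cellVec β hβ m j

theorem integral_indicator_Ico {a b t : ℝ} (ha : 0 ≤ a) (hab : a ≤ b) (ht : 0 ≤ t) :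
    ∫ s in (0 : ℝ)..t, (Ico a b).indicator (1 : ℝ → ℝ) s = max (t - a) 0 - max (t - b) 0 := by
  rw [intervalIntegral.integral_of_le ht, ← integral_Icc_eq_integral_Ioc,
    integral_Icc_eq_integral_Ico, setIntegral_indicator measurableSet_Ico, Ico_inter_Ico,
    Pi.one_def, setIntegral_const]
  simp only [smul_eq_mul, mul_one, sup_eq_right.2 ha]
  rw [Measure.real, Real.volume_Ico, ENNReal.toReal_ofReal']
  grind

theorem linInterp_eq_sum {m : ℕ} (w : ℝ → ℝ) {t : ℝ} (ht : 0 ≤ t) :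
    linInterp m w t = ∑ j ∈ Finset.range m, (m * cellIncr m j w) *
      (max (t - j / m) 0 - max (t - (j + 1) / m) 0) := by
  have h0 : ∀ j : ℕ, IntervalIntegrable
      ((Ico ((j : ℝ) / m) ((j + 1) / m)).indicator (1 : ℝ → ℝ)) volume 0 t := fun j =>
    IntegrableOn.intervalIntegrable
      ((integrableOn_const (by simp)).indicator measurableSet_Ico)
  rw [linInterp, intervalIntegral.integral_const_mul, intervalIntegral.integral_finsetSum,
    Finset.mul_sum]
  · refine Finset.sum_congr rfl fun j _ => ?_
    rw [intervalIntegral.integral_const_mul, integral_indicator_Ico (by positivity) _ ht, cellIncr]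
    · ring
    · gcongr
      linarith
  · exact fun j _ => (h0 j).const_mul _

theorem isFracDeriv_linInterp {β : ℝ} (hβ0 : 0 ≤ β) (hβ : β < 1 / 2) (m : ℕ) (w : ℝ → ℝ) :
    IsFracDeriv β (linInterp m w) (interpDeriv β hβ m w) := by
  have h := IsFracDeriv.sum hβ0 (Finset.range m) (fun j => m * cellIncr m j w)
    (w := fun j t => max (t - j / m) 0 + (-1) * max (t - (j + 1) / m) 0)
    (f := fun j => hingeVec β hβ (j / m) + (-1 : ℝ) • hingeVec β hβ ((j + 1) / m))
    (fun j _ => (isFracDeriv_hinge hβ0 hβ (by positivity)).add_smul hβ0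
      (isFracDeriv_hinge hβ0 hβ (by positivity)) (-1))
  have e : ∑ j ∈ Finset.range m, (m * cellIncr m j w) •
      (hingeVec β hβ (j / m) + (-1 : ℝ) • hingeVec β hβ ((j + 1) / m)) = interpDeriv β hβ m w := by
    simp only [interpDeriv, cellVec, neg_one_smul, ← sub_eq_add_neg]
  rw [e] at h
  unfold IsFracDeriv at h ⊢
  filter_upwards [h, ae_restrict_mem measurableSet_Icc] with t h1 h2
  rw [← h1, linInterp_eq_sum w h2.1]
  refine Finset.sum_congr rfl fun j _ => ?_
  ring

theorem exists_mem_cell {m : ℕ} (hm : 1 ≤ m) {t : ℝ} (ht : t ∈ Icc (0 : ℝ) 1) :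
    ∃ j < m, (j : ℝ) / m ≤ t ∧ t ≤ (j + 1) / m := by
  have hm' : (0 : ℝ) < m := by exact_mod_cast hm
  rcases ht.1.eq_or_lt with h0 | h0
  · exact ⟨0, hm, by simp [← h0], by rw [← h0]; positivity⟩
  -- The cell is `j = ⌈m t⌉ - 1`: with the ceiling, `t = 1` falls in the last cell, at the price of
  -- treating `t = 0` separately.
  · have h1 : 0 < ⌈(m : ℝ) * t⌉₊ := Nat.ceil_pos.2 (by positivity)
    have h2 : ⌈(m : ℝ) * t⌉₊ ≤ m := Nat.ceil_le.2 (by nlinarith [ht.2])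
    obtain ⟨j, hj⟩ := Nat.exists_eq_succ_of_ne_zero h1.ne'
    have h3 : (m : ℝ) * t ≤ (j + 1 : ℕ) := by
      rw [← Nat.succ_eq_add_one, ← hj]
      exact Nat.le_ceil _
    have h4 : (j : ℝ) < m * t := Nat.lt_ceil.1 (by omega)
    refine ⟨j, by omega, ?_, ?_⟩
    · rw [div_le_iff₀ hm']
      linarith
    · rw [le_div_iff₀ hm']
      push_cast at h3
      linarith

/-- Cells to the left of `j` contribute their whole increments, which telescope; cells to the right
contribute nothing. The term `- w 0` appears because the interpolation is normalised to start at
zero. -/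
theorem linInterp_eq_of_mem_cell {m j : ℕ} (hj : j < m) (w : ℝ → ℝ) {t : ℝ}
    (h1 : (j : ℝ) / m ≤ t) (h2 : t ≤ (j + 1) / m) :
    linInterp m w t = w (j / m) - w 0 + (m * t - j) * cellIncr m j w := by
  have hm : (0 : ℝ) < m := by exact_mod_cast (Nat.zero_le j).trans_lt hj
  have e : ∀ i : ℕ, (m * cellIncr m i w) * (max (t - i / m) 0 - max (t - (i + 1) / m) 0)
      = (if i < j then cellIncr m i w else 0)
        + (if i = j then (m * t - j) * cellIncr m j w else 0) := by
    intro i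
    rcases lt_trichotomy i j with h | h | h
    · have h3 : ((i : ℝ) + 1) / m ≤ j / m := by
        gcongr
        exact_mod_cast h
      have h4 : (i : ℝ) / m ≤ (i + 1) / m := by gcongr; linarith
      rw [if_pos h, if_neg h.ne, max_eq_left (by linarith), max_eq_left (by linarith)]
      field_simp
      ring
    · subst h
      rw [if_neg (lt_irrefl _), if_pos rfl, max_eq_left (by linarith), max_eq_right (by linarith)]
      field_simp
      ring
    · have h3 : ((j : ℝ) + 1) / m ≤ i / m := by
        gcongr
        exact_mod_cast h
      have h4 : (i : ℝ) / m ≤ (i + 1) / m := by gcongr; linarith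
      rw [if_neg h.not_gt, if_neg h.ne', max_eq_right (by linarith), max_eq_right (by linarith)]
      ring
  rw [linInterp_eq_sum w (le_trans (by positivity) h1), Finset.sum_congr rfl fun i _ => e i,
    Finset.sum_add_distrib, Finset.sum_ite_eq', if_pos (Finset.mem_range.2 hj),
    ← Finset.sum_filter,
    show (Finset.range m).filter (· < j) = Finset.range j by ext; simp; omega]
  have := Finset.sum_range_sub (fun i : ℕ => w (i / m)) j
  simp only [Nat.cast_add, Nat.cast_one, Nat.cast_zero, zero_div] at this
  simp only [cellIncr] at this ⊢
  rw [this]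

theorem tendsto_linInterp {w : ℝ → ℝ} (hw : Continuous w) (h0 : w 0 = 0) {u : ℕ → ℕ}
    (hu : Tendsto u atTop atTop) {t : ℝ} (ht : t ∈ Icc (0 : ℝ) 1) :
    Tendsto (fun k => linInterp (u k) w t) atTop (𝓝 (w t)) := by
  rw [Metric.tendsto_atTop]
  intro ε hε
  obtain ⟨δ, hδ, hc⟩ := Metric.continuous_iff.1 hw t ε hε
  have h1 : Tendsto (fun k => 1 / (u k : ℝ)) atTop (𝓝 0) :=
    tendsto_one_div_atTop_nhds_zero_nat.comp hu
  have h2 := (h1.eventually (gt_mem_nhds hδ)).and (hu.eventually_ge_atTop 1)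
  obtain ⟨N, hN⟩ := eventually_atTop.1 h2
  refine ⟨N, fun k hk => ?_⟩
  obtain ⟨hk1, hk2⟩ := hN k hk
  obtain ⟨j, hj, hj1, hj2⟩ := exists_mem_cell hk2 ht
  have hm : (0 : ℝ) < u k := by exact_mod_cast hk2
  have hlen : ((j : ℝ) + 1) / u k = j / u k + 1 / u k := by ring
  have a1 := hc (j / u k) (by rw [Real.dist_eq, abs_lt]; constructor <;> linarith)
  have a2 := hc ((j + 1) / u k) (by rw [Real.dist_eq, abs_lt]; constructor <;> linarith)
  rw [Real.dist_eq, abs_lt] at a1 a2 ⊢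
  rw [linInterp_eq_of_mem_cell hj w hj1 hj2, h0, cellIncr]
  have t1 : 0 ≤ u k * t - j := by
    rw [div_le_iff₀ hm] at hj1
    linarith
  have t2 : 0 ≤ 1 - (u k * t - j) := by
    rw [le_div_iff₀ hm] at hj2
    linarith
  generalize (u k : ℝ) * t - j = θ at *
  generalize w (j / u k) = p at *
  generalize w ((j + 1) / u k) = q at *
  -- The error is the convex combination, with weights `1 - θ` and `θ`, of the deviations of `w` at
  -- the two ends of the cell, both in `(-ε, ε)`.
  have := convex_Ioo (-ε) ε a1 a2 t2 t1 (by ring)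
  simp only [smul_eq_mul, mem_Ioo] at this
  constructor <;> linarith

theorem sum_range_mul {M : Type*} [AddCommMonoid M] (f : ℕ → M) (m q : ℕ) :
    ∑ i ∈ Finset.range (m * q), f i
      = ∑ j ∈ Finset.range m, ∑ r ∈ Finset.range q, f (j * q + r) := by
  induction m with
  | zero => simp
  | succ m ih => rw [add_mul, one_mul, Finset.sum_range_add, ih, Finset.sum_range_succ]

/-- A cell vector is a difference of hinge vectors, so it telescopes over the `q` subcells. -/
theorem cellVec_eq_sum (β : ℝ) (hβ : β < 1 / 2) (m j : ℕ) {q : ℕ} (hq : q ≠ 0) :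
    cellVec β hβ m j = ∑ r ∈ Finset.range q, cellVec β hβ (m * q) (j * q + r) := by
  have h := Finset.sum_range_sub' (fun r : ℕ => hingeVec β hβ (((j * q + r : ℕ) : ℝ) / (m * q : ℕ)))
    q
  have hq' : (q : ℝ) ≠ 0 := by exact_mod_cast hq
  have e1 : ((j * q + 0 : ℕ) : ℝ) / (m * q : ℕ) = j / m := by
    push_cast
    rw [add_zero, mul_div_mul_right _ _ hq']
  have e2 : ((j * q + q : ℕ) : ℝ) / (m * q : ℕ) = (j + 1) / m := by
    push_cast
    rw [show (j : ℝ) * q + q = (j + 1) * q by ring, mul_div_mul_right _ _ hq']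
  rw [e1, e2] at h
  rw [cellVec, ← h]
  refine Finset.sum_congr rfl fun r _ => ?_
  rw [cellVec]
  push_cast
  rw [add_assoc]

/-- The deviation of a fine increment from its share of the coarse increment. -/
noncomputable def fineDev (m q i : ℕ) (w : ℝ → ℝ) : ℝ :=
  cellIncr (m * q) i w - (1 / q) * cellIncr m (i / q) w

/-- On each fine cell the coarse interpolation has slope `m` times the coarse increment, that is `m
* q` times its share `1 / q`. Both levels are thus expanded on the same fine cell vectors, and only
the residuals remain. -/
theorem interpDeriv_mul_sub (β : ℝ) (hβ : β < 1 / 2) (m : ℕ) {q : ℕ} (hq : q ≠ 0) (w : ℝ → ℝ) :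
    interpDeriv β hβ (m * q) w - interpDeriv β hβ m w
      = ∑ i ∈ Finset.range (m * q), ((m * q : ℕ) * fineDev m q i w) • cellVec β hβ (m * q) i := by
  have hq' : (q : ℝ) ≠ 0 := by exact_mod_cast hq
  have h : interpDeriv β hβ m w = ∑ i ∈ Finset.range (m * q),
      (m * cellIncr m (i / q) w) • cellVec β hβ (m * q) i := by
    rw [interpDeriv, sum_range_mul]
    refine Finset.sum_congr rfl fun j _ => ?_
    rw [cellVec_eq_sum β hβ m j hq, Finset.smul_sum]
    refine Finset.sum_congr rfl fun r hr => ?_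
    have : (j * q + r) / q = j := by
      rw [mul_comm, Nat.mul_add_div (Nat.pos_of_ne_zero hq), Nat.div_eq_of_lt (Finset.mem_range.1 hr),
        add_zero]
    rw [this]
  rw [h, interpDeriv, ← Finset.sum_sub_distrib]
  refine Finset.sum_congr rfl fun i _ => ?_
  rw [← sub_smul, fineDev]
  congr 1
  push_cast
  field_simp

end BrownianStein

/-! ### Two-sided estimates of the energy -/

namespace BrownianStein

open Filter Topology

theorem kern_eq_max_rpow {p : ℝ} (hp : 1 < p) (t a : ℝ) :
    kern p t a = (max (t - a) 0) ^ (p - 1) := by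
  unfold kern
  split_ifs with h
  · rw [max_eq_left (by linarith)]
  · rw [max_eq_right (by linarith), Real.zero_rpow (by linarith)]

/-- Cauchy–Schwarz on `[B, A]` for `u ^ (-β)` against the constant one; `β < 1/2` keeps the square
integrable at zero. -/
theorem sq_rpow_sub_rpow_le {β A B : ℝ} (hβ : β < 1 / 2) (hB : 0 ≤ B) (hAB : B ≤ A) :
    ((A ^ (1 - β) - B ^ (1 - β)) / (1 - β)) ^ 2
      ≤ (A - B) * ((A ^ (1 - 2 * β) - B ^ (1 - 2 * β)) / (1 - 2 * β)) := by
  rcases hAB.eq_or_lt with h | h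
  · subst h
    simp
  have hd : 0 < A - B := sub_pos.2 h
  have i1 : ∫ u in B..A, u ^ (-β) = (A ^ (1 - β) - B ^ (1 - β)) / (1 - β) := by
    rw [integral_rpow (Or.inl (by linarith))]
    ring_nf
  have i2 : ∫ u in B..A, u ^ (-(2 * β)) = (A ^ (1 - 2 * β) - B ^ (1 - 2 * β)) / (1 - 2 * β) := by
    rw [integral_rpow (Or.inl (by linarith))]
    ring_nf
  rw [← i1, ← i2]
  -- With `c` the mean value, expanding `∫ (u ^ (-β) - c)² ≥ 0` is exactly the Cauchy–Schwarz
  -- inequality.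
  set c := (∫ u in B..A, u ^ (-β)) / (A - B) with hc
  have n1 : IntervalIntegrable (fun u : ℝ => u ^ (-β)) volume B A :=
    intervalIntegral.intervalIntegrable_rpow' (by linarith)
  have n2 : IntervalIntegrable (fun u : ℝ => u ^ (-(2 * β))) volume B A :=
    intervalIntegral.intervalIntegrable_rpow' (by linarith)
  have h0 : 0 ≤ ∫ u in B..A, (u ^ (-(2 * β)) - (2 * c) * u ^ (-β) + c ^ 2) := by
    refine intervalIntegral.integral_nonneg hAB fun u hu => ?_
    have : u ^ (-(2 * β)) = (u ^ (-β)) ^ 2 := by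
      rw [← Real.rpow_mul_natCast (hB.trans hu.1)]
      push_cast
      ring_nf
    rw [this]
    nlinarith [sq_nonneg (u ^ (-β) - c)]
  rw [intervalIntegral.integral_add (n2.sub (n1.const_mul _)) intervalIntegrable_const,
    intervalIntegral.integral_sub n2 (n1.const_mul _), intervalIntegral.integral_const_mul,
    intervalIntegral.integral_const, smul_eq_mul] at h0
  have hcm : ∫ u in B..A, u ^ (-β) = c * (A - B) := by
    rw [hc, div_mul_cancel₀ _ hd.ne']
  rw [hcm] at h0 ⊢
  nlinarith [mul_nonneg hd.le h0]

/-- Bernoulli's inequality at `-h / A` for the concave power `s ≤ 1`; it bounds hinge differences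
from below. -/
theorem mul_rpow_le_rpow_sub_rpow {s A h : ℝ} (hs0 : 0 ≤ s) (hs : s ≤ 1) (hA : 0 < A)
    (hh : h ≤ A) : s * h * A ^ (s - 1) ≤ A ^ s - (A - h) ^ s := by
  have h1 := rpow_one_add_le_one_add_mul_self (s := -(h / A)) (p := s)
    (by rw [neg_le_neg_iff, div_le_one hA]; exact hh) hs0 hs
  have h2 : A - h = A * (1 + -(h / A)) := by field_simp; ring
  have h3 : (0 : ℝ) ≤ 1 + -(h / A) := by
    have : h / A ≤ 1 := (div_le_one hA).2 hh
    linarith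
  rw [h2, Real.mul_rpow hA.le h3, Real.rpow_sub_one hA.ne']
  have h4 : 0 < A ^ s := Real.rpow_pos_of_pos hA _
  have := mul_le_mul_of_nonneg_left h1 h4.le
  calc s * h * (A ^ s / A) = A ^ s - A ^ s * (1 + s * -(h / A)) := by field_simp; ring
    _ ≤ _ := by linarith

/-- Bernoulli's inequality for the convex power `p ≥ 1`; it compares a Riemann sum with a
telescoping sum. -/
theorem rpow_sub_rpow_le_mul_rpow {p x h : ℝ} (hp : 1 ≤ p) (hx : 0 < x) (hh : h ≤ x) :
    x ^ p - (x - h) ^ p ≤ p * h * x ^ (p - 1) := by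
  have h1 := one_add_mul_self_le_rpow_one_add (s := -(h / x)) (p := p)
    (by rw [neg_le_neg_iff, div_le_one hx]; exact hh) hp
  have h2 : x - h = x * (1 + -(h / x)) := by field_simp; ring
  have h3 : (0 : ℝ) ≤ 1 + -(h / x) := by
    have : h / x ≤ 1 := (div_le_one hx).2 hh
    linarith
  rw [h2, Real.mul_rpow hx.le h3, Real.rpow_sub_one hx.ne']
  have h4 : 0 < x ^ p := Real.rpow_pos_of_pos hx _
  have := mul_le_mul_of_nonneg_left h1 h4.le
  calc _ ≤ x ^ p - x ^ p * (1 + p * -(h / x)) := by linarith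
    _ = p * h * (x ^ p / x) := by field_simp; ring

theorem coeFn_cellVec (β : ℝ) (hβ : β < 1 / 2) (m j : ℕ) :
    cellVec β hβ m j =ᵐ[unitVolume]
      fun t => hingeDeriv β (j / m) t - hingeDeriv β ((j + 1) / m) t := by
  filter_upwards [Lp.coeFn_sub (hingeVec β hβ (j / m)) (hingeVec β hβ ((j + 1) / m)),
    coeFn_hingeVec β hβ (j / m), coeFn_hingeVec β hβ ((j + 1) / m)] with t h1 h2 h3
  rw [cellVec, h1, Pi.sub_apply, h2, h3]

theorem norm_sq_L2 (f : L2) : ‖f‖ ^ 2 = ∫ t, f t ^ 2 ∂unitVolume := by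
  rw [← real_inner_self_eq_norm_sq, L2.inner_def]
  refine integral_congr_ae (Eventually.of_forall fun t => ?_)
  simp [sq]

theorem norm_sq_cellVec (β : ℝ) (hβ : β < 1 / 2) (m j : ℕ) :
    ‖cellVec β hβ m j‖ ^ 2
      = ∫ t, (hingeDeriv β (j / m) t - hingeDeriv β ((j + 1) / m) t) ^ 2 ∂unitVolume := by
  rw [norm_sq_L2]
  refine integral_congr_ae ?_
  filter_upwards [coeFn_cellVec β hβ m j] with t ht
  rw [ht]

theorem hingeDeriv_eq {β : ℝ} (hβ : β < 1 / 2) (a t : ℝ) :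
    hingeDeriv β a t = (max (t - a) 0) ^ (1 - β) / (1 - β) / Real.Gamma (1 - β) := by
  rw [hingeDeriv, kern_eq_max_rpow (by linarith), show 2 - β - 1 = 1 - β by ring,
    show 2 - β = (1 - β) + 1 by ring, Real.Gamma_add_one (by linarith), div_div]

theorem integrable_sq_hingeDeriv_sub {β : ℝ} (hβ : β < 1 / 2) (a b : ℝ) :
    Integrable (fun t => (hingeDeriv β a t - hingeDeriv β b t) ^ 2) unitVolume :=
  ((memLp_hingeDeriv hβ a).sub (memLp_hingeDeriv hβ b)).integrable_sq

/-- The squared Hilbert-Schmidt norm `E ‖I^{-β} B_m‖²` of the interpolated Brownian motion. -/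
noncomputable def interpEnergy (β : ℝ) (hβ : β < 1 / 2) (m : ℕ) : ℝ :=
  ∑ j ∈ Finset.range m, m * ‖cellVec β hβ m j‖ ^ 2

theorem interpEnergy_eq_integral (β : ℝ) (hβ : β < 1 / 2) (m : ℕ) :
    interpEnergy β hβ m = ∫ t, ∑ j ∈ Finset.range m,
      m * (hingeDeriv β (j / m) t - hingeDeriv β ((j + 1) / m) t) ^ 2 ∂unitVolume := by
  rw [integral_finsetSum _ fun j _ => (integrable_sq_hingeDeriv_sub hβ _ _).const_mul _]
  simp_rw [integral_const_mul, ← norm_sq_cellVec β hβ]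
  rfl

/-- For fixed `t`, Cauchy–Schwarz on each cell produces a factor at most `1 / m`, which cancels the
weight `m`. What is left telescopes in `j` to at most `t ^ (1 - 2β)`, whose integral is `1 / (2 -
2β)`. -/
theorem interpEnergy_le {β : ℝ} (hβ : β < 1 / 2) {m : ℕ} (hm : 1 ≤ m) :
    interpEnergy β hβ m ≤ 1 / ((1 - 2 * β) * Real.Gamma (1 - β) ^ 2) * (1 / (2 - 2 * β)) := by
  have hG : 0 < Real.Gamma (1 - β) := Real.Gamma_pos_of_pos (by linarith)
  have hm' : (0 : ℝ) < m := by exact_mod_cast hm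
  have h2 : 0 < 1 - 2 * β := by linarith
  have hint : ∫ t, t ^ (1 - 2 * β) ∂unitVolume = 1 / (2 - 2 * β) := by
    rw [integral_Icc_eq_integral_Ioc, ← intervalIntegral.integral_of_le zero_le_one,
      integral_rpow (Or.inl (by linarith)), Real.one_rpow, Real.zero_rpow (by linarith)]
    ring_nf
  have hii : Integrable (fun t : ℝ => t ^ (1 - 2 * β)) unitVolume :=
    (intervalIntegrable_iff_integrableOn_Icc_of_le zero_le_one).1
      (intervalIntegral.intervalIntegrable_rpow' (by linarith))
  rw [interpEnergy_eq_integral, ← hint, ← integral_const_mul]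
  refine integral_mono_ae (integrable_finsetSum _ fun j _ =>
    (integrable_sq_hingeDeriv_sub hβ _ _).const_mul _) (hii.const_mul _) ?_
  filter_upwards [ae_restrict_mem measurableSet_Icc] with t ht
  have hterm : ∀ j ∈ Finset.range m,
      m * (hingeDeriv β (j / m) t - hingeDeriv β ((j + 1) / m) t) ^ 2
      ≤ 1 / ((1 - 2 * β) * Real.Gamma (1 - β) ^ 2) * ((max (t - j / m) 0) ^ (1 - 2 * β)
        - (max (t - (j + 1 : ℕ) / m) 0) ^ (1 - 2 * β)) := by
    intro j _
    rw [hingeDeriv_eq hβ, hingeDeriv_eq hβ]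
    push_cast
    have hd : ((j : ℝ) + 1) / m = j / m + 1 / m := by ring
    have hpos : 0 < 1 / (m : ℝ) := by positivity
    have hB : 0 ≤ max (t - ((j : ℝ) + 1) / m) 0 := le_max_right _ _
    have hAB : max (t - ((j : ℝ) + 1) / m) 0 ≤ max (t - j / m) 0 :=
      max_le_max (by linarith) le_rfl
    have hdiff : max (t - (j : ℝ) / m) 0 - max (t - ((j : ℝ) + 1) / m) 0 ≤ 1 / m := by
      rw [hd]
      rcases max_cases (t - (j : ℝ) / m) 0 with h | h <;>
      rcases max_cases (t - ((j : ℝ) / m + 1 / m)) 0 with h' | h' <;> linarith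
    have key := sq_rpow_sub_rpow_le hβ hB hAB
    generalize max (t - ((j : ℝ) + 1) / m) 0 = B at *
    generalize max (t - (j : ℝ) / m) 0 = A at *
    have hmono : 0 ≤ (A ^ (1 - 2 * β) - B ^ (1 - 2 * β)) / (1 - 2 * β) :=
      div_nonneg (sub_nonneg.2 (Real.rpow_le_rpow hB hAB h2.le)) h2.le
    have key2 := key.trans (mul_le_mul_of_nonneg_right hdiff hmono)
    calc m * (A ^ (1 - β) / (1 - β) / Real.Gamma (1 - β)
          - B ^ (1 - β) / (1 - β) / Real.Gamma (1 - β)) ^ 2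
        = m * ((A ^ (1 - β) - B ^ (1 - β)) / (1 - β)) ^ 2 / Real.Gamma (1 - β) ^ 2 := by
          ring
      _ ≤ m * (1 / m * ((A ^ (1 - 2 * β) - B ^ (1 - 2 * β)) / (1 - 2 * β)))
          / Real.Gamma (1 - β) ^ 2 := by gcongr
      _ = _ := by field_simp
  refine (Finset.sum_le_sum hterm).trans ?_
  rw [← Finset.mul_sum, Finset.sum_range_sub'
    (fun j : ℕ => (max (t - j / m) 0) ^ (1 - 2 * β))]
  refine mul_le_mul_of_nonneg_left ?_ (by positivity)
  simp only [Nat.cast_zero, zero_div, sub_zero, max_eq_left ht.1]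
  have : 0 ≤ (max (t - (m : ℝ) / m) 0) ^ (1 - 2 * β) :=
    Real.rpow_nonneg (le_max_right _ _) _
  linarith

/-- Only times to the right of the cell are kept. There both hinges are active, and concavity of the
power `1 - β` (this needs `β ≥ 0`) bounds the cell vector below by `(1/m) (t - j/m) ^ (-β) /
Γ(1-β)`. -/
theorem le_norm_sq_cellVec {β : ℝ} (hβ0 : 0 ≤ β) (hβ : β < 1 / 2) {m j : ℕ} (hj : j < m) :
    1 / ((1 - 2 * β) * Real.Gamma (1 - β) ^ 2) *
      (1 / m * ((1 - j / m) ^ (1 - 2 * β) - (1 / m : ℝ) ^ (1 - 2 * β)))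
      ≤ m * ‖cellVec β hβ m j‖ ^ 2 := by
  have hG : 0 < Real.Gamma (1 - β) := Real.Gamma_pos_of_pos (by linarith)
  have hm' : (0 : ℝ) < m := by exact_mod_cast (Nat.zero_le j).trans_lt hj
  have h2 : 0 < 1 - 2 * β := by linarith
  have hpos : 0 < 1 / (m : ℝ) := by positivity
  have hd : ((j : ℝ) + 1) / m = j / m + 1 / m := by ring
  have ha : 0 ≤ (j : ℝ) / m := by positivity
  have hb1 : ((j : ℝ) + 1) / m ≤ 1 := by
    rw [div_le_one hm']
    exact_mod_cast hj
  have hint : ∫ t in ((j : ℝ) + 1) / m..1, (t - j / m) ^ (-(2 * β))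
      = ((1 - j / m) ^ (1 - 2 * β) - (1 / m : ℝ) ^ (1 - 2 * β)) / (1 - 2 * β) := by
    rw [intervalIntegral.integral_comp_sub_right (fun u => u ^ (-(2 * β))),
      integral_rpow (Or.inl (by linarith)), hd, add_sub_cancel_left]
    ring_nf
  have hsub : Ioc (((j : ℝ) + 1) / m) 1 ⊆ Icc (0 : ℝ) 1 := fun t ht =>
    ⟨by linarith [ht.1], ht.2⟩
  have hii : IntervalIntegrable (fun t : ℝ => (t - j / m) ^ (-(2 * β))) volume
      (((j : ℝ) + 1) / m) 1 := by
    have := (intervalIntegral.intervalIntegrable_rpow' (a := 1 / m) (b := 1 - (j : ℝ) / m)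
      (r := -(2 * β)) (by linarith)).comp_sub_right ((j : ℝ) / m)
    rwa [sub_add_cancel, add_comm, ← hd] at this
  have hmain : ∫ t in Ioc (((j : ℝ) + 1) / m) 1,
      (1 / m) ^ 2 / Real.Gamma (1 - β) ^ 2 * (t - j / m) ^ (-(2 * β))
      ≤ ‖cellVec β hβ m j‖ ^ 2 := by
    rw [norm_sq_cellVec]
    refine le_trans ?_ (setIntegral_mono_set (integrable_sq_hingeDeriv_sub hβ _ _)
      (Eventually.of_forall fun t => sq_nonneg _) hsub.eventuallyLE)
    refine setIntegral_mono_on (((intervalIntegrable_iff_integrableOn_Ioc_of_le hb1).1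
      hii).const_mul _) ((integrable_sq_hingeDeriv_sub hβ _ _).mono_measure
        (Measure.restrict_mono_set _ hsub)) measurableSet_Ioc fun t ht => ?_
    have ht1 := ht.1
    rw [hingeDeriv_eq hβ, hingeDeriv_eq hβ, max_eq_left (by linarith), max_eq_left (by linarith)]
    have hA : 0 < t - j / m := by linarith
    have e1 : t - ((j : ℝ) + 1) / m = t - j / m - 1 / m := by linarith
    have key := mul_rpow_le_rpow_sub_rpow (s := 1 - β) (A := t - j / m) (h := 1 / m)
      (by linarith) (by linarith) hA (by linarith)
    rw [e1]
    generalize t - (j : ℝ) / m = A at *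
    have e2 : A ^ (-(2 * β)) = (A ^ (1 - β - 1)) ^ 2 := by
      rw [← Real.rpow_mul_natCast hA.le]
      push_cast
      ring_nf
    rw [e2]
    have hβ1 : 0 < 1 - β := by linarith
    have hr : 0 < A ^ (1 - β - 1) := Real.rpow_pos_of_pos hA _
    have key2 : 1 / m * A ^ (1 - β - 1) / Real.Gamma (1 - β)
        ≤ A ^ (1 - β) / (1 - β) / Real.Gamma (1 - β)
          - (A - 1 / m) ^ (1 - β) / (1 - β) / Real.Gamma (1 - β) := by
      rw [← sub_div, ← sub_div]
      gcongr
      rw [le_div_iff₀ hβ1]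
      linarith
    calc (1 / (m : ℝ)) ^ 2 / Real.Gamma (1 - β) ^ 2 * (A ^ (1 - β - 1)) ^ 2
        = (1 / m * A ^ (1 - β - 1) / Real.Gamma (1 - β)) ^ 2 := by ring
      _ ≤ _ := pow_le_pow_left₀ (by positivity) key2 2
  rw [integral_const_mul, ← intervalIntegral.integral_of_le hb1, hint] at hmain
  have := mul_le_mul_of_nonneg_left hmain hm'.le
  refine le_trans (le_of_eq ?_) this
  field_simp

/-- The left-endpoint Riemann sum of the decreasing function `(1 - x) ^ (1 - 2β)` dominates its
integral `1 / (2 - 2β)`. The whole loss comes from the `m` terms `(1/m) m ^ (2β - 1)`. -/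
theorem le_interpEnergy {β : ℝ} (hβ0 : 0 ≤ β) (hβ : β < 1 / 2) {m : ℕ} (hm : 1 ≤ m) :
    1 / ((1 - 2 * β) * Real.Gamma (1 - β) ^ 2) * (1 / (2 - 2 * β) - (m : ℝ) ^ (2 * β - 1))
      ≤ interpEnergy β hβ m := by
  have hG : 0 < Real.Gamma (1 - β) := Real.Gamma_pos_of_pos (by linarith)
  have hm' : (0 : ℝ) < m := by exact_mod_cast hm
  have h2 : 0 < 1 - 2 * β := by linarith
  refine le_trans ?_ (Finset.sum_le_sum fun j hj =>
    le_norm_sq_cellVec hβ0 hβ (Finset.mem_range.1 hj))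
  rw [← Finset.mul_sum]
  refine mul_le_mul_of_nonneg_left ?_ (by positivity)
  have e1 : (1 / m : ℝ) ^ (1 - 2 * β) = (m : ℝ) ^ (2 * β - 1) := by
    rw [one_div, Real.inv_rpow hm'.le, ← Real.rpow_neg hm'.le, neg_sub]
  have hterm : ∀ j ∈ Finset.range m,
      ((1 - (j : ℝ) / m) ^ (2 - 2 * β) - (1 - ((j + 1 : ℕ) : ℝ) / m) ^ (2 - 2 * β)) / (2 - 2 * β)
        - 1 / m * (m : ℝ) ^ (2 * β - 1)
      ≤ 1 / m * ((1 - j / m) ^ (1 - 2 * β) - (1 / m : ℝ) ^ (1 - 2 * β)) := by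
    intro j hj
    have hj1 : ((j : ℝ) + 1) / m ≤ 1 := by
      rw [div_le_one hm']
      exact_mod_cast Finset.mem_range.1 hj
    have hd : ((j : ℝ) + 1) / m = j / m + 1 / m := by ring
    have hpos : 0 < 1 / (m : ℝ) := by positivity
    have key := rpow_sub_rpow_le_mul_rpow (p := 2 - 2 * β) (x := 1 - j / m) (h := 1 / m)
      (by linarith) (by linarith) (by linarith)
    rw [e1, mul_sub]
    push_cast
    rw [hd, ← sub_sub]
    gcongr
    rw [div_le_iff₀ (by linarith)]
    rw [show 2 - 2 * β - 1 = 1 - 2 * β by ring] at key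
    linarith
  refine le_trans (le_of_eq ?_) (Finset.sum_le_sum hterm)
  rw [Finset.sum_sub_distrib, ← Finset.sum_div, Finset.sum_range_sub'
    (fun j : ℕ => (1 - (j : ℝ) / m) ^ (2 - 2 * β)), Finset.sum_const, Finset.card_range,
    div_self hm'.ne', sub_self, Real.zero_rpow (by linarith)]
  simp only [Nat.cast_zero, zero_div, sub_zero, Real.one_rpow, nsmul_eq_mul]
  field_simp

end BrownianStein

/-! ### Fractional integration by parts and the tensor `H_m^†` -/

namespace BrownianStein

open Filter Topology

theorem real_inner_eq_mul (x y : ℝ) : ⟪x, y⟫_ℝ = x * y := by simp [mul_comm]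

/-- Here `kern 1 x a` is the indicator of `a < x`. Fubini moves the right fractional integral of `f`
onto this indicator as a left one: duality of `I^α_{1-}` and `I^α_{0+}`. -/
theorem integral_kern_one_mul_integral_kern {α a : ℝ} (hα : 0 < α) (ha : 0 ≤ a) {f : ℝ → ℝ}
    (hf : Integrable f unitVolume) :
    Integrable (fun x => kern 1 x a * ∫ t, kern α t x * f t ∂unitVolume) unitVolume ∧
    ∫ x, kern 1 x a * ∫ t, kern α t x * f t ∂unitVolume ∂unitVolume
      = (1 / α) * ∫ t, kern (α + 1) t a * f t ∂unitVolume := by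
  have hm : AEStronglyMeasurable (fun p : ℝ × ℝ => kern 1 p.1 a * (kern α p.2 p.1 * f p.2))
      (unitVolume.prod unitVolume) :=
    ((measurable_kern _).comp (measurable_fst.prodMk measurable_const)).aestronglyMeasurable.mul
      (((measurable_kern α).comp (measurable_snd.prodMk measurable_fst)).aestronglyMeasurable.mul
        hf.aestronglyMeasurable.comp_snd)
  have key : ∀ t ∈ Icc (0 : ℝ) 1, ∫ x, kern 1 x a * kern α t x ∂unitVolume
      = (1 / α) * kern (α + 1) t a := by
    intro t ht
    rw [integral_kern_mul_kern one_pos hα ha ht.2, kern]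
    split_ifs with h
    · rw [show beta 1 α = beta α 1 by simp only [beta, add_comm, mul_comm], beta_one_right hα,
        add_comm, mul_comm]
    · simp
  have hi : Integrable (fun p : ℝ × ℝ => kern 1 p.1 a * (kern α p.2 p.1 * f p.2))
      (unitVolume.prod unitVolume) := by
    rw [integrable_prod_iff' hm]
    constructor
    · filter_upwards [ae_restrict_mem measurableSet_Icc] with t h2
      refine ((integrable_kern_mul_kern (a := a) (c := t) one_pos hα).mul_const (f t)).congr
        (Eventually.of_forall fun s => ?_)
      ring
    · have : Integrable (fun t => (1 / α) * kern (α + 1) t a * ‖f t‖) unitVolume := by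
        refine Integrable.bdd_mul (c := 1 / α) hf.norm
          (((measurable_kern _).comp (measurable_id.prodMk measurable_const)).const_mul
            _).aestronglyMeasurable ?_
        filter_upwards [ae_restrict_mem measurableSet_Icc] with t ht
        rw [Real.norm_of_nonneg (mul_nonneg (by positivity) (kern_nonneg _ _ _))]
        refine mul_le_of_le_one_right (by positivity) ?_
        unfold kern
        split_ifs with h
        · exact Real.rpow_le_one (by linarith) (by linarith [ht.2]) (by linarith)
        · exact zero_le_one
      refine this.congr ?_
      filter_upwards [ae_restrict_mem measurableSet_Icc] with t h2
      rw [← key t h2, ← integral_mul_const]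
      refine integral_congr_ae (Eventually.of_forall fun s => ?_)
      simp only [norm_mul, Real.norm_of_nonneg (kern_nonneg _ _ _), mul_assoc]
  refine ⟨?_, ?_⟩
  · simp_rw [← integral_const_mul]
    exact hi.integral_prod_left
  calc ∫ x, kern 1 x a * ∫ t, kern α t x * f t ∂unitVolume ∂unitVolume
      = ∫ x, ∫ t, kern 1 x a * (kern α t x * f t) ∂unitVolume ∂unitVolume := by
        simp_rw [integral_const_mul]
    _ = ∫ t, ∫ x, kern 1 x a * (kern α t x * f t) ∂unitVolume ∂unitVolume :=
        integral_integral_swap (f := fun x t => kern 1 x a * (kern α t x * f t)) hi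
    _ = ∫ t, (1 / α) * (kern (α + 1) t a * f t) ∂unitVolume := by
        refine setIntegral_congr_fun measurableSet_Icc fun t ht => ?_
        simp_rw [← mul_assoc]
        rw [integral_mul_const, key t ht]
    _ = _ := integral_const_mul _ _

theorem fracIntRight_eq_integral_kern {α : ℝ} (h0 : α ≠ 0) (f : ℝ → ℝ) {x : ℝ}
    (hx : x ∈ Icc (0 : ℝ) 1) :
    fracIntRight α f x = (1 / Real.Gamma α) * ∫ t, kern α t x * f t ∂unitVolume := by
  rw [fracIntRight, if_neg h0, intervalIntegral.integral_of_le hx.2]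
  congr 1
  rw [← inter_eq_self_of_subset_right (show Ioc x 1 ⊆ Icc (0 : ℝ) 1 from
    fun t ht => ⟨hx.1.trans ht.1.le, ht.2⟩), ← setIntegral_indicator measurableSet_Ioc]
  refine setIntegral_congr_fun measurableSet_Icc fun t ht => ?_
  by_cases h : x < t <;> simp [kern, h, ht.2, mul_comm]

theorem inner_hingeVec (β : ℝ) (hβ : β < 1 / 2) (a : ℝ) (f : L2) :
    ⟪hingeVec β hβ a, f⟫_ℝ = ∫ t, hingeDeriv β a t * f t ∂unitVolume := by
  rw [L2.inner_def]
  refine integral_congr_ae ?_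
  filter_upwards [coeFn_hingeVec β hβ a] with t ht
  rw [ht, real_inner_eq_mul]

theorem integral_kern_one_mul_hBasis (β : ℝ) (hβ : β < 1 / 2) (e : HilbertBasis ℕ ℝ L2) (n : ℕ)
    {a : ℝ} (ha : 0 ≤ a) :
    Integrable (fun x => kern 1 x a * hBasis β hβ e n x) unitVolume ∧
    ∫ x, kern 1 x a * hBasis β hβ e n x ∂unitVolume = ⟪hingeVec β hβ a, e n⟫_ℝ := by
  have hβ1 : 0 < 1 - β := by linarith
  obtain ⟨h1, h2⟩ := integral_kern_one_mul_integral_kern hβ1 ha (integrable_coe_L2 (e n))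
  have hae : (fun x => (1 / Real.Gamma (1 - β)) *
      (kern 1 x a * ∫ t, kern (1 - β) t x * e n t ∂unitVolume))
      =ᵐ[unitVolume] fun x => kern 1 x a * hBasis β hβ e n x := by
    have h3 : hBasis β hβ e n =ᵐ[unitVolume] fracIntRight (1 - β) (e n) := MemLp.coeFn_toLp _
    filter_upwards [h3, ae_restrict_mem measurableSet_Icc] with x hx hm
    rw [hx, fracIntRight_eq_integral_kern hβ1.ne' _ hm]
    ring
  refine ⟨(h1.const_mul _).congr hae, ?_⟩
  rw [← integral_congr_ae hae, integral_const_mul, h2, inner_hingeVec, ← mul_assoc,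
    ← integral_const_mul]
  refine integral_congr_ae (Eventually.of_forall fun t => ?_)
  have hG : Real.Gamma (1 - β) ≠ 0 := (Real.Gamma_pos_of_pos hβ1).ne'
  simp only [hingeDeriv]
  rw [show 1 - β + 1 = 2 - β by ring, show Real.Gamma (2 - β) = (1 - β) * Real.Gamma (1 - β) by
    rw [← Real.Gamma_add_one hβ1.ne']; ring_nf]
  field_simp

/-- The cell indicator is almost everywhere the difference of the indicators of `x > j/m` and `x >
(j+1)/m`, so the duality applies at both endpoints. This links `H_m^†` to the Gaussian sum
`interpDeriv`. -/
theorem inner_eStep_hBasis (β : ℝ) (hβ : β < 1 / 2) (e : HilbertBasis ℕ ℝ L2) (m j n : ℕ) :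
    ⟪eStep m j, hBasis β hβ e n⟫_ℝ = Real.sqrt m * ⟪cellVec β hβ m j, e n⟫_ℝ := by
  have h1 := integral_kern_one_mul_hBasis β hβ e n (a := j / m) (by positivity)
  have h2 := integral_kern_one_mul_hBasis β hβ e n (a := (j + 1) / m) (by positivity)
  have hle : (j : ℝ) / m ≤ (j + 1) / m := by gcongr; linarith
  rw [eStep, L2.inner_indicatorConstLp_eq_inner_setIntegral, cellVec, inner_sub_left, ← h1.2,
    ← h2.2, ← integral_sub h1.1 h2.1, ← integral_indicator measurableSet_Ico, real_inner_eq_mul]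
  congr 1
  refine integral_congr_ae ?_
  have hn : ∀ c : ℝ, ∀ᵐ t ∂unitVolume, t ≠ c := fun c => ae_restrict_of_ae (by simp [ae_iff])
  filter_upwards [hn (j / m), hn ((j + 1) / m)] with t ha hb
  rcases lt_or_gt_of_ne ha with h | h <;> rcases lt_or_gt_of_ne hb with h' | h'
  · simp [kern, h.not_gt, h'.not_gt, h.not_ge]
  · exact absurd (h.trans_le hle) h'.not_gt
  · simp [kern, h, h', h.le, h'.not_gt]
  · simp [kern, h, h', h'.not_gt]

theorem inner_eStep_eStep {m : ℕ} {i j : ℕ} (hi : i < m) :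
    ⟪eStep m i, eStep m j⟫_ℝ = if i = j then 1 else 0 := by
  have hm : (0 : ℝ) < m := by exact_mod_cast (Nat.zero_le i).trans_lt hi
  have hi1 : ((i : ℝ) + 1) / m ≤ 1 := by
    rw [div_le_one hm]
    exact_mod_cast hi
  have hi0 : 0 ≤ (i : ℝ) / m := by positivity
  have hlt : ∀ k l : ℕ, k < l → ((k : ℝ) + 1) / m ≤ l / m := fun k l h => by
    gcongr
    exact_mod_cast h
  rw [eStep, eStep, L2.inner_indicatorConstLp_eq_inner_setIntegral,
    integral_congr_ae (ae_restrict_of_ae indicatorConstLp_coeFn),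
    setIntegral_indicator measurableSet_Ico, setIntegral_const, real_inner_eq_mul,
    smul_eq_mul, mul_left_comm, Real.mul_self_sqrt hm.le, Measure.real,
    Measure.restrict_apply (measurableSet_Ico.inter measurableSet_Ico)]
  split_ifs with h
  · subst h
    rw [inter_self, inter_eq_self_of_subset_left (show Ico ((i : ℝ) / m) ((i + 1) / m) ⊆ Icc (0 : ℝ) 1
      from fun t ht => ⟨hi0.trans ht.1, ht.2.le.trans hi1⟩),
      Real.volume_Ico, ENNReal.toReal_ofReal (by rw [← sub_div]; simp)]
    field_simp
    ring
  · have : Ico ((i : ℝ) / m) ((i + 1) / m) ∩ Ico ((j : ℝ) / m) ((j + 1) / m) = ∅ := by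
      rcases lt_or_gt_of_ne h with h | h
      · have := hlt _ _ h
        ext t
        simp only [mem_inter_iff, mem_Ico, mem_empty_iff_false, iff_false]
        intro ht
        linarith [ht.1.2, ht.2.1]
      · have := hlt _ _ h
        ext t
        simp only [mem_inter_iff, mem_Ico, mem_empty_iff_false, iff_false]
        intro ht
        linarith [ht.1.1, ht.2.2]
    rw [this]
    simp

/-- The coordinates of `I^{1-β}_{0+} e_j^m` in the basis `e`. -/
noncomputable def stepCoord (β : ℝ) (hβ : β < 1 / 2) (e : HilbertBasis ℕ ℝ L2) (m j : ℕ) : l2 :=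
  e.repr (Real.sqrt m • cellVec β hβ m j)

theorem stepCoord_apply (β : ℝ) (hβ : β < 1 / 2) (e : HilbertBasis ℕ ℝ L2) (m j n : ℕ) :
    stepCoord β hβ e m j n = ⟪eStep m j, hBasis β hβ e n⟫_ℝ := by
  rw [stepCoord, e.repr_apply_apply, inner_eStep_hBasis, real_inner_smul_right, real_inner_comm]

theorem HDagger_eq_sum (β : ℝ) (hβ : β < 1 / 2) (e : HilbertBasis ℕ ℝ L2) (m n : ℕ) :
    HDagger β hβ e m n = ∑ j ∈ Finset.range m, stepCoord β hβ e m j n • eStep m j := by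
  refine Submodule.eq_starProjection_of_mem_of_inner_eq_zero ?_ ?_
  · refine Submodule.sum_mem _ fun j hj => Submodule.smul_mem _ _ (Submodule.subset_span ?_)
    exact ⟨⟨j, Finset.mem_range.1 hj⟩, rfl⟩
  · intro w hw
    induction hw using Submodule.span_induction with
    | mem x hx =>
      obtain ⟨i, rfl⟩ := hx
      simp only [inner_sub_left, sum_inner, real_inner_smul_left]
      rw [Finset.sum_congr rfl fun j hj => by
        rw [inner_eStep_eStep (Finset.mem_range.1 hj)]]
      simp [stepCoord_apply, real_inner_comm]
    | zero => simp
    | add x y _ _ hx hy => rw [inner_add_right, hx, hy, add_zero]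
    | smul a x _ hx => rw [real_inner_smul_right, hx, mul_zero]

/-- `H_m^†` as a finite sum of elementary tensors. -/
theorem HDagger_eq_coe_sum (β : ℝ) (hβ : β < 1 / 2) (e : HilbertBasis ℕ ℝ L2) (m : ℕ) :
    HDagger β hβ e m
      = ((∑ j ∈ Finset.range m, tmul (stepCoord β hβ e m j) (eStep m j) : ℓ²(ℕ, L2)) :
        ℕ → L2) := by
  ext1 n
  rw [HDagger_eq_sum, lp.coeFn_sum, Finset.sum_apply]
  rfl

theorem memℓp_HDagger (β : ℝ) (hβ : β < 1 / 2) (e : HilbertBasis ℕ ℝ L2) (m : ℕ) :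
    Memℓp (HDagger β hβ e m) 2 := by
  rw [HDagger_eq_coe_sum]
  exact lp.memℓp _

theorem toOp_HDagger (β : ℝ) (hβ : β < 1 / 2) (e : HilbertBasis ℕ ℝ L2) (m : ℕ)
    (h : Memℓp (HDagger β hβ e m) 2) (y : L2) :
    toOp (⟨HDagger β hβ e m, h⟩ : ℓ²(ℕ, L2)) y
      = ∑ j ∈ Finset.range m, ⟪eStep m j, y⟫_ℝ • stepCoord β hβ e m j := by
  ext n
  rw [toOp_apply, lp.coeFn_sum, Finset.sum_apply]
  change ⟪HDagger β hβ e m n, y⟫_ℝ = _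
  rw [HDagger_eq_sum, sum_inner]
  refine Finset.sum_congr rfl fun j _ => ?_
  rw [real_inner_smul_left, mul_comm]
  rfl

theorem adjoint_toOp_HDagger (β : ℝ) (hβ : β < 1 / 2) (e : HilbertBasis ℕ ℝ L2) (m : ℕ)
    (h : Memℓp (HDagger β hβ e m) 2) (v : l2) :
    ContinuousLinearMap.adjoint (toOp (⟨HDagger β hβ e m, h⟩ : ℓ²(ℕ, L2))) v
      = ∑ j ∈ Finset.range m, ⟪stepCoord β hβ e m j, v⟫_ℝ • eStep m j := by
  refine ext_inner_right ℝ fun y => ?_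
  rw [ContinuousLinearMap.adjoint_inner_left, toOp_HDagger, inner_sum, sum_inner]
  refine Finset.sum_congr rfl fun j _ => ?_
  rw [real_inner_smul_left, real_inner_smul_right, real_inner_comm v, mul_comm]

/-- Orthonormality of the `e_j^m` collapses `H H*` to the operator `∑ j, v_j ⊗ v_j`, the covariance
of `∑ j, (√m ΔB_j) • v_j`. -/
theorem partialTrace_HDagger (β : ℝ) (hβ : β < 1 / 2) (e : HilbertBasis ℕ ℝ L2) (m : ℕ)
    (h : Memℓp (HDagger β hβ e m) 2) (v : l2) :
    partialTrace (⟨HDagger β hβ e m, h⟩ : ℓ²(ℕ, L2)) v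
      = ∑ j ∈ Finset.range m, ⟪stepCoord β hβ e m j, v⟫_ℝ • stepCoord β hβ e m j := by
  rw [partialTrace, ContinuousLinearMap.comp_apply, adjoint_toOp_HDagger, toOp_HDagger]
  refine Finset.sum_congr rfl fun j hj => ?_
  simp only [inner_sum, real_inner_smul_right, inner_eStep_eStep (Finset.mem_range.1 hj)]
  congr 1
  simp only [mul_ite, mul_one, mul_zero, Finset.sum_ite_eq, hj, if_true]

theorem inner_basisVec (v : l2) (n : ℕ) : ⟪v, basisVec n⟫_ℝ = v n := by
  rw [basisVec, lp.inner_single_right]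
  simp

theorem hasSum_basisVec (v : l2) : HasSum (fun n => v n • basisVec n) v := by
  have := lp.hasSum_single (p := 2) (by norm_num) v
  refine this.congr_fun fun n => ?_
  rw [basisVec, ← lp.single_smul]
  simp

theorem hasSum_map_basisVec {Y : Type*} [NormedAddCommGroup Y] [NormedSpace ℝ Y]
    (A : l2 →L[ℝ] Y) (v : l2) : HasSum (fun n => v n • A (basisVec n)) (A v) := by
  simpa using (hasSum_basisVec v).mapL A

/-- The operator has finite rank, so the trace series converges for every bounded `A`: sum over the
basis inside each rank-one term. -/
theorem trace_partialTrace_HDagger_comp (β : ℝ) (hβ : β < 1 / 2) (e : HilbertBasis ℕ ℝ L2) (m : ℕ)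
    (h : Memℓp (HDagger β hβ e m) 2) (A : l2 →L[ℝ] l2) :
    trace (partialTrace (⟨HDagger β hβ e m, h⟩ : ℓ²(ℕ, L2)) ∘L A)
      = ∑ j ∈ Finset.range m, ⟪stepCoord β hβ e m j, A (stepCoord β hβ e m j)⟫_ℝ := by
  refine HasSum.tsum_eq ?_
  have h1 : ∀ j ∈ Finset.range m, HasSum
      (fun n => stepCoord β hβ e m j n * ⟪stepCoord β hβ e m j, A (basisVec n)⟫_ℝ)
      ⟪stepCoord β hβ e m j, A (stepCoord β hβ e m j)⟫_ℝ := fun j _ => by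
    simpa [real_inner_smul_right] using
      (hasSum_map_basisVec A (stepCoord β hβ e m j)).mapL (innerSL ℝ (stepCoord β hβ e m j))
  refine (hasSum_sum h1).congr_fun fun n => ?_
  rw [ContinuousLinearMap.comp_apply, partialTrace_HDagger, sum_inner]
  refine Finset.sum_congr rfl fun j _ => ?_
  rw [real_inner_smul_left, inner_basisVec, mul_comm]

end BrownianStein

/-! ### Hilbert–Schmidt norms and test functions -/

namespace BrownianStein

open Filter Topology

theorem tsum_mul_sq_le (f g : ℕ → ℝ≥0∞) :
    (∑' n, f n * g n) ^ 2 ≤ (∑' n, f n ^ 2) * ∑' n, g n ^ 2 := by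
  have h := ENNReal.lintegral_mul_le_Lp_mul_Lq (μ := Measure.count) Real.HolderConjugate.two_two
    (f := f) (g := g) (measurable_of_countable f).aemeasurable
    (measurable_of_countable g).aemeasurable
  simp only [lintegral_count, Pi.mul_apply, ENNReal.rpow_two] at h
  refine (pow_le_pow_left₀ zero_le h 2).trans (le_of_eq ?_)
  rw [mul_pow, ← ENNReal.rpow_mul_natCast, ← ENNReal.rpow_mul_natCast]
  norm_num

theorem tsum_enorm_sq (v : l2) : ∑' n, ‖v n‖ₑ ^ 2 = ‖v‖ₑ ^ 2 := by
  have h := lp.hasSum_norm (p := 2) (by norm_num) v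
  simp only [ENNReal.toReal_ofNat, Real.rpow_ofNat] at h
  have h2 := ENNReal.ofReal_tsum_of_nonneg (fun n => sq_nonneg ‖v n‖) h.summable
  rw [h.tsum_eq] at h2
  simp only [ENNReal.ofReal_pow (norm_nonneg _), ofReal_norm] at h2
  exact h2.symm

/-- The Hilbert–Schmidt norm dominates the operator norm. Values in `ℝ≥0∞` make summability
hypotheses unnecessary. -/
theorem enorm_apply_sq_le {Y : Type*} [NormedAddCommGroup Y] [NormedSpace ℝ Y]
    (A : l2 →L[ℝ] Y) (v : l2) : ‖A v‖ₑ ^ 2 ≤ (∑' n, ‖A (basisVec n)‖ₑ ^ 2) * ‖v‖ₑ ^ 2 := by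
  have h := hasSum_map_basisVec A v
  calc ‖A v‖ₑ ^ 2 ≤ (∑' n, ‖v n‖ₑ * ‖A (basisVec n)‖ₑ) ^ 2 := by
        refine pow_le_pow_left₀ zero_le ?_ 2
        rw [← h.tsum_eq]
        refine enorm_tsum_le_tsum_enorm.trans (le_of_eq ?_)
        simp only [enorm_smul]
    _ ≤ _ := tsum_mul_sq_le _ _
    _ = _ := by rw [tsum_enorm_sq, mul_comm]

section

variable {X : Type*} [NormedAddCommGroup X] [InnerProductSpace ℝ X]

theorem hsNorm_sq {j : ℕ} (T : ContinuousMultilinearMap ℝ (fun _ : Fin j => l2) X) :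
    hsNorm T ^ 2 = ∑' i : Fin j → ℕ, ‖T fun a => basisVec (i a)‖ₑ ^ 2 := by
  rw [hsNorm, ← ENNReal.rpow_mul_natCast]
  norm_num

theorem enorm_apply_one_le (T : ContinuousMultilinearMap ℝ (fun _ : Fin 1 => l2) X)
    (v : Fin 1 → l2) : ‖T v‖ₑ ≤ hsNorm T * ‖v 0‖ₑ := by
  have h := enorm_apply_sq_le (T.toContinuousLinearMap 0 0) (v 0)
  have e : ∀ u : l2, T.toContinuousLinearMap 0 0 u = T fun _ => u := fun u => by
    change T (Function.update 0 0 u) = _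
    congr 1
    ext1 i
    rw [Subsingleton.elim i 0, Function.update_self]
  simp only [e] at h
  have h2 : ∑' n, ‖T fun _ => basisVec n‖ₑ ^ 2 = hsNorm T ^ 2 := by
    rw [hsNorm_sq, ← (Equiv.funUnique (Fin 1) ℕ).symm.tsum_eq]
    rfl
  rw [h2, ← mul_pow] at h
  have h3 : (fun _ => v 0) = v := by
    ext1 i
    rw [Subsingleton.elim i 0]
  rw [h3] at h
  exact (ENNReal.pow_le_pow_left_iff two_ne_zero).1 h

/-- The one-variable bound is applied in the second argument, then in the first for each basis
vector in the second. -/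
theorem enorm_apply_two_le (T : ContinuousMultilinearMap ℝ (fun _ : Fin 2 => l2) X)
    (v : Fin 2 → l2) : ‖T v‖ₑ ≤ hsNorm T * (‖v 0‖ₑ * ‖v 1‖ₑ) := by
  have e0 : ∀ u w : l2, T.toContinuousLinearMap ![u, w] 0 u = T ![u, w] := fun u w => by
    change T (Function.update _ _ _) = _
    congr 1
    ext1 i
    fin_cases i <;> simp
  have e0' : ∀ u u' w : l2, T.toContinuousLinearMap ![u', w] 0 u = T ![u, w] := fun u u' w => by
    change T (Function.update _ _ _) = _
    congr 1
    ext1 i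
    fin_cases i <;> simp
  have e1 : ∀ u w w' : l2, T.toContinuousLinearMap ![u, w'] 1 w = T ![u, w] := fun u w w' => by
    change T (Function.update _ _ _) = _
    congr 1
    ext1 i
    fin_cases i <;> simp
  have h1 : ‖T ![v 0, v 1]‖ₑ ^ 2 ≤ (∑' k, ‖T ![v 0, basisVec k]‖ₑ ^ 2) * ‖v 1‖ₑ ^ 2 := by
    have := enorm_apply_sq_le (T.toContinuousLinearMap ![v 0, 0] 1) (v 1)
    simpa only [e1] using this
  have h2 : ∀ k, ‖T ![v 0, basisVec k]‖ₑ ^ 2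
      ≤ (∑' n, ‖T ![basisVec n, basisVec k]‖ₑ ^ 2) * ‖v 0‖ₑ ^ 2 := fun k => by
    have := enorm_apply_sq_le (T.toContinuousLinearMap ![0, basisVec k] 0) (v 0)
    simpa only [e0'] using this
  have h3 : ∑' k, ∑' n, ‖T ![basisVec n, basisVec k]‖ₑ ^ 2 = hsNorm T ^ 2 := by
    rw [hsNorm_sq, ← (finTwoArrowEquiv ℕ).symm.tsum_eq, ENNReal.tsum_comm, ← ENNReal.tsum_prod]
    refine tsum_congr fun p => ?_
    congr 3
    ext1 i
    fin_cases i <;> rfl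
  have h4 : ‖T ![v 0, v 1]‖ₑ ^ 2 ≤ (hsNorm T * (‖v 0‖ₑ * ‖v 1‖ₑ)) ^ 2 := by
    refine h1.trans ((mul_le_mul_left (ENNReal.tsum_le_tsum h2) _).trans (le_of_eq ?_))
    rw [ENNReal.tsum_mul_right, h3]
    ring
  have h5 : ![v 0, v 1] = v := by
    ext1 i
    fin_cases i <;> rfl
  rw [h5] at h4
  exact (ENNReal.pow_le_pow_left_iff two_ne_zero).1 h4

/-- Test functions have bounded and Lipschitz derivatives. -/
theorem MemCb.fderiv_bounds {F : l2 → X} (hF : MemCb 2 F) :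
    Differentiable ℝ F ∧ (∀ x, ‖fderiv ℝ F x‖ ≤ (cbNorm 2 F).toReal) ∧
      ∀ x y, ‖fderiv ℝ F x - fderiv ℝ F y‖ ≤ (cbNorm 2 F).toReal * ‖x - y‖ := by
  obtain ⟨hd, hb⟩ := hF
  have hle : ∀ j ∈ Finset.Icc 1 2, ∀ x, hsNorm (iteratedFDeriv ℝ j F x) ≤ cbNorm 2 F :=
    fun j hj x => (le_iSup (fun x => hsNorm (iteratedFDeriv ℝ j F x)) x).trans
      (le_iSup₂ (f := fun j (_ : j ∈ Finset.Icc 1 2) => derivSupNorm j F) j hj)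
  have hreal : ∀ {a b : ℝ} {c : ℝ≥0∞}, c ≠ ⊤ → 0 ≤ a → 0 ≤ b →
      ENNReal.ofReal a ≤ c * ENNReal.ofReal b → a ≤ c.toReal * b := fun hc ha hb' h => by
    rw [← ENNReal.ofReal_toReal hc, ← ENNReal.ofReal_mul ENNReal.toReal_nonneg] at h
    exact (ENNReal.ofReal_le_ofReal_iff (mul_nonneg ENNReal.toReal_nonneg hb')).1 h
  have hdF : Differentiable ℝ F := by
    have h0 := hd 0 (by norm_num)
    have e : F = fun x => (continuousMultilinearCurryFin0 ℝ l2 X) (iteratedFDeriv ℝ 0 F x) := by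
      ext1 x
      simp
    rw [e]
    exact (continuousMultilinearCurryFin0 ℝ l2 X).toContinuousLinearEquiv.differentiable.comp h0
  have n1 : ∀ x, ‖fderiv ℝ F x‖ ≤ (cbNorm 2 F).toReal := by
    intro x
    refine ContinuousLinearMap.opNorm_le_bound _ ENNReal.toReal_nonneg fun v => ?_
    refine hreal hb.ne (norm_nonneg _) (norm_nonneg _) ?_
    rw [ofReal_norm, ofReal_norm]
    have := enorm_apply_one_le (iteratedFDeriv ℝ 1 F x) (fun _ => v)
    rw [iteratedFDeriv_one_apply] at this
    exact this.trans (mul_le_mul_left (hle 1 (by simp) x) _)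
  -- The derivative of `iteratedFDeriv ℝ 1 F` has the norm of the second iterated derivative; the
  -- mean value inequality then makes the first derivative Lipschitz.
  have n2 : ∀ x, ‖fderiv ℝ (iteratedFDeriv ℝ 1 F) x‖ ≤ (cbNorm 2 F).toReal := by
    intro x
    rw [norm_fderiv_iteratedFDeriv]
    refine ContinuousMultilinearMap.opNorm_le_bound ENNReal.toReal_nonneg fun v => ?_
    refine hreal hb.ne (norm_nonneg _) (by positivity) ?_
    rw [Fin.prod_univ_two, ENNReal.ofReal_mul (norm_nonneg _), ofReal_norm, ofReal_norm,
      ofReal_norm]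
    exact (enorm_apply_two_le _ v).trans (mul_le_mul_left (hle 2 (by simp) x) _)
  refine ⟨hdF, n1, fun x y => ?_⟩
  have h1 := hd 1 (by norm_num)
  have h2 := Convex.norm_image_sub_le_of_norm_fderiv_le (s := univ)
    (fun z _ => h1 z) (fun z _ => n2 z) convex_univ (mem_univ y) (mem_univ x)
  refine le_trans ?_ h2
  refine ContinuousLinearMap.opNorm_le_bound _ (norm_nonneg _) fun v => ?_
  have h3 := (iteratedFDeriv ℝ 1 F x - iteratedFDeriv ℝ 1 F y).le_opNorm (fun _ => v)
  rw [sub_apply, iteratedFDeriv_one_apply, iteratedFDeriv_one_apply] at h3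
  simpa using h3

end

/-! ### Taylor bounds and one-dimensional Gaussian integration by parts -/

/-- Second order Taylor bound for a function with Lipschitz derivative. -/
theorem norm_sub_sub_fderiv_le {E Y : Type*} [NormedAddCommGroup E] [NormedSpace ℝ E]
    [NormedAddCommGroup Y] [NormedSpace ℝ Y] {F : E → Y} {C : ℝ} (hd : Differentiable ℝ F)
    (hL : ∀ x y, ‖fderiv ℝ F x - fderiv ℝ F y‖ ≤ C * ‖x - y‖) (x y : E) :
    ‖F (x + y) - F x - fderiv ℝ F x y‖ ≤ C / 2 * ‖y‖ ^ 2 := by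
  have hline : ∀ t : ℝ, HasDerivAt (fun t : ℝ => x + t • y) y t := fun t => by
    simpa using ((hasDerivAt_id t).smul_const y).const_add x
  have hg : ∀ t : ℝ, HasDerivAt (fun t : ℝ => F (x + t • y) - F x - t • fderiv ℝ F x y)
      (fderiv ℝ F (x + t • y) y - fderiv ℝ F x y) t := fun t => by
    have h1 := (hd (x + t • y)).hasFDerivAt.comp_hasDerivAt t (hline t)
    have h2 := (hasDerivAt_id t).smul_const (fderiv ℝ F x y)
    exact ((h1.sub_const (F x)).sub h2).congr_deriv (by simp)
  have hB : ∀ t : ℝ, HasDerivAt (fun t : ℝ => C / 2 * ‖y‖ ^ 2 * t ^ 2) (C * ‖y‖ ^ 2 * t) t :=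
    fun t => by
      have := (hasDerivAt_pow 2 t).const_mul (C / 2 * ‖y‖ ^ 2)
      refine this.congr_deriv ?_
      push_cast
      ring
  -- Along the segment the remainder has derivative of norm at most `C t ‖y‖²`, so it stays below
  -- `C/2 ‖y‖² t²`, and `t = 1` concludes.
  have := image_norm_le_of_norm_deriv_right_le_deriv_boundary (a := 0) (b := 1)
    (f := fun t : ℝ => F (x + t • y) - F x - t • fderiv ℝ F x y)
    (B := fun t : ℝ => C / 2 * ‖y‖ ^ 2 * t ^ 2)
    (fun t _ => (hg t).continuousAt.continuousWithinAt) (fun t _ => (hg t).hasDerivWithinAt)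
    (by simp) hB
    (fun t ht => by
      rw [← sub_apply]
      refine (ContinuousLinearMap.le_opNorm _ _).trans ?_
      have := hL (x + t • y) x
      rw [add_sub_cancel_left, norm_smul, Real.norm_of_nonneg ht.1] at this
      nlinarith [mul_le_mul_of_nonneg_right this (norm_nonneg y)])
    (right_mem_Icc.2 zero_le_one)
  simpa using this

theorem norm_sub_le_of_norm_fderiv_le {E Y : Type*} [NormedAddCommGroup E] [NormedSpace ℝ E]
    [NormedAddCommGroup Y] [NormedSpace ℝ Y] {F : E → Y} {C : ℝ} (hd : Differentiable ℝ F)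
    (hC : ∀ x, ‖fderiv ℝ F x‖ ≤ C) (x y : E) : ‖F x - F y‖ ≤ C * ‖x - y‖ :=
  Convex.norm_image_sub_le_of_norm_fderiv_le (s := univ)
    (fun z _ => hd z) (fun z _ => hC z) convex_univ (mem_univ y) (mem_univ x)

/-- Gaussian integration by parts on the real line. -/
theorem integral_mul_gaussianReal {v : ℝ≥0} (hv : v ≠ 0) {φ φ' : ℝ → ℝ} {C D : ℝ}
    (hφ : ∀ x, HasDerivAt φ (φ' x) x) (hb : ∀ x, |φ x| ≤ C * |x| + D) (hb' : ∀ x, |φ' x| ≤ C) :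
    Integrable (fun x => x * φ x) (gaussianReal 0 v) ∧ Integrable φ' (gaussianReal 0 v) ∧
      ∫ x, x * φ x ∂gaussianReal 0 v = v * ∫ x, φ' x ∂gaussianReal 0 v := by
  have hv' : (v : ℝ) ≠ 0 := by exact_mod_cast hv
  have hφc : Continuous φ := continuous_iff_continuousAt.2 fun x => (hφ x).continuousAt
  have hφ'm : Measurable φ' := by
    have : φ' = deriv φ := funext fun x => (hφ x).deriv.symm
    rw [this]
    exact measurable_deriv φ
  have hid : Integrable (fun x : ℝ => x) (gaussianReal 0 v) :=
    (memLp_id_gaussianReal' (μ := 0) (v := v) 2 (by norm_num)).integrable (by norm_num)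
  have hsq : Integrable (fun x : ℝ => x ^ 2) (gaussianReal 0 v) :=
    (memLp_id_gaussianReal' (μ := 0) (v := v) 2 (by norm_num)).integrable_sq
  have i1 : Integrable (fun x => x * φ x) (gaussianReal 0 v) := by
    refine Integrable.mono' ((hsq.const_mul C).add (hid.abs.const_mul D))
      (by fun_prop) (Eventually.of_forall fun x => ?_)
    rw [norm_mul, Real.norm_eq_abs, Real.norm_eq_abs, Pi.add_apply]
    have h1 := mul_le_mul_of_nonneg_left (hb x) (abs_nonneg x)
    have h2 : |x| * (C * |x| + D) = C * |x| ^ 2 + D * |x| := by ring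
    rwa [h2, sq_abs] at h1
  have i2 : Integrable φ' (gaussianReal 0 v) :=
    Integrable.of_bound hφ'm.aestronglyMeasurable C (Eventually.of_forall hb')
  have i3 : Integrable φ (gaussianReal 0 v) :=
    Integrable.mono' ((hid.abs.const_mul C).add (integrable_const D))
      hφc.aestronglyMeasurable (Eventually.of_forall fun x => hb x)
  refine ⟨i1, i2, ?_⟩
  have hiff : ∀ g : ℝ → ℝ, Integrable g (gaussianReal 0 v) →
      Integrable (fun x => gaussianPDFReal 0 v x * g x) := fun g hg => by
    rw [gaussianReal_of_var_ne_zero 0 hv, integrable_withDensity_iff_integrable_smul'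
      (measurable_gaussianPDF 0 v) (Eventually.of_forall fun _ => gaussianPDF_lt_top)] at hg
    simpa only [toReal_gaussianPDF, smul_eq_mul] using hg
  have hpdf : ∀ x, HasDerivAt (gaussianPDFReal 0 v) (-(x / v) * gaussianPDFReal 0 v x) x := by
    intro x
    have h1 : HasDerivAt (fun x : ℝ => -(x - 0) ^ 2 / (2 * v)) (-(x / v)) x := by
      have := (((hasDerivAt_id x).sub_const 0).pow 2).neg.div_const (2 * (v : ℝ))
      refine this.congr_deriv ?_
      simp
      field_simp
    have h2 := (h1.exp).const_mul ((Real.sqrt (2 * Real.pi * v))⁻¹)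
    rw [gaussianPDFReal_def]
    refine h2.congr_deriv ?_
    ring
  -- The density satisfies `p' = -(x / v) p`. Integrability of `φ p'`, `φ' p` and `φ p` removes the
  -- boundary terms at infinity.
  have key := integral_mul_deriv_eq_deriv_mul_of_integrable (u := φ) (u' := φ')
    (v := gaussianPDFReal 0 v) (v' := fun x => -(x / v) * gaussianPDFReal 0 v x)
    (fun x _ => hφ x) (fun x _ => hpdf x)
    (((hiff _ i1).const_mul (-(1 / (v : ℝ)))).congr (Eventually.of_forall fun x => by
      simp only [Pi.mul_apply]; ring))
    ((hiff _ i2).congr (Eventually.of_forall fun x => by simp only [Pi.mul_apply]; ring))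
    ((hiff _ i3).congr (Eventually.of_forall fun x => by simp only [Pi.mul_apply]; ring))
  rw [integral_gaussianReal_eq_integral_smul hv, integral_gaussianReal_eq_integral_smul hv]
  simp only [smul_eq_mul]
  have e1 : ∫ x, φ x * (-(x / v) * gaussianPDFReal 0 v x)
      = -(1 / (v : ℝ)) * ∫ x, gaussianPDFReal 0 v x * (x * φ x) := by
    rw [← integral_const_mul]
    congr 1
    ext x
    ring
  have e2 : ∫ x, φ' x * gaussianPDFReal 0 v x = ∫ x, gaussianPDFReal 0 v x * φ' x := by
    congr 1
    ext x
    ring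
  rw [e1, e2] at key
  generalize ∫ x, gaussianPDFReal 0 v x * (x * φ x) = I at *
  generalize ∫ x, gaussianPDFReal 0 v x * φ' x = I' at *
  field_simp at key
  linarith

end BrownianStein

/-! ### Gaussian increments: covariances and independence -/

namespace BrownianStein

open Filter Topology

theorem cellIncr_mem_span {Ω : Type*} (W : ℝ≥0 → Ω → ℝ) (m j : ℕ) :
    (fun ω => cellIncr m j (path W ω)) ∈ Submodule.span ℝ (range W) :=
  Submodule.sub_mem _ (Submodule.subset_span ⟨_, rfl⟩) (Submodule.subset_span ⟨_, rfl⟩)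

theorem fineDev_mem_span {Ω : Type*} (W : ℝ≥0 → Ω → ℝ) (m q i : ℕ) :
    (fun ω => fineDev m q i (path W ω)) ∈ Submodule.span ℝ (range W) :=
  Submodule.sub_mem _ (cellIncr_mem_span W _ _)
    (Submodule.smul_mem _ (1 / (q : ℝ)) (cellIncr_mem_span W _ _))

section

variable {Ω : Type*} [MeasurableSpace Ω] {P : Measure Ω} {W : ℝ≥0 → Ω → ℝ}

/-- Each variable is a fixed linear combination of finitely many values of `W`. Working in this span
reduces independence to covariance computations. -/
theorem isGaussianProcess_of_mem_span {S : Type*} {Z : S → Ω → ℝ} (hW : IsGaussianProcess W P)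
    (h : ∀ s, Z s ∈ Submodule.span ℝ (range W)) : IsGaussianProcess Z P := by
  refine hW.of_isGaussianProcess fun s => ?_
  obtain ⟨c, hc⟩ := Finsupp.mem_span_range_iff_exists_finsupp.1 (h s)
  refine ⟨c.support, ∑ i : c.support, c i • ContinuousLinearMap.proj i, fun ω => ?_⟩
  rw [← hc, Finsupp.sum, sum_apply, Finset.sum_apply,
    ← Finset.sum_coe_sort c.support]
  rfl

theorem memLp_and_integral_eq_zero_of_mem_span (hW : IsPreBrownianReal W P) {f : Ω → ℝ}
    (hf : f ∈ Submodule.span ℝ (range W)) : MemLp f 2 P ∧ ∫ ω, f ω ∂P = 0 := by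
  have := hW.isGaussianProcess.isProbabilityMeasure
  induction hf using Submodule.span_induction with
  | mem x hx =>
    obtain ⟨t, rfl⟩ := hx
    exact ⟨(hW.isGaussianProcess.hasGaussianLaw_eval t).memLp_two, hW.integral_eval t⟩
  | zero => exact ⟨MemLp.zero, by simp⟩
  | add x y _ _ hx hy =>
    refine ⟨hx.1.add hy.1, ?_⟩
    simp only [Pi.add_apply]
    rw [integral_add (hx.1.integrable (by norm_num)) (hy.1.integrable (by norm_num)), hx.2, hy.2,
      add_zero]
  | smul a x _ hx =>
    refine ⟨hx.1.const_smul a, ?_⟩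
    simp only [Pi.smul_apply, smul_eq_mul]
    rw [integral_const_mul, hx.2, mul_zero]

/-- The variables are jointly Gaussian and centred, so vanishing of the mixed second moments already
gives independence from the whole family. -/
theorem indepFun_of_mem_span {ι : Type*} (hW : IsPreBrownianReal W P) {f : Ω → ℝ}
    {Y : ι → Ω → ℝ} (hf : f ∈ Submodule.span ℝ (range W))
    (hY : ∀ i, Y i ∈ Submodule.span ℝ (range W)) (h : ∀ i, ∫ ω, f ω * Y i ω ∂P = 0) :
    IndepFun f (fun ω i => Y i ω) P := by
  have := hW.isGaussianProcess.isProbabilityMeasure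
  obtain ⟨f1, f2⟩ := memLp_and_integral_eq_zero_of_mem_span hW hf
  have hY' := fun i => memLp_and_integral_eq_zero_of_mem_span hW (hY i)
  have hG : IsGaussianProcess (Sum.elim (fun _ : Unit => f) Y) P :=
    isGaussianProcess_of_mem_span hW.isGaussianProcess (by rintro (_ | i) <;> simp [hf, hY])
  have := hG.indepFun_of_covariance_eq_zero (fun _ => f1.aestronglyMeasurable.aemeasurable)
    (fun i => (hY' i).1.aestronglyMeasurable.aemeasurable) (fun _ i => by
      rw [covariance_eq_sub f1 (hY' i).1, f2, zero_mul, sub_zero]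
      exact h i)
  exact this.comp (measurable_pi_apply ()) measurable_id

theorem integrable_mul_of_mem_span (hW : IsPreBrownianReal W P) {f g : Ω → ℝ}
    (hf : f ∈ Submodule.span ℝ (range W)) (hg : g ∈ Submodule.span ℝ (range W)) :
    Integrable (fun ω => f ω * g ω) P :=
  MemLp.integrable_mul (memLp_and_integral_eq_zero_of_mem_span hW hf).1
    (memLp_and_integral_eq_zero_of_mem_span hW hg).1

theorem integral_path_mul_path (hW : IsPreBrownianReal W P) {s t : ℝ} (hs : 0 ≤ s) (ht : 0 ≤ t) :
    ∫ ω, path W ω s * path W ω t ∂P = min s t := by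
  have := hW.isGaussianProcess.isProbabilityMeasure
  have h := hW.covariance_eval s.toNNReal t.toNNReal
  rw [covariance_eq_sub (hW.isGaussianProcess.hasGaussianLaw_eval _).memLp_two
    (hW.isGaussianProcess.hasGaussianLaw_eval _).memLp_two, hW.integral_eval, zero_mul,
    sub_zero] at h
  change ∫ ω, W s.toNNReal ω * W t.toNNReal ω ∂P = _
  refine h.trans ?_
  simp [hs, ht]

theorem integral_cellIncr_mul_cellIncr (hW : IsPreBrownianReal W P) {m q : ℕ} (hm : 1 ≤ m)
    (hq : 1 ≤ q) (i j : ℕ) :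
    ∫ ω, cellIncr (m * q) i (path W ω) * cellIncr m j (path W ω) ∂P
      = if i / q = j then 1 / ((m : ℝ) * q) else 0 := by
  have hm' : (0 : ℝ) < m := by exact_mod_cast hm
  have hq' : (0 : ℝ) < q := by exact_mod_cast hq
  have hi : ∀ s t : ℝ, Integrable (fun ω => path W ω s * path W ω t) P := fun s t =>
    integrable_mul_of_mem_span hW (Submodule.subset_span ⟨_, rfl⟩) (Submodule.subset_span ⟨_, rfl⟩)
  have hi2 : ∀ r s t : ℝ, Integrable
      (fun ω => path W ω r * path W ω s - path W ω r * path W ω t) P := fun r s t =>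
    (hi r s).sub (hi r t)
  have e : ∀ a b c d : ℝ, 0 ≤ a → 0 ≤ b → 0 ≤ c → 0 ≤ d →
      ∫ ω, (path W ω a - path W ω b) * (path W ω c - path W ω d) ∂P
        = min a c - min a d - (min b c - min b d) := by
    intro a b c d ha hb hc hd
    rw [← integral_path_mul_path hW ha hc, ← integral_path_mul_path hW ha hd,
      ← integral_path_mul_path hW hb hc, ← integral_path_mul_path hW hb hd,
      ← integral_sub (hi _ _) (hi _ _), ← integral_sub (hi _ _) (hi _ _),
      ← integral_sub (hi2 _ _ _) (hi2 _ _ _)]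
    congr 1
    ext ω
    ring
  simp only [cellIncr]
  rw [e _ _ _ _ (by positivity) (by positivity) (by positivity) (by positivity)]
  push_cast
  have a1 : ((i : ℝ) + 1) / (m * q) = i / (m * q) + 1 / (m * q) := by ring
  have a2 : (0 : ℝ) < 1 / (m * q) := by positivity
  -- All endpoints are written on the grid of step `1 / (m * q)`, so evaluating each `min` only
  -- requires comparing integers.
  have a3 : ∀ k : ℕ, (k : ℝ) / m = ((k * q : ℕ) : ℝ) / (m * q) := fun k => by
    push_cast
    rw [mul_div_mul_right _ _ hq'.ne']
  have a4 : ((j : ℝ) + 1) / m = (((j + 1) * q : ℕ) : ℝ) / (m * q) := by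
    rw [← a3]
    push_cast
    rfl
  have a5 : ∀ k l : ℕ, k ≤ l → (k : ℝ) / (m * q) ≤ l / (m * q) := fun k l h => by gcongr
  have a6 := a5 (j * q) ((j + 1) * q) (Nat.mul_le_mul_right _ (Nat.le_succ _))
  rw [a4, a3 j]
  rcases lt_trichotomy (i / q) j with h | h | h
  · have h1 : i + 1 ≤ j * q := (Nat.div_lt_iff_lt_mul hq).1 h
    have h2 := a5 _ _ h1
    push_cast at h2 a6 ⊢
    rw [if_neg h.ne, min_eq_left (by linarith), min_eq_left h2, min_eq_left (by linarith),
      min_eq_left (by linarith)]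
    ring
  · have h1 : j * q ≤ i := by
      rw [← h]
      exact Nat.div_mul_le_self i q
    have h1' : i + 1 ≤ (j + 1) * q := (Nat.div_lt_iff_lt_mul hq).1 (by omega)
    have h2 := a5 _ _ h1
    have h3 := a5 _ _ h1'
    push_cast at h2 h3 a6 ⊢
    rw [if_pos h, min_eq_left h3, min_eq_right (by linarith), min_eq_left (by linarith),
      min_eq_right h2]
    rw [a1]
    ring
  · have h1 : (j + 1) * q ≤ i := (Nat.le_div_iff_mul_le hq).1 h
    have h2 := a5 _ _ h1
    push_cast at h2 a6 ⊢
    rw [if_neg h.ne', min_eq_right (by linarith), min_eq_right (by linarith),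
      min_eq_right (by linarith), min_eq_right (by linarith)]
    ring

theorem integral_cellIncr_mul_cellIncr_self (hW : IsPreBrownianReal W P) {m : ℕ} (hm : 1 ≤ m)
    (i j : ℕ) : ∫ ω, cellIncr m i (path W ω) * cellIncr m j (path W ω) ∂P
      = if i = j then 1 / (m : ℝ) else 0 := by
  simpa using integral_cellIncr_mul_cellIncr hW hm le_rfl i j

/-- When fine cell `i` lies in coarse cell `j`, the covariance `1 / (m q)` is exactly the share `1 /
q` of the coarse variance `1 / m`; otherwise both terms vanish. -/
theorem integral_fineDev_mul_cellIncr (hW : IsPreBrownianReal W P) {m q : ℕ} (hm : 1 ≤ m)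
    (hq : 1 ≤ q) (i j : ℕ) :
    ∫ ω, fineDev m q i (path W ω) * cellIncr m j (path W ω) ∂P = 0 := by
  have h1 := integrable_mul_of_mem_span hW (cellIncr_mem_span W (m * q) i) (cellIncr_mem_span W m j)
  have h2 := integrable_mul_of_mem_span hW (cellIncr_mem_span W m (i / q)) (cellIncr_mem_span W m j)
  have e : ∀ ω, fineDev m q i (path W ω) * cellIncr m j (path W ω)
      = cellIncr (m * q) i (path W ω) * cellIncr m j (path W ω)
        - (1 / (q : ℝ)) * (cellIncr m (i / q) (path W ω) * cellIncr m j (path W ω)) := fun ω => by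
    rw [fineDev]
    ring
  simp_rw [e]
  rw [integral_sub h1 (h2.const_mul _), integral_const_mul,
    integral_cellIncr_mul_cellIncr hW hm hq, integral_cellIncr_mul_cellIncr_self hW hm]
  split_ifs
  · field_simp
    ring
  · ring

theorem hasLaw_cellIncr (hW : IsPreBrownianReal W P) {m : ℕ} (hm : 1 ≤ m) (j : ℕ) :
    HasLaw (fun ω => cellIncr m j (path W ω)) (gaussianReal 0 (1 / (m : ℝ≥0))) P := by
  have h := hW.hasLaw_sub (((j : ℝ) + 1) / m).toNNReal ((j : ℝ) / m).toNNReal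
  have hm' : (0 : ℝ) < m := by exact_mod_cast hm
  have e : nndist ((((j : ℝ) + 1) / m).toNNReal : ℝ) (((j : ℝ) / m).toNNReal : ℝ)
      = 1 / (m : ℝ≥0) := by
    rw [← NNReal.coe_inj, coe_nndist, Real.coe_toNNReal _ (by positivity),
      Real.coe_toNNReal _ (by positivity), Real.dist_eq, ← sub_div, add_sub_cancel_left,
      abs_of_pos (by positivity)]
    simp
  rw [← e]
  exact h

/-- Gaussian integration by parts for a function of a Gaussian variable and of an independent
vector. -/
theorem IndepFun.integral_gaussian_mul {f : Ω → ℝ} {Y : Ω → ℕ → ℝ} {v : ℝ≥0} (hv : v ≠ 0)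
    [IsProbabilityMeasure P] (hf : HasLaw f (gaussianReal 0 v) P) (hY : AEMeasurable Y P)
    (hind : IndepFun f Y P) {φ φ' : ℝ × (ℕ → ℝ) → ℝ} {C : ℝ} (hφ : Continuous φ)
    (hφ' : Continuous φ') (hd : ∀ x y, HasDerivAt (fun x => φ (x, y)) (φ' (x, y)) x)
    (hb : ∀ p, |φ' p| ≤ C) (hi : Integrable (fun ω => f ω * φ (f ω, Y ω)) P) :
    ∫ ω, f ω * φ (f ω, Y ω) ∂P = v * ∫ ω, φ' (f ω, Y ω) ∂P := by
  have hmap := (indepFun_iff_map_prod_eq_prod_map_map hf.aemeasurable hY).1 hind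
  rw [hf.map_eq] at hmap
  have hpair : AEMeasurable (fun ω => (f ω, Y ω)) P := hf.aemeasurable.prodMk hY
  have hmY : IsProbabilityMeasure (P.map Y) := Measure.isProbabilityMeasure_map hY
  have c1 : Continuous fun p : ℝ × (ℕ → ℝ) => p.1 * φ p := continuous_fst.mul hφ
  have e1 : ∫ ω, f ω * φ (f ω, Y ω) ∂P
      = ∫ p, p.1 * φ p ∂(gaussianReal 0 v).prod (P.map Y) := by
    rw [← hmap, integral_map hpair c1.aestronglyMeasurable]
  have e2 : ∫ ω, φ' (f ω, Y ω) ∂P = ∫ p, φ' p ∂(gaussianReal 0 v).prod (P.map Y) := by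
    rw [← hmap, integral_map hpair hφ'.aestronglyMeasurable]
  have i1 : Integrable (fun p : ℝ × (ℕ → ℝ) => p.1 * φ p) ((gaussianReal 0 v).prod (P.map Y)) := by
    rw [← hmap, integrable_map_measure c1.aestronglyMeasurable hpair]
    exact hi
  have i2 : Integrable φ' ((gaussianReal 0 v).prod (P.map Y)) :=
    Integrable.of_bound hφ'.aestronglyMeasurable C (Eventually.of_forall hb)
  rw [e1, e2, integral_prod_symm _ i1, integral_prod_symm _ i2, ← integral_const_mul]
  congr 1
  ext y
  -- By independence and Fubini the vector `y` is frozen; the derivative bound gives linear growth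
  -- in `x`, with constant term `|φ (0, y)|`.
  refine (integral_mul_gaussianReal hv (φ := fun x => φ (x, y)) (φ' := fun x => φ' (x, y))
    (C := C) (D := |φ (0, y)|) (fun x => hd x y) (fun x => ?_) fun x => hb _).2.2
  have h := Convex.norm_image_sub_le_of_norm_hasDerivWithin_le (s := univ) (C := C)
    (fun x _ => (hd x y).hasDerivWithinAt) (fun x _ => hb _) convex_univ (mem_univ 0) (mem_univ x)
  rw [Real.norm_eq_abs, Real.norm_eq_abs, sub_zero] at h
  have := abs_sub_abs_le_abs_sub (φ (x, y)) (φ (0, y))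
  linarith

end

end BrownianStein

/-! ### The Gaussian sum in coordinates and the property `Hyp` -/

namespace BrownianStein

open Filter Topology

section

variable {Ω : Type*} [MeasurableSpace Ω] {P : Measure Ω} {W : ℝ≥0 → Ω → ℝ}

theorem memLp_sum_smul_of_mem_span {E : Type*} [NormedAddCommGroup E] [NormedSpace ℝ E]
    {ι : Type*} (hW : IsPreBrownianReal W P) (s : Finset ι) {a : ι → Ω → ℝ} (x : ι → E)
    (ha : ∀ i, a i ∈ Submodule.span ℝ (range W)) :
    MemLp (fun ω => ∑ i ∈ s, a i ω • x i) 2 P := by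
  refine memLp_finsetSum _ fun i _ => ?_
  exact (ContinuousLinearMap.toSpanSingleton ℝ (x i)).comp_memLp'
    (memLp_and_integral_eq_zero_of_mem_span hW (ha i)).1

theorem integral_inner_sum_smul {E : Type*} [NormedAddCommGroup E] [InnerProductSpace ℝ E]
    {ι κ : Type*} (hW : IsPreBrownianReal W P) (s : Finset ι) (t : Finset κ) {a : ι → Ω → ℝ}
    {b : κ → Ω → ℝ} (x : ι → E) (y : κ → E) (ha : ∀ i, a i ∈ Submodule.span ℝ (range W))
    (hb : ∀ i, b i ∈ Submodule.span ℝ (range W)) :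
    ∫ ω, ⟪∑ i ∈ s, a i ω • x i, ∑ j ∈ t, b j ω • y j⟫_ℝ ∂P
      = ∑ i ∈ s, ∑ j ∈ t, (∫ ω, a i ω * b j ω ∂P) * ⟪x i, y j⟫_ℝ := by
  have h := fun i j => (integrable_mul_of_mem_span hW (ha i) (hb j)).mul_const ⟪x i, y j⟫_ℝ
  have e : ∀ ω, ⟪∑ i ∈ s, a i ω • x i, ∑ j ∈ t, b j ω • y j⟫_ℝ
      = ∑ i ∈ s, ∑ j ∈ t, a i ω * b j ω * ⟪x i, y j⟫_ℝ := fun ω => by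
    rw [sum_inner]
    refine Finset.sum_congr rfl fun i _ => ?_
    rw [inner_sum]
    refine Finset.sum_congr rfl fun j _ => ?_
    rw [real_inner_smul_left, real_inner_smul_right, mul_assoc]
  simp_rw [e]
  rw [integral_finsetSum _ fun i _ => integrable_finsetSum _ fun j _ => h i j]
  refine Finset.sum_congr rfl fun i _ => ?_
  rw [integral_finsetSum _ fun j _ => h i j]
  exact Finset.sum_congr rfl fun j _ => integral_mul_const _ _

theorem MemLp.comp_of_lipschitz {E Y : Type*} [NormedAddCommGroup E]
    [NormedAddCommGroup Y] [IsFiniteMeasure P] {F : E → Y} {C : ℝ}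
    (hF : ∀ x y, ‖F x - F y‖ ≤ C * ‖x - y‖) {X : Ω → E} {p : ℝ≥0∞} (hX : MemLp X p P)
    (hm : AEStronglyMeasurable (fun ω => F (X ω)) P) : MemLp (fun ω => F (X ω)) p P := by
  refine MemLp.mono' ((hX.norm.const_mul C).add (memLp_const ‖F 0‖)) hm
    (Eventually.of_forall fun ω => ?_)
  have h := hF (X ω) 0
  rw [sub_zero] at h
  have := norm_sub_norm_le (F (X ω)) (F 0)
  simp only [Pi.add_apply]
  linarith

/-! ### The law of the interpolated Brownian motion -/

/-- The linear map sending the increments of a path to `𝔍_β` of its interpolation. -/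
noncomputable def stepMap (β : ℝ) (hβ : β < 1 / 2) (e : HilbertBasis ℕ ℝ L2) (m : ℕ)
    (y : ℕ → ℝ) : l2 :=
  ∑ j ∈ Finset.range m, (Real.sqrt m * y j) • stepCoord β hβ e m j

theorem continuous_stepMap (β : ℝ) (hβ : β < 1 / 2) (e : HilbertBasis ℕ ℝ L2) (m : ℕ) :
    Continuous (stepMap β hβ e m) := by
  unfold stepMap
  fun_prop

theorem repr_interpDeriv (β : ℝ) (hβ : β < 1 / 2) (e : HilbertBasis ℕ ℝ L2) (m : ℕ)
    (w : ℝ → ℝ) : e.repr (interpDeriv β hβ m w) = stepMap β hβ e m fun j => cellIncr m j w := by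
  rw [interpDeriv, stepMap, map_sum]
  refine Finset.sum_congr rfl fun j _ => ?_
  rw [stepCoord, map_smul, map_smul, smul_smul]
  congr 1
  have := Real.mul_self_sqrt (Nat.cast_nonneg (α := ℝ) m)
  linear_combination (-cellIncr m j w) * this

theorem J_linInterp {β : ℝ} (hβ0 : 0 ≤ β) (hβ : β < 1 / 2) (e : HilbertBasis ℕ ℝ L2) (m : ℕ)
    (w : ℝ → ℝ) : J β e (linInterp m w) = stepMap β hβ e m fun j => cellIncr m j w := by
  rw [J, (isFracDeriv_linInterp hβ0 hβ m w).fracDeriv_eq hβ0 (by linarith), repr_interpDeriv]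

theorem aemeasurable_cellIncr (hW : IsPreBrownianReal W P) (m j : ℕ) :
    AEMeasurable (fun ω => cellIncr m j (path W ω)) P :=
  (memLp_and_integral_eq_zero_of_mem_span hW
    (cellIncr_mem_span W m j)).1.aestronglyMeasurable.aemeasurable

theorem aemeasurable_cellIncr_pi (hW : IsPreBrownianReal W P) (m : ℕ) :
    AEMeasurable (fun ω j => cellIncr m j (path W ω)) P :=
  aemeasurable_pi_iff.2 fun j => aemeasurable_cellIncr hW m j

theorem aemeasurable_stepMap (hW : IsPreBrownianReal W P) (β : ℝ) (hβ : β < 1 / 2)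
    (e : HilbertBasis ℕ ℝ L2) (m : ℕ) :
    AEMeasurable (fun ω => stepMap β hβ e m fun j => cellIncr m j (path W ω)) P :=
  (continuous_stepMap β hβ e m).measurable.comp_aemeasurable (aemeasurable_cellIncr_pi hW m)

/-- One increment is isolated so that the rest is a function of increments independent of it, as
integration by parts requires. -/
theorem stepMap_eq_add (β : ℝ) (hβ : β < 1 / 2) (e : HilbertBasis ℕ ℝ L2) {m j : ℕ} (hj : j < m)
    (y : ℕ → ℝ) : stepMap β hβ e m y = (Real.sqrt m * y j) • stepCoord β hβ e m j
      + stepMap β hβ e m fun i => if i = j then 0 else y i := by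
  unfold stepMap
  rw [← Finset.add_sum_erase _ _ (Finset.mem_range.2 hj),
    ← Finset.add_sum_erase (Finset.range m) (fun i => (Real.sqrt m * if i = j then 0 else y i) •
      stepCoord β hβ e m i) (Finset.mem_range.2 hj)]
  simp only [if_true, mul_zero, zero_smul, zero_add]
  congr 1
  refine Finset.sum_congr rfl fun i hi => ?_
  rw [if_neg (Finset.ne_of_mem_erase hi)]

theorem indepFun_cellIncr (hW : IsPreBrownianReal W P) {m : ℕ} (hm : 1 ≤ m) (j : ℕ) :
    IndepFun (fun ω => cellIncr m j (path W ω))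
      (fun ω i => if i = j then 0 else cellIncr m i (path W ω)) P := by
  have e : ∀ i, (fun ω => if i = j then 0 else cellIncr m i (path W ω))
      = if i = j then (0 : Ω → ℝ) else fun ω => cellIncr m i (path W ω) := fun i => by
    split_ifs <;> rfl
  refine indepFun_of_mem_span hW (cellIncr_mem_span W m j)
    (Y := fun i ω => if i = j then 0 else cellIncr m i (path W ω)) (fun i => ?_) (fun i => ?_)
  · rw [e]
    split_ifs
    · exact Submodule.zero_mem _
    · exact cellIncr_mem_span W m i
  · by_cases h : i = j
    · simp [h]
    · simp only [h, if_false]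
      rw [integral_cellIncr_mul_cellIncr_self hW hm, if_neg (Ne.symm h)]

/-- Expand `⟪X, G X⟫` over the cells and integrate by parts in one increment at a time. The factor
`√m` of the expansion, the variance `1 / m` and the chain rule factor `√m` multiply to one, so the
two integrals agree term by term with the trace formula. -/
theorem hyp_nuDagger {β : ℝ} (hβ0 : 0 ≤ β) (hβ : β < 1 / 2) (e : HilbertBasis ℕ ℝ L2) {m : ℕ}
    (hm : 1 ≤ m) (hW : IsPreBrownianReal W P) (hH : Memℓp (HDagger β hβ e m) 2) :
    Hyp (⟨HDagger β hβ e m, hH⟩ : ℓ²(ℕ, L2)) 0 (nuDagger P W β e m) := by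
  intro G hG
  have hprob := hW.isGaussianProcess.isProbabilityMeasure
  obtain ⟨hd, hb, hL⟩ := hG.fderiv_bounds
  set C := (cbNorm 2 G).toReal
  have hGL := norm_sub_le_of_norm_fderiv_le hd hb
  have hm' : (0 : ℝ) < m := by exact_mod_cast hm
  have hcG : Continuous G := hd.continuous
  have hcG' : Continuous (fderiv ℝ G) :=
    (LipschitzWith.of_dist_le_mul (K := C.toNNReal) fun x y => by
      rw [dist_eq_norm, dist_eq_norm, Real.coe_toNNReal _ ENNReal.toReal_nonneg]
      exact hL x y).continuous
  set v := stepCoord β hβ e m with hv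
  set X : Ω → l2 := fun ω => stepMap β hβ e m fun j => cellIncr m j (path W ω) with hX
  have hXm : AEMeasurable X P := aemeasurable_stepMap hW β hβ e m
  have hXL : MemLp X 2 P := memLp_sum_smul_of_mem_span hW (Finset.range m)
    (a := fun j ω => Real.sqrt m * cellIncr m j (path W ω)) _
    fun j => Submodule.smul_mem _ (Real.sqrt m) (cellIncr_mem_span W m j)
  have hν : nuDagger P W β e m = P.map X := by
    rw [nuDagger]
    congr 1
    ext1 ω
    exact J_linInterp hβ0 hβ e m _
  have hcont1 : Continuous fun x : l2 => ⟪x, G x⟫_ℝ := continuous_id.inner hcG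
  have hcont2 : Continuous fun x : l2 => ∑ j ∈ Finset.range m, ⟪v j, fderiv ℝ G x (v j)⟫_ℝ :=
    continuous_finsetSum _ fun j _ => continuous_const.inner (hcG'.clm_apply continuous_const)
  have hδ := fun j => (memLp_and_integral_eq_zero_of_mem_span hW (cellIncr_mem_span W m j)).1
  have hint : ∀ j, Integrable (fun ω => cellIncr m j (path W ω) * ⟪v j, G (X ω)⟫_ℝ) P := by
    intro j
    refine MemLp.integrable_mul (hδ j) (MemLp.comp_of_lipschitz (F := fun x => ⟪v j, G x⟫_ℝ)
      (C := ‖v j‖ * C) (fun x y => ?_) hXL ?_)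
    · rw [← inner_sub_right, mul_assoc]
      exact (norm_inner_le_norm _ _).trans (mul_le_mul_of_nonneg_left (hGL x y) (norm_nonneg _))
    · exact (continuous_const.inner hcG).comp_aestronglyMeasurable hXL.aestronglyMeasurable
  have hint' : ∀ j, Integrable (fun ω => ⟪v j, fderiv ℝ G (X ω) (v j)⟫_ℝ) P := fun j =>
    Integrable.of_bound ((continuous_const.inner
      (hcG'.clm_apply continuous_const)).comp_aestronglyMeasurable hXL.aestronglyMeasurable)
      (‖v j‖ * (C * ‖v j‖)) (Eventually.of_forall fun ω =>
        (norm_inner_le_norm _ _).trans (mul_le_mul_of_nonneg_left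
          ((fderiv ℝ G (X ω)).le_of_opNorm_le (hb _) _) (norm_nonneg _)))
  have hibp : ∀ j ∈ Finset.range m, ∫ ω, cellIncr m j (path W ω) * ⟪v j, G (X ω)⟫_ℝ ∂P
      = (1 / m) * ∫ ω, Real.sqrt m * ⟪v j, fderiv ℝ G (X ω) (v j)⟫_ℝ ∂P := by
    intro j hj
    have hXj : ∀ ω, X ω = (Real.sqrt m * cellIncr m j (path W ω)) • v j
        + stepMap β hβ e m fun i => if i = j then 0 else cellIncr m i (path W ω) := fun ω =>
      stepMap_eq_add β hβ e (Finset.mem_range.1 hj) _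
    have hc : Continuous fun p : ℝ × (ℕ → ℝ) =>
        (Real.sqrt m * p.1) • v j + stepMap β hβ e m p.2 :=
      ((continuous_const.mul continuous_fst).smul continuous_const).add
        ((continuous_stepMap β hβ e m).comp continuous_snd)
    have key := IndepFun.integral_gaussian_mul (P := P)
      (f := fun ω => cellIncr m j (path W ω))
      (Y := fun ω i => if i = j then 0 else cellIncr m i (path W ω))
      (v := 1 / (m : ℝ≥0)) (by simpa using Nat.one_le_iff_ne_zero.1 hm) (hasLaw_cellIncr hW hm j)
      (aemeasurable_pi_iff.2 fun i => by
        split_ifs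
        · exact aemeasurable_const
        · exact aemeasurable_cellIncr hW m i)
      (indepFun_cellIncr hW hm j)
      (φ := fun p => ⟪v j, G ((Real.sqrt m * p.1) • v j + stepMap β hβ e m p.2)⟫_ℝ)
      (φ' := fun p => Real.sqrt m *
        ⟪v j, fderiv ℝ G ((Real.sqrt m * p.1) • v j + stepMap β hβ e m p.2) (v j)⟫_ℝ)
      (C := Real.sqrt m * (‖v j‖ * (C * ‖v j‖)))
      (continuous_const.inner (hcG.comp hc))
      (continuous_const.mul (continuous_const.inner ((hcG'.comp hc).clm_apply continuous_const)))
      (fun x y => by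
        have h1 : HasDerivAt (fun x : ℝ => (Real.sqrt m * x) • v j + stepMap β hβ e m y)
            (Real.sqrt m • v j) x := by
          have := (((hasDerivAt_id x).const_mul (Real.sqrt m)).smul_const (v j)).add_const
            (stepMap β hβ e m y)
          simpa using this
        have h2 := (hd _).hasFDerivAt.comp_hasDerivAt x h1
        have h3 := (innerSL ℝ (v j)).hasFDerivAt.comp_hasDerivAt x h2
        refine h3.congr_deriv ?_
        simp)
      (fun p => by
        rw [abs_mul, abs_of_nonneg (Real.sqrt_nonneg _)]
        refine mul_le_mul_of_nonneg_left ?_ (Real.sqrt_nonneg _)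
        exact (abs_real_inner_le_norm _ _).trans (mul_le_mul_of_nonneg_left
          ((fderiv ℝ G _).le_of_opNorm_le (hb _) _) (norm_nonneg _)))
      (by simpa only [← hXj] using hint j)
    simp only [← hXj] at key
    rw [key]
    push_cast
    rfl
  have hexp : ∀ ω, ⟪X ω, G (X ω)⟫_ℝ = ∑ j ∈ Finset.range m,
      Real.sqrt m * (cellIncr m j (path W ω) * ⟪v j, G (X ω)⟫_ℝ) := by
    intro ω
    have h : ⟪X ω, G (X ω)⟫_ℝ
        = ⟪stepMap β hβ e m fun j => cellIncr m j (path W ω), G (X ω)⟫_ℝ := rfl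
    rw [h, stepMap, sum_inner]
    refine Finset.sum_congr rfl fun j _ => ?_
    rw [real_inner_smul_left, mul_assoc]
  have hI1 : Integrable (fun ω => ⟪X ω, G (X ω)⟫_ℝ) P := by
    simp_rw [hexp]
    exact integrable_finsetSum _ fun j _ => (hint j).const_mul _
  simp only [trace_partialTrace_HDagger_comp, ← hv]
  rw [hν]
  refine ⟨(integrable_map_measure hcont1.aestronglyMeasurable hXm).2 hI1,
    (integrable_map_measure hcont2.aestronglyMeasurable hXm).2
      (integrable_finsetSum _ fun j _ => hint' j), ?_⟩
  rw [integral_map hXm hcont1.aestronglyMeasurable, integral_map hXm hcont2.aestronglyMeasurable]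
  simp_rw [hexp]
  rw [integral_finsetSum _ fun j _ => (hint j).const_mul _,
    integral_finsetSum _ fun j _ => hint' j]
  have : ∀ j ∈ Finset.range m,
      ∫ ω, Real.sqrt m * (cellIncr m j (path W ω) * ⟪v j, G (X ω)⟫_ℝ) ∂P
      = ∫ ω, ⟪v j, fderiv ℝ G (X ω) (v j)⟫_ℝ ∂P := by
    intro j hj
    rw [integral_const_mul, hibp j hj, integral_const_mul]
    have := Real.mul_self_sqrt hm'.le
    calc _ = (Real.sqrt m * Real.sqrt m) / m * ∫ ω, ⟪v j, fderiv ℝ G (X ω) (v j)⟫_ℝ ∂P := by ring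
      _ = _ := by rw [this, div_self hm'.ne', one_mul]
  rw [Finset.sum_congr rfl this, sub_self]
  simp

end

end BrownianStein

/-! ### Effect of refining the subdivision -/

namespace BrownianStein

open Filter Topology

section

variable {Ω : Type*} [MeasurableSpace Ω] {P : Measure Ω} {W : ℝ≥0 → Ω → ℝ}

theorem memLp_interpDeriv (hW : IsPreBrownianReal W P) (β : ℝ) (hβ : β < 1 / 2) (m : ℕ) :
    MemLp (fun ω => interpDeriv β hβ m (path W ω)) 2 P :=
  memLp_sum_smul_of_mem_span hW (Finset.range m)
    (a := fun j ω => m * cellIncr m j (path W ω)) _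
    fun j => Submodule.smul_mem _ (m : ℝ) (cellIncr_mem_span W m j)

theorem integral_norm_sq_interpDeriv (hW : IsPreBrownianReal W P) (β : ℝ) (hβ : β < 1 / 2) {m : ℕ}
    (hm : 1 ≤ m) :
    ∫ ω, ‖interpDeriv β hβ m (path W ω)‖ ^ 2 ∂P = interpEnergy β hβ m := by
  have hm' : (m : ℝ) ≠ 0 := by exact_mod_cast (Nat.one_le_iff_ne_zero.1 hm)
  have hmem := fun j => Submodule.smul_mem _ (m : ℝ) (cellIncr_mem_span W m j)
  simp_rw [← real_inner_self_eq_norm_sq]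
  refine (integral_inner_sum_smul hW (Finset.range m) (Finset.range m)
    (a := fun j ω => m * cellIncr m j (path W ω)) (b := fun j ω => m * cellIncr m j (path W ω))
    (cellVec β hβ m) (cellVec β hβ m) hmem hmem).trans ?_
  have e : ∀ i j, ∫ ω, (m * cellIncr m i (path W ω)) * (m * cellIncr m j (path W ω)) ∂P
      = if i = j then (m : ℝ) else 0 := by
    intro i j
    have h : ∀ ω, (m * cellIncr m i (path W ω)) * (m * cellIncr m j (path W ω))
        = (m * m : ℝ) * (cellIncr m i (path W ω) * cellIncr m j (path W ω)) := fun ω => by ring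
    simp_rw [h]
    rw [integral_const_mul, integral_cellIncr_mul_cellIncr_self hW hm]
    split_ifs
    · field_simp
    · rw [mul_zero]
  refine Finset.sum_congr rfl fun i hi => ?_
  simp only [e, ite_mul, zero_mul, Finset.sum_ite_eq, hi, if_true, real_inner_self_eq_norm_sq]

theorem integral_inner_interpDeriv_sub (hW : IsPreBrownianReal W P) (β : ℝ) (hβ : β < 1 / 2)
    {m q : ℕ} (hm : 1 ≤ m) (hq : 1 ≤ q) :
    ∫ ω, ⟪interpDeriv β hβ (m * q) (path W ω) - interpDeriv β hβ m (path W ω),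
      interpDeriv β hβ m (path W ω)⟫_ℝ ∂P = 0 := by
  simp_rw [interpDeriv_mul_sub β hβ m (Nat.one_le_iff_ne_zero.1 hq)]
  refine (integral_inner_sum_smul hW (Finset.range (m * q)) (Finset.range m)
    (a := fun i ω => (m * q : ℕ) * fineDev m q i (path W ω))
    (b := fun j ω => m * cellIncr m j (path W ω))
    (cellVec β hβ (m * q)) (cellVec β hβ m)
    (fun i => Submodule.smul_mem _ ((m * q : ℕ) : ℝ) (fineDev_mem_span W m q i))
    (fun j => Submodule.smul_mem _ (m : ℝ) (cellIncr_mem_span W m j))).trans ?_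
  refine Finset.sum_eq_zero fun i _ => Finset.sum_eq_zero fun j _ => ?_
  have h : ∀ ω, ((m * q : ℕ) * fineDev m q i (path W ω)) * (m * cellIncr m j (path W ω))
      = ((m * q : ℕ) * m : ℝ) * (fineDev m q i (path W ω) * cellIncr m j (path W ω)) :=
    fun ω => by ring
  simp_rw [h]
  rw [integral_const_mul, integral_fineDev_mul_cellIncr hW hm hq, mul_zero, zero_mul]

/-- Pythagoras: the refinement is orthogonal in mean to the coarse level, so its second moment is
the energy gained. -/
theorem integral_norm_sq_interpDeriv_sub (hW : IsPreBrownianReal W P) (β : ℝ) (hβ : β < 1 / 2)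
    {m q : ℕ} (hm : 1 ≤ m) (hq : 1 ≤ q) :
    ∫ ω, ‖interpDeriv β hβ (m * q) (path W ω) - interpDeriv β hβ m (path W ω)‖ ^ 2 ∂P
      = interpEnergy β hβ (m * q) - interpEnergy β hβ m := by
  have h1 := memLp_interpDeriv hW β hβ m
  have h2 := memLp_interpDeriv hW β hβ (m * q)
  have h3 := h2.sub h1
  have h0 := integral_inner_interpDeriv_sub hW β hβ hm hq
  have hI : Integrable (fun ω => ⟪interpDeriv β hβ (m * q) (path W ω)
      - interpDeriv β hβ m (path W ω), interpDeriv β hβ m (path W ω)⟫_ℝ) P :=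
    (h3.norm.integrable_mul h1.norm).mono'
      (h3.aestronglyMeasurable.inner h1.aestronglyMeasurable)
      (Eventually.of_forall fun ω => norm_inner_le_norm _ _)
  have e : ∀ ω, ‖interpDeriv β hβ (m * q) (path W ω) - interpDeriv β hβ m (path W ω)‖ ^ 2
      = ‖interpDeriv β hβ (m * q) (path W ω)‖ ^ 2 - ‖interpDeriv β hβ m (path W ω)‖ ^ 2
        - 2 * ⟪interpDeriv β hβ (m * q) (path W ω)
          - interpDeriv β hβ m (path W ω), interpDeriv β hβ m (path W ω)⟫_ℝ := fun ω => by
    rw [norm_sub_sq_real, inner_sub_left, real_inner_self_eq_norm_sq]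
    ring
  simp_rw [e]
  have hq1 : 1 ≤ m * q := Nat.mul_pos hm hq
  have i1 : Integrable (fun ω => ‖interpDeriv β hβ m (path W ω)‖ ^ 2) P :=
    h1.integrable_norm_pow two_ne_zero
  have i2 : Integrable (fun ω => ‖interpDeriv β hβ (m * q) (path W ω)‖ ^ 2) P :=
    h2.integrable_norm_pow two_ne_zero
  have i3 : Integrable (fun ω => ‖interpDeriv β hβ (m * q) (path W ω)‖ ^ 2
      - ‖interpDeriv β hβ m (path W ω)‖ ^ 2) P := i2.sub i1
  rw [integral_sub i3 (hI.const_mul 2), integral_sub i2 i1, integral_const_mul, h0,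
    integral_norm_sq_interpDeriv hW β hβ hm, integral_norm_sq_interpDeriv hW β hβ hq1, mul_zero,
    sub_zero]

theorem indepFun_fineDev (hW : IsPreBrownianReal W P) {m q : ℕ} (hm : 1 ≤ m) (hq : 1 ≤ q) (i : ℕ) :
    IndepFun (fun ω => fineDev m q i (path W ω)) (fun ω j => cellIncr m j (path W ω)) P :=
  indepFun_of_mem_span hW (Y := fun j ω => cellIncr m j (path W ω)) (fineDev_mem_span W m q i)
    (fun j => cellIncr_mem_span W m j) fun j => integral_fineDev_mul_cellIncr hW hm hq i j

/-- The effect on smooth functionals of refining the subdivision. -/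
theorem abs_integral_interpDeriv_sub_le (hW : IsPreBrownianReal W P) (β : ℝ) (hβ : β < 1 / 2)
    {m q : ℕ} (hm : 1 ≤ m) (hq : 1 ≤ q) {F : L2 → ℝ} {C : ℝ} (hd : Differentiable ℝ F)
    (hb : ∀ x, ‖fderiv ℝ F x‖ ≤ C) (hL : ∀ x y, ‖fderiv ℝ F x - fderiv ℝ F y‖ ≤ C * ‖x - y‖) :
    |∫ ω, F (interpDeriv β hβ (m * q) (path W ω)) ∂P - ∫ ω, F (interpDeriv β hβ m (path W ω)) ∂P|
      ≤ C / 2 * (interpEnergy β hβ (m * q) - interpEnergy β hβ m) := by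
  have hprob := hW.isGaussianProcess.isProbabilityMeasure
  have hC : 0 ≤ C := (norm_nonneg _).trans (hb 0)
  have hcF' : Continuous (fderiv ℝ F) :=
    (LipschitzWith.of_dist_le_mul (K := C.toNNReal) fun x y => by
      rw [dist_eq_norm, dist_eq_norm, Real.coe_toNNReal _ hC]
      exact hL x y).continuous
  have h1 := memLp_interpDeriv hW β hβ m
  have h2 := memLp_interpDeriv hW β hβ (m * q)
  have hFL := norm_sub_le_of_norm_fderiv_le hd hb
  have hF : ∀ n, Integrable (fun ω => F (interpDeriv β hβ n (path W ω))) P := fun n =>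
    (MemLp.comp_of_lipschitz hFL (memLp_interpDeriv hW β hβ n)
      (hd.continuous.comp_aestronglyMeasurable
        (memLp_interpDeriv hW β hβ n).aestronglyMeasurable)).integrable (by norm_num)
  set Ψ : (ℕ → ℝ) → L2 := fun y => ∑ j ∈ Finset.range m, (m * y j) • cellVec β hβ m j with hΨ
  have hΨc : Continuous Ψ := by
    rw [hΨ]
    fun_prop
  have hD : ∀ ω, interpDeriv β hβ m (path W ω) = Ψ fun j => cellIncr m j (path W ω) :=
    fun ω => rfl
  -- Each residual is centred and independent of the coarse increments, on which the derivative of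
  -- `F` at the coarse level depends; so the linear Taylor term has mean zero.
  have hterm : ∀ i, Integrable (fun ω => fineDev m q i (path W ω) *
      fderiv ℝ F (interpDeriv β hβ m (path W ω)) (cellVec β hβ (m * q) i)) P ∧
      ∫ ω, fineDev m q i (path W ω) *
        fderiv ℝ F (interpDeriv β hβ m (path W ω)) (cellVec β hβ (m * q) i) ∂P = 0 := by
    intro i
    obtain ⟨f1, f2⟩ := memLp_and_integral_eq_zero_of_mem_span hW (fineDev_mem_span W m q i)
    have hg : Continuous fun y => fderiv ℝ F (Ψ y) (cellVec β hβ (m * q) i) :=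
      (hcF'.comp hΨc).clm_apply continuous_const
    constructor
    · refine (f1.integrable (by norm_num)).mul_bdd (c := C * ‖cellVec β hβ (m * q) i‖)
        ((hcF'.clm_apply continuous_const).comp_aestronglyMeasurable h1.aestronglyMeasurable)
        (Eventually.of_forall fun ω => (fderiv ℝ F _).le_of_opNorm_le (hb _) _)
    · have := (indepFun_fineDev hW hm hq i).integral_fun_comp_mul_comp (f := fun x => x)
        (g := fun y => fderiv ℝ F (Ψ y) (cellVec β hβ (m * q) i))
        f1.aestronglyMeasurable.aemeasurable (aemeasurable_cellIncr_pi hW m)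
        continuous_id.aestronglyMeasurable hg.aestronglyMeasurable
      simp only [← hD] at this
      rw [this, f2, zero_mul]
  have hexp : ∀ ω, fderiv ℝ F (interpDeriv β hβ m (path W ω))
      (interpDeriv β hβ (m * q) (path W ω) - interpDeriv β hβ m (path W ω))
      = ∑ i ∈ Finset.range (m * q), ((m * q : ℕ) : ℝ) * (fineDev m q i (path W ω) *
        fderiv ℝ F (interpDeriv β hβ m (path W ω)) (cellVec β hβ (m * q) i)) := fun ω => by
    rw [interpDeriv_mul_sub β hβ m (Nat.one_le_iff_ne_zero.1 hq), map_sum]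
    refine Finset.sum_congr rfl fun i _ => ?_
    rw [map_smul, smul_eq_mul, mul_assoc]
  have hlin : Integrable (fun ω => fderiv ℝ F (interpDeriv β hβ m (path W ω))
      (interpDeriv β hβ (m * q) (path W ω) - interpDeriv β hβ m (path W ω))) P := by
    simp_rw [hexp]
    exact integrable_finsetSum _ fun i _ => (hterm i).1.const_mul _
  have hzero : ∫ ω, fderiv ℝ F (interpDeriv β hβ m (path W ω))
      (interpDeriv β hβ (m * q) (path W ω) - interpDeriv β hβ m (path W ω)) ∂P = 0 := by
    simp_rw [hexp]
    rw [integral_finsetSum _ fun i _ => (hterm i).1.const_mul _]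
    refine Finset.sum_eq_zero fun i _ => ?_
    rw [integral_const_mul, (hterm i).2, mul_zero]
  rw [← integral_sub (hF _) (hF _), ← integral_norm_sq_interpDeriv_sub hW β hβ hm hq,
    ← integral_const_mul]
  have hsub : ∫ ω, (F (interpDeriv β hβ (m * q) (path W ω)) - F (interpDeriv β hβ m (path W ω))) ∂P
      = ∫ ω, (F (interpDeriv β hβ (m * q) (path W ω)) - F (interpDeriv β hβ m (path W ω))
        - fderiv ℝ F (interpDeriv β hβ m (path W ω))
          (interpDeriv β hβ (m * q) (path W ω) - interpDeriv β hβ m (path W ω))) ∂P := by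
    have hs : Integrable (fun ω => F (interpDeriv β hβ (m * q) (path W ω))
      - F (interpDeriv β hβ m (path W ω))) P := (hF _).sub (hF _)
    rw [integral_sub hs hlin, hzero, sub_zero]
  rw [hsub]
  rw [← Real.norm_eq_abs]
  refine norm_integral_le_of_norm_le (g := fun ω => C / 2 *
      ‖interpDeriv β hβ (m * q) (path W ω) - interpDeriv β hβ m (path W ω)‖ ^ 2)
    (((h2.sub h1).integrable_norm_pow two_ne_zero).const_mul _) (Eventually.of_forall fun ω => ?_)
  have := norm_sub_sub_fderiv_le hd hL (interpDeriv β hβ m (path W ω))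
    (interpDeriv β hβ (m * q) (path W ω) - interpDeriv β hβ m (path W ω))
  rwa [add_sub_cancel] at this

/-- The upper estimate at level `n` and the lower one at level `m` share the term in `1 / (2 - 2β)`,
which cancels; the bound is therefore uniform in `n`. -/
theorem interpEnergy_sub_le {β : ℝ} (hβ0 : 0 ≤ β) (hβ : β < 1 / 2) {m n : ℕ} (hm : 1 ≤ m)
    (hn : 1 ≤ n) : interpEnergy β hβ n - interpEnergy β hβ m
      ≤ (m : ℝ) ^ (2 * β - 1) / ((1 - 2 * β) * Real.Gamma (1 - β) ^ 2) := by
  have h1 := interpEnergy_le hβ hn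
  have h2 := le_interpEnergy hβ0 hβ hm
  rw [mul_sub] at h2
  rw [div_eq_mul_one_div, mul_comm]
  linarith

/-- The subdivision points of `[0,1]`. -/
noncomputable def gridTimes (m : ℕ) : Finset ℝ≥0 :=
  (Finset.range (m + 1)).image fun j : ℕ => ((j : ℝ) / m).toNNReal

/-- `𝔍_β` of the linear interpolation, as a function of the values at the subdivision points. -/
noncomputable def gridMap (β : ℝ) (hβ : β < 1 / 2) (e : HilbertBasis ℕ ℝ L2) (m : ℕ)
    (x : gridTimes m → ℝ) : l2 :=
  stepMap β hβ e m fun j => cellIncr m j fun t =>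
    if h : t.toNNReal ∈ gridTimes m then x ⟨t.toNNReal, h⟩ else 0

theorem measurable_gridMap (β : ℝ) (hβ : β < 1 / 2) (e : HilbertBasis ℕ ℝ L2) (m : ℕ) :
    Measurable (gridMap β hβ e m) := by
  refine ((continuous_stepMap β hβ e m).comp (continuous_pi fun j => ?_)).measurable
  have h : ∀ t : ℝ, Continuous fun x : gridTimes m → ℝ =>
      if h : t.toNNReal ∈ gridTimes m then x ⟨t.toNNReal, h⟩ else 0 := fun t => by
    split_ifs <;> fun_prop
  exact (h _).sub (h _)

/-- The law is expressed through the Brownian marginal at the grid times, so it depends neither on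
the probability space nor on the process chosen. -/
theorem nuDagger_eq_map_projectiveFamily (hW : IsPreBrownianReal W P) {β : ℝ} (hβ0 : 0 ≤ β)
    (hβ : β < 1 / 2) (e : HilbertBasis ℕ ℝ L2) (m : ℕ) :
    nuDagger P W β e m = (BrownianReal.projectiveFamily (gridTimes m)).map (gridMap β hβ e m) := by
  rw [← (hW.hasLaw (gridTimes m)).map_eq, AEMeasurable.map_map_of_aemeasurable
    (measurable_gridMap β hβ e m).aemeasurable (hW.hasLaw _).aemeasurable, nuDagger]
  congr 1
  ext1 ω
  rw [J_linInterp hβ0 hβ, Function.comp_apply, gridMap]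
  unfold stepMap
  refine Finset.sum_congr rfl fun j hj => ?_
  have hj' := Finset.mem_range.1 hj
  have h1 : (((j : ℝ) + 1) / m).toNNReal ∈ gridTimes m :=
    Finset.mem_image.2 ⟨j + 1, Finset.mem_range.2 (by omega), by push_cast; rfl⟩
  have h2 : ((j : ℝ) / m).toNNReal ∈ gridTimes m :=
    Finset.mem_image.2 ⟨j, Finset.mem_range.2 (by omega), rfl⟩
  simp only [cellIncr, h1, h2, dif_pos]
  rfl

end

end BrownianStein

/-! ### Passage to the limit along dyadic refinements -/

namespace BrownianStein

open Filter Topology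

theorem exists_tendsto_of_tsum_edist_ne_top {E : Type*} [NormedAddCommGroup E] [CompleteSpace E]
    {f : ℕ → E} (h : ∑' k, ‖f (k + 1) - f k‖ₑ ≠ ⊤) : ∃ x, Tendsto f atTop (𝓝 x) := by
  have h' : ∑' k, edist (f k) (f (k + 1)) ≠ ⊤ := by
    simpa only [edist_comm (f _) (f (_ + 1)), edist_eq_enorm_sub] using h
  exact cauchySeq_tendsto_of_complete
    (cauchySeq_of_edist_le_of_tsum_ne_top _ (fun _ => le_rfl) h')

section

variable {Ω : Type*} [MeasurableSpace Ω] {P : Measure Ω} {W : ℝ≥0 → Ω → ℝ}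

theorem ae_continuous_path (hW : IsBrownianReal W P) :
    ∀ᵐ ω ∂P, Continuous (path W ω) ∧ path W ω 0 = 0 := by
  filter_upwards [hW.cont, hW.eval_zero_ae_eq_zero] with ω h1 h2
  refine ⟨h1.comp continuous_real_toNNReal, ?_⟩
  simpa [path] using h2

/-- Instead of Cauchy–Schwarz, `a ≤ s/2 + a²/(2s)` converts the energy bound into an `L¹` bound,
with `s` free to be matched to the level. -/
theorem lintegral_enorm_interpDeriv_sub_le (hW : IsPreBrownianReal W P) {β : ℝ} (hβ0 : 0 ≤ β)
    (hβ : β < 1 / 2) {n : ℕ} (hn : 1 ≤ n) {s : ℝ} (hs : 0 < s) :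
    ∫⁻ ω, ‖interpDeriv β hβ (n * 2) (path W ω) - interpDeriv β hβ n (path W ω)‖ₑ ∂P
      ≤ ENNReal.ofReal ((s + (n : ℝ) ^ (2 * β - 1) /
        ((1 - 2 * β) * Real.Gamma (1 - β) ^ 2) / s) / 2) := by
  have hprob := hW.isGaussianProcess.isProbabilityMeasure
  have h3 := (memLp_interpDeriv hW β hβ (n * 2)).sub (memLp_interpDeriv hW β hβ n)
  have hsq : Integrable (fun ω => ‖interpDeriv β hβ (n * 2) (path W ω)
      - interpDeriv β hβ n (path W ω)‖ ^ 2) P := h3.integrable_norm_pow two_ne_zero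
  have hi : Integrable (fun ω => interpDeriv β hβ (n * 2) (path W ω)
      - interpDeriv β hβ n (path W ω)) P := h3.integrable (by norm_num)
  rw [← ofReal_integral_norm_eq_lintegral_enorm hi]
  refine ENNReal.ofReal_le_ofReal ?_
  calc ∫ ω, ‖interpDeriv β hβ (n * 2) (path W ω) - interpDeriv β hβ n (path W ω)‖ ∂P
      ≤ ∫ ω, (s / 2 + (1 / (2 * s)) * ‖interpDeriv β hβ (n * 2) (path W ω)
          - interpDeriv β hβ n (path W ω)‖ ^ 2) ∂P := by
        refine integral_mono hi.norm ((integrable_const _).add (hsq.const_mul _)) fun ω => ?_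
        have key : ∀ a : ℝ, a ≤ s / 2 + 1 / (2 * s) * a ^ 2 := fun a => by
          have : s / 2 + 1 / (2 * s) * a ^ 2 - a = (a - s) ^ 2 / (2 * s) := by
            field_simp
            ring
          have h2 : 0 ≤ (a - s) ^ 2 / (2 * s) := by positivity
          linarith
        exact key _
    _ = s / 2 + (1 / (2 * s)) * (interpEnergy β hβ (n * 2) - interpEnergy β hβ n) := by
        rw [integral_add (integrable_const _) (hsq.const_mul _), integral_const_mul,
          integral_norm_sq_interpDeriv_sub hW β hβ hn (by norm_num)]
        simp
    _ ≤ s / 2 + (1 / (2 * s)) * ((n : ℝ) ^ (2 * β - 1) /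
          ((1 - 2 * β) * Real.Gamma (1 - β) ^ 2)) := by
        gcongr
        exact interpEnergy_sub_le hβ0 hβ hn (by omega)
    _ = _ := by field_simp

theorem tsum_lintegral_enorm_interpDeriv_sub_ne_top (hW : IsPreBrownianReal W P) {β : ℝ}
    (hβ0 : 0 ≤ β) (hβ : β < 1 / 2) {m : ℕ} (hm : 1 ≤ m) :
    ∑' k : ℕ, ∫⁻ ω, ‖interpDeriv β hβ (m * 2 ^ (k + 1)) (path W ω)
      - interpDeriv β hβ (m * 2 ^ k) (path W ω)‖ₑ ∂P ≠ ⊤ := by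
  -- The energy gain at level `m * 2 ^ k` is at most `A r ^ (2 k)`, so the choice `s = r ^ k` gives
  -- the geometric bound `(1 + A) / 2 * r ^ k`; `β < 1/2` ensures `r < 1`.
  set r : ℝ := (2 : ℝ) ^ ((2 * β - 1) / 2) with hr
  have hr0 : 0 < r := Real.rpow_pos_of_pos two_pos _
  have hr1 : r < 1 := Real.rpow_lt_one_of_one_lt_of_neg one_lt_two (by linarith)
  set A : ℝ := (m : ℝ) ^ (2 * β - 1) / ((1 - 2 * β) * Real.Gamma (1 - β) ^ 2) with hA
  have hA0 : 0 ≤ A := div_nonneg (Real.rpow_nonneg (Nat.cast_nonneg _) _)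
    (mul_nonneg (by linarith) (sq_nonneg _))
  have hle : ∀ k : ℕ, ∫⁻ ω, ‖interpDeriv β hβ (m * 2 ^ (k + 1)) (path W ω)
      - interpDeriv β hβ (m * 2 ^ k) (path W ω)‖ₑ ∂P ≤ ENNReal.ofReal ((1 + A) / 2 * r ^ k) := by
    intro k
    have h := lintegral_enorm_interpDeriv_sub_le hW hβ0 hβ (n := m * 2 ^ k)
      (Nat.mul_pos hm (by positivity)) (s := r ^ k) (by positivity)
    rw [mul_assoc, ← pow_succ] at h
    refine h.trans (le_of_eq ?_)
    congr 1
    have e : ((m * 2 ^ k : ℕ) : ℝ) ^ (2 * β - 1) = (m : ℝ) ^ (2 * β - 1) * (r ^ k * r ^ k) := by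
      push_cast
      rw [Real.mul_rpow (Nat.cast_nonneg _) (by positivity), ← mul_pow, hr,
        ← Real.rpow_add two_pos, add_halves, ← Real.rpow_natCast, ← Real.rpow_natCast,
        ← Real.rpow_mul zero_le_two, ← Real.rpow_mul zero_le_two, mul_comm (k : ℝ)]
    rw [e, hA]
    have : r ^ k ≠ 0 := by positivity
    field_simp
  refine ne_top_of_le_ne_top ?_ (ENNReal.tsum_le_tsum hle)
  rw [← ENNReal.ofReal_tsum_of_nonneg (fun k => by positivity)
    ((summable_geometric_of_lt_one hr0.le hr1).mul_left _)]
  exact ENNReal.ofReal_ne_top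

theorem tendsto_mul_two_pow {m : ℕ} (hm : 1 ≤ m) :
    Tendsto (fun k : ℕ => m * 2 ^ k) atTop atTop := by
  refine tendsto_atTop_mono (fun k => ?_) (tendsto_pow_atTop_atTop_of_one_lt (one_lt_two (α := ℕ)))
  exact Nat.le_mul_of_pos_left _ hm

/-- Finite expected total change makes the sequence almost surely Cauchy in `L²([0,1])`. Its limit
is the fractional derivative of the path by closedness, since the interpolations converge pointwise;
in particular the path lies in the Besov–Liouville space. -/
theorem ae_tendsto_interpDeriv (hW : IsBrownianReal W P) {β : ℝ} (hβ0 : 0 ≤ β) (hβ : β < 1 / 2)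
    {m : ℕ} (hm : 1 ≤ m) :
    ∀ᵐ ω ∂P, MemBesov β (path W ω) ∧
      Tendsto (fun k : ℕ => interpDeriv β hβ (m * 2 ^ k) (path W ω)) atTop
        (𝓝 (fracDeriv β (path W ω))) := by
  have hW' := hW.toIsPreBrownianReal
  have hfin := tsum_lintegral_enorm_interpDeriv_sub_ne_top hW' hβ0 hβ hm
  have hmeas : ∀ k : ℕ, AEMeasurable (fun ω => ‖interpDeriv β hβ (m * 2 ^ (k + 1)) (path W ω)
      - interpDeriv β hβ (m * 2 ^ k) (path W ω)‖ₑ) P := fun k =>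
    ((memLp_interpDeriv hW' β hβ _).sub (memLp_interpDeriv hW' β hβ _)).aestronglyMeasurable.enorm
  rw [← lintegral_tsum hmeas] at hfin
  filter_upwards [ae_lt_top' (AEMeasurable.tsum hmeas) hfin, ae_continuous_path hW]
    with ω h1 h2
  obtain ⟨x, hx⟩ := exists_tendsto_of_tsum_edist_ne_top
    (f := fun k : ℕ => interpDeriv β hβ (m * 2 ^ k) (path W ω)) h1.ne
  have hfd : IsFracDeriv β (path W ω) x :=
    IsFracDeriv.of_tendsto hβ0 (fun k => isFracDeriv_linInterp hβ0 hβ (m * 2 ^ k) (path W ω)) hx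
      fun t ht => tendsto_linInterp h2.1 h2.2 (tendsto_mul_two_pow hm) ht
  refine ⟨⟨x, hfd⟩, ?_⟩
  rwa [hfd.fracDeriv_eq hβ0 (by linarith)]

theorem aestronglyMeasurable_fracDeriv_path (hW : IsBrownianReal W P) {β : ℝ} (hβ0 : 0 ≤ β)
    (hβ : β < 1 / 2) : AEStronglyMeasurable (fun ω => fracDeriv β (path W ω)) P :=
  aestronglyMeasurable_of_tendsto_ae atTop
    (fun k : ℕ => (memLp_interpDeriv hW.toIsPreBrownianReal β hβ (1 * 2 ^ k)).aestronglyMeasurable)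
    ((ae_tendsto_interpDeriv hW hβ0 hβ le_rfl).mono fun _ h => h.2)

/-- The distance to the limit is at most the sum of the remaining changes, whose expectation is the
tail of a convergent series. -/
theorem tendsto_lintegral_interpDeriv_sub (hW : IsBrownianReal W P) {β : ℝ} (hβ0 : 0 ≤ β)
    (hβ : β < 1 / 2) {m : ℕ} (hm : 1 ≤ m) :
    Tendsto (fun k : ℕ => ∫⁻ ω, ‖interpDeriv β hβ (m * 2 ^ k) (path W ω)
      - fracDeriv β (path W ω)‖ₑ ∂P) atTop (𝓝 0) := by
  have hW' := hW.toIsPreBrownianReal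
  have hfin := tsum_lintegral_enorm_interpDeriv_sub_ne_top hW' hβ0 hβ hm
  have hmeas : ∀ k : ℕ, AEMeasurable (fun ω => ‖interpDeriv β hβ (m * 2 ^ (k + 1)) (path W ω)
      - interpDeriv β hβ (m * 2 ^ k) (path W ω)‖ₑ) P := fun k =>
    ((memLp_interpDeriv hW' β hβ _).sub (memLp_interpDeriv hW' β hβ _)).aestronglyMeasurable.enorm
  refine tendsto_of_tendsto_of_tendsto_of_le_of_le tendsto_const_nhds
    (ENNReal.tendsto_sum_nat_add _ hfin) (fun _ => zero_le) fun k => ?_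
  simp only
  rw [← lintegral_tsum fun l => hmeas (l + k)]
  refine lintegral_mono_ae ?_
  filter_upwards [ae_tendsto_interpDeriv hW hβ0 hβ hm] with ω h
  have := edist_le_tsum_of_edist_le_of_tendsto
    (f := fun k : ℕ => interpDeriv β hβ (m * 2 ^ k) (path W ω))
    (fun k => ‖interpDeriv β hβ (m * 2 ^ (k + 1)) (path W ω)
      - interpDeriv β hβ (m * 2 ^ k) (path W ω)‖ₑ)
    (fun k => by rw [edist_comm, edist_eq_enorm_sub]) h.2 k
  rw [edist_eq_enorm_sub] at this
  refine this.trans (le_of_eq (tsum_congr fun l => ?_))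
  rw [add_comm k l]

theorem integrable_fracDeriv_path (hW : IsBrownianReal W P) {β : ℝ} (hβ0 : 0 ≤ β)
    (hβ : β < 1 / 2) : Integrable (fun ω => fracDeriv β (path W ω)) P := by
  have hprob := hW.isGaussianProcess.isProbabilityMeasure
  have h := tendsto_lintegral_interpDeriv_sub hW hβ0 hβ (m := 1) le_rfl
  obtain ⟨k, hk⟩ := (h.eventually (gt_mem_nhds ENNReal.zero_lt_top)).exists
  have h1 : Integrable (fun ω => interpDeriv β hβ (1 * 2 ^ k) (path W ω)) P :=
    (memLp_interpDeriv hW.toIsPreBrownianReal β hβ _).integrable (by norm_num)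
  have h2 : Integrable (fun ω => interpDeriv β hβ (1 * 2 ^ k) (path W ω)
      - fracDeriv β (path W ω)) P :=
    ⟨h1.aestronglyMeasurable.sub (aestronglyMeasurable_fracDeriv_path hW hβ0 hβ), hk⟩
  exact (h1.sub h2).congr (Eventually.of_forall fun ω => by simp)

theorem integrable_comp_fracDeriv (hW : IsBrownianReal W P) {β : ℝ} (hβ0 : 0 ≤ β)
    (hβ : β < 1 / 2) {F : L2 → ℝ} {C : ℝ} (hc : Continuous F)
    (hL : ∀ x y, ‖F x - F y‖ ≤ C * ‖x - y‖) :
    Integrable (fun ω => F (fracDeriv β (path W ω))) P := by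
  have hprob := hW.isGaussianProcess.isProbabilityMeasure
  have h := integrable_fracDeriv_path hW hβ0 hβ
  exact memLp_one_iff_integrable.1 (MemLp.comp_of_lipschitz hL (memLp_one_iff_integrable.2 h)
    (hc.comp_aestronglyMeasurable h.aestronglyMeasurable))

theorem tendsto_integral_interpDeriv (hW : IsBrownianReal W P) {β : ℝ} (hβ0 : 0 ≤ β)
    (hβ : β < 1 / 2) {m : ℕ} (hm : 1 ≤ m) {F : L2 → ℝ} {C : ℝ} (hc : Continuous F)
    (hL : ∀ x y, ‖F x - F y‖ ≤ C * ‖x - y‖) :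
    Tendsto (fun k : ℕ => ∫ ω, F (interpDeriv β hβ (m * 2 ^ k) (path W ω)) ∂P) atTop
      (𝓝 (∫ ω, F (fracDeriv β (path W ω)) ∂P)) := by
  have hprob := hW.isGaussianProcess.isProbabilityMeasure
  refine tendsto_integral_of_L1 _ (integrable_comp_fracDeriv hW hβ0 hβ hc hL).aestronglyMeasurable
    (Eventually.of_forall fun k => ?_) ?_
  · have h := memLp_interpDeriv hW.toIsPreBrownianReal β hβ (m * 2 ^ k)
    exact (MemLp.comp_of_lipschitz hL h
      (hc.comp_aestronglyMeasurable h.aestronglyMeasurable)).integrable (by norm_num)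
  · have h1 := ENNReal.Tendsto.const_mul (a := ENNReal.ofReal C)
      (tendsto_lintegral_interpDeriv_sub hW hβ0 hβ hm) (Or.inr ENNReal.ofReal_ne_top)
    rw [mul_zero] at h1
    refine tendsto_of_tendsto_of_tendsto_of_le_of_le tendsto_const_nhds h1
      (fun _ => zero_le) fun k => ?_
    simp only
    rw [← lintegral_const_mul' _ _ ENNReal.ofReal_ne_top]
    refine lintegral_mono fun ω => ?_
    have hx := hL (interpDeriv β hβ (m * 2 ^ k) (path W ω)) (fracDeriv β (path W ω))
    rw [← ofReal_norm, ← ofReal_norm, ← ENNReal.ofReal_mul' (norm_nonneg _)]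
    exact ENNReal.ofReal_le_ofReal hx

/-- Quantitative approximation of smooth functionals of Brownian motion by its interpolations. -/
theorem abs_integral_interpDeriv_sub_integral_fracDeriv_le (hW : IsBrownianReal W P) {β : ℝ}
    (hβ0 : 0 ≤ β) (hβ : β < 1 / 2) {m : ℕ} (hm : 1 ≤ m) {F : L2 → ℝ} {C : ℝ}
    (hd : Differentiable ℝ F) (hb : ∀ x, ‖fderiv ℝ F x‖ ≤ C)
    (hL : ∀ x y, ‖fderiv ℝ F x - fderiv ℝ F y‖ ≤ C * ‖x - y‖) :
    |∫ ω, F (fracDeriv β (path W ω)) ∂P - ∫ ω, F (interpDeriv β hβ m (path W ω)) ∂P|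
      ≤ C / 2 * ((m : ℝ) ^ (2 * β - 1) / ((1 - 2 * β) * Real.Gamma (1 - β) ^ 2)) := by
  have hC : 0 ≤ C := (norm_nonneg _).trans (hb 0)
  refine le_of_tendsto (((tendsto_integral_interpDeriv hW hβ0 hβ hm hd.continuous
    (norm_sub_le_of_norm_fderiv_le hd hb)).sub_const _).abs) (Eventually.of_forall fun k => ?_)
  have h2 : 1 ≤ 2 ^ k := Nat.one_le_two_pow
  refine (abs_integral_interpDeriv_sub_le hW.toIsPreBrownianReal β hβ hm h2 hd hb hL).trans ?_
  exact mul_le_mul_of_nonneg_left (interpEnergy_sub_le hβ0 hβ hm (Nat.mul_pos hm h2))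
    (by positivity)

/-! ### The laws on `l²` -/

theorem aemeasurable_J_linInterp (hW : IsPreBrownianReal W P) {β : ℝ} (hβ0 : 0 ≤ β)
    (hβ : β < 1 / 2) (e : HilbertBasis ℕ ℝ L2) (m : ℕ) :
    AEMeasurable (fun ω => J β e (linInterp m (path W ω))) P := by
  simp_rw [J_linInterp hβ0 hβ]
  exact aemeasurable_stepMap hW β hβ e m

theorem aemeasurable_J_path (hW : IsBrownianReal W P) {β : ℝ} (hβ0 : 0 ≤ β)
    (hβ : β < 1 / 2) (e : HilbertBasis ℕ ℝ L2) : AEMeasurable (fun ω => J β e (path W ω)) P :=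
  (e.repr.continuous.comp_aestronglyMeasurable
    (aestronglyMeasurable_fracDeriv_path hW hβ0 hβ)).aemeasurable

theorem integral_nuDagger (hW : IsPreBrownianReal W P) {β : ℝ} (hβ0 : 0 ≤ β)
    (hβ : β < 1 / 2) (e : HilbertBasis ℕ ℝ L2) (m : ℕ) {F : l2 → ℝ} (hF : Continuous F) :
    ∫ x, F x ∂nuDagger P W β e m = ∫ ω, F (e.repr (interpDeriv β hβ m (path W ω))) ∂P := by
  rw [nuDagger, integral_map (aemeasurable_J_linInterp hW hβ0 hβ e m) hF.aestronglyMeasurable]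
  simp_rw [J_linInterp hβ0 hβ, repr_interpDeriv]

theorem integral_mBeta (hW : IsBrownianReal W P) {β : ℝ} (hβ0 : 0 ≤ β)
    (hβ : β < 1 / 2) (e : HilbertBasis ℕ ℝ L2) {F : l2 → ℝ} (hF : Continuous F) :
    ∫ x, F x ∂mBeta P W β e = ∫ ω, F (e.repr (fracDeriv β (path W ω))) ∂P :=
  integral_map (aemeasurable_J_path hW hβ0 hβ e) hF.aestronglyMeasurable

/-- Test functions on `l²` transported to `L²([0,1])` keep their bounds. -/
theorem MemCb.fderiv_bounds_comp_repr {F : l2 → ℝ} (hF : MemCb 2 F) (e : HilbertBasis ℕ ℝ L2) :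
    Differentiable ℝ (fun f => F (e.repr f)) ∧
      (∀ x, ‖fderiv ℝ (fun f => F (e.repr f)) x‖ ≤ (cbNorm 2 F).toReal) ∧
      ∀ x y, ‖fderiv ℝ (fun f => F (e.repr f)) x - fderiv ℝ (fun f => F (e.repr f)) y‖
        ≤ (cbNorm 2 F).toReal * ‖x - y‖ := by
  obtain ⟨hd, hb, hL⟩ := hF.fderiv_bounds
  set R : L2 →L[ℝ] l2 := e.repr.toContinuousLinearEquiv.toContinuousLinearMap
  have hR : ‖R‖ ≤ 1 := R.opNorm_le_bound zero_le_one fun x => by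
    rw [one_mul]
    exact (e.repr.norm_map x).le
  have hf : ∀ x, HasFDerivAt (fun f => F (e.repr f)) (fderiv ℝ F (e.repr x) ∘L R) x := fun x =>
    (hd (e.repr x)).hasFDerivAt.comp x R.hasFDerivAt
  have hcomp : ∀ A : l2 →L[ℝ] ℝ, ‖A ∘L R‖ ≤ ‖A‖ := fun A =>
    (A.opNorm_comp_le R).trans (mul_le_of_le_one_right (norm_nonneg _) hR)
  refine ⟨fun x => (hf x).differentiableAt, fun x => ?_, fun x y => ?_⟩
  · rw [(hf x).fderiv]
    exact (hcomp _).trans (hb _)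
  · rw [(hf x).fderiv, (hf y).fderiv, ← ContinuousLinearMap.sub_comp]
    refine (hcomp _).trans ((hL _ _).trans (le_of_eq ?_))
    rw [← map_sub, e.repr.norm_map]

theorem integrable_nuDagger (hW : IsPreBrownianReal W P) {β : ℝ} (hβ0 : 0 ≤ β)
    (hβ : β < 1 / 2) (e : HilbertBasis ℕ ℝ L2) (m : ℕ) {F : l2 → ℝ} (hF : MemCb 2 F) :
    Integrable F (nuDagger P W β e m) := by
  have hprob := hW.isGaussianProcess.isProbabilityMeasure
  obtain ⟨hd, hb, -⟩ := hF.fderiv_bounds_comp_repr e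
  refine (integrable_map_measure hF.fderiv_bounds.1.continuous.aestronglyMeasurable
    (aemeasurable_J_linInterp hW hβ0 hβ e m)).2 ?_
  have h := memLp_interpDeriv hW β hβ m
  refine ((MemLp.comp_of_lipschitz (norm_sub_le_of_norm_fderiv_le hd hb) h
    (hd.continuous.comp_aestronglyMeasurable h.aestronglyMeasurable)).integrable
    (by norm_num)).congr (Eventually.of_forall fun ω => ?_)
  simp only [Function.comp_apply, J_linInterp hβ0 hβ, repr_interpDeriv]

theorem integrable_mBeta (hW : IsBrownianReal W P) {β : ℝ} (hβ0 : 0 ≤ β)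
    (hβ : β < 1 / 2) (e : HilbertBasis ℕ ℝ L2) {F : l2 → ℝ} (hF : MemCb 2 F) :
    Integrable F (mBeta P W β e) := by
  obtain ⟨hd, hb, -⟩ := hF.fderiv_bounds_comp_repr e
  exact (integrable_map_measure hF.fderiv_bounds.1.continuous.aestronglyMeasurable
    (aemeasurable_J_path hW hβ0 hβ e)).2
    (integrable_comp_fracDeriv hW hβ0 hβ hd.continuous (norm_sub_le_of_norm_fderiv_le hd hb))

theorem rho_nuDagger_mBeta_le (hW : IsBrownianReal W P) {β : ℝ} (hβ0 : 0 ≤ β)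
    (hβ : β < 1 / 2) (e : HilbertBasis ℕ ℝ L2) {m : ℕ} (hm : 1 ≤ m) :
    rho 2 (nuDagger P W β e m) (mBeta P W β e) ≤
      (((m : ℝ) ^ (2 * β - 1) / (2 * (1 - 2 * β) * Real.Gamma (1 - β) ^ 2) : ℝ) : EReal) := by
  refine iSup_le fun F => ?_
  obtain ⟨F, hF, hF1⟩ := F
  obtain ⟨hd, hb, hL⟩ := hF.fderiv_bounds_comp_repr e
  -- The test function constant is at most one; the Taylor factor `C / 2` then supplies the `2` in
  -- the denominator of the bound.
  have hC : (cbNorm 2 F).toReal ≤ 1 := ENNReal.toReal_le_of_le_ofReal zero_le_one (by simpa using hF1)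
  have h := abs_integral_interpDeriv_sub_integral_fracDeriv_le hW hβ0 hβ hm hd hb hL
  have hc := hF.fderiv_bounds.1.continuous
  rw [EReal.coe_le_coe_iff, integral_nuDagger hW.toIsPreBrownianReal hβ0 hβ e m hc,
    integral_mBeta hW hβ0 hβ e hc]
  rw [abs_sub_comm] at h
  refine (le_abs_self _).trans (h.trans ?_)
  have hA : 0 ≤ (m : ℝ) ^ (2 * β - 1) / ((1 - 2 * β) * Real.Gamma (1 - β) ^ 2) :=
    div_nonneg (Real.rpow_nonneg (Nat.cast_nonneg _) _) (mul_nonneg (by linarith) (sq_nonneg _))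
  calc _ ≤ 1 / 2 * ((m : ℝ) ^ (2 * β - 1) / ((1 - 2 * β) * Real.Gamma (1 - β) ^ 2)) := by gcongr
    _ = _ := by
      rw [div_mul_div_comm, one_mul, mul_assoc]

end

end BrownianStein


theorem mainTheorem4
    {Ω Ω' : Type*} [MeasurableSpace Ω] [MeasurableSpace Ω']
    (P : Measure Ω) (P' : Measure Ω')
    (B : ℝ≥0 → Ω → ℝ) (hB : IsBrownianReal B P)
    (W : ℝ≥0 → Ω' → ℝ) (hW : IsBrownianReal W P')
    (β : ℝ) (hβ0 : 0 ≤ β) (hβ : β < 1 / 2)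
    (e : HilbertBasis ℕ ℝ L2) (m : ℕ) (hm : 1 ≤ m) :
    -- the two laws are well defined probability measures on `l²`
    (∀ ω, MemBesov β (linInterp m (path B ω))) ∧
    (∀ᵐ ω ∂P', MemBesov β (path W ω)) ∧
    IsProbabilityMeasure (nuDagger P B β e m) ∧
    IsProbabilityMeasure (mBeta P' W β e) ∧
    -- `H_m^†` belongs to `l² ⊗ L²` and `Hyp(L², H_m^†, 0)` holds
    (∃ hH : Memℓp (HDagger β hβ e m) 2,
      Hyp (⟨HDagger β hβ e m, hH⟩ : ℓ²(ℕ, L2)) 0 (nuDagger P B β e m)) ∧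
    -- test functions are integrable, and the bound on `ρ₂` holds
    (∀ F : l2 → ℝ, MemCb 2 F →
      Integrable F (nuDagger P B β e m) ∧ Integrable F (mBeta P' W β e)) ∧
    rho 2 (nuDagger P B β e m) (mBeta P' W β e) ≤
      (((m : ℝ) ^ (2 * β - 1) / (2 * (1 - 2 * β) * Real.Gamma (1 - β) ^ 2) : ℝ) : EReal) := by
  have hP := hB.isGaussianProcess.isProbabilityMeasure
  have hP' := hW.isGaussianProcess.isProbabilityMeasure
  refine ⟨fun ω => ⟨_, isFracDeriv_linInterp hβ0 hβ m _⟩,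
    (ae_tendsto_interpDeriv hW hβ0 hβ hm).mono fun _ h => h.1,
    Measure.isProbabilityMeasure_map (aemeasurable_J_linInterp hB.toIsPreBrownianReal hβ0 hβ e m),
    Measure.isProbabilityMeasure_map (aemeasurable_J_path hW hβ0 hβ e),
    ⟨memℓp_HDagger β hβ e m, hyp_nuDagger hβ0 hβ e hm hB.toIsPreBrownianReal _⟩,
    fun F hF => ⟨integrable_nuDagger hB.toIsPreBrownianReal hβ0 hβ e m hF,
      integrable_mBeta hW hβ0 hβ e hF⟩, ?_⟩
  -- The law of the interpolation is unchanged when `B` is replaced by `W`, so the coupling on `Ω'`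
  -- applies.
  rw [nuDagger_eq_map_projectiveFamily hB.toIsPreBrownianReal hβ0 hβ e m,
    ← nuDagger_eq_map_projectiveFamily hW.toIsPreBrownianReal hβ0 hβ e m]
  exact rho_nuDagger_mBeta_le hW hβ0 hβ e hm
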